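/- All graphs are finite and simple. An $r$-partite graph comes with a partition of its vertex set into $r$ independent sets, its parts; for an integer $m\ge 0$, an $m$-IT of it is an independent set of exactly $m$ vertices containing at most one vertex of each part. For integers $r, D\ge 1$ and $\Delta\ge 0$, let $n(r,D,\Delta)$ denote the largest integer $n\ge 0$ for which there is an $r$-partite graph with at least $n$ vertices in each part, with maximum degree $\Delta$, and without an $(r-D+1)$-IT. Theorem 1.4. Let $r,d,q,k,\Delta\ge 0$ be integers such that $r=q(d+1)+k$ and $0\le k\le d$, and suppose that $q\ge 3$ is odd. Then the largest integer defining $n(r,d+1,\Delta)$ exists, and \[ n(r,d+1,\Delta)\le\max\left\{2\Delta\left(1-\frac{6d+7}{6r}\right),\ 2\Delta\left(1-\frac{1}{q-1}\right)\right\}. \] -/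

import Mathlib

/-- `T` is an independent `m`-transversal (an `m`-IT) of the graph `G` with respect to the
`r`-partition given by the colour classes of `c`: an independent set of `m` vertices
with at most one vertex in each part. -/
structure IsIndepTransversal {V : Type*} {r : ℕ} (G : SimpleGraph V) (c : G.Coloring (Fin r))
    (m : ℕ) (T : Finset V) : Prop where
  indep : G.IsIndepSet (T : Set V)
  injOn : Set.InjOn c (T : Set V)
  card_eq : T.card = m

/-- There is a finite `r`-partite graph with at least `n` vertices in each part and maximum
degree `Δ` that has no `(r - D + 1)`-IT. The parts are the colour classes of a proper colouring
by `Fin r`. (`r - D + 1` is written `r + 1 - D`, which avoids truncation when `D = r + 1`.) -/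
def ExistsGraphWithoutIT (r D Δ n : ℕ) : Prop :=
  ∃ (V : Type) (_ : Fintype V) (G : SimpleGraph V) (_ : DecidableRel G.Adj)
    (c : G.Coloring (Fin r)),
    (∀ i : Fin r, n ≤ (c.colorClass i).ncard) ∧
    G.maxDegree = Δ ∧
    ¬ ∃ T : Finset V, IsIndepTransversal G c (r + 1 - D) T

/-- `n(r, D, Δ)`: the largest `n` for which there is an `r`-partite graph with at least `n`
vertices in each part, maximum degree `Δ`, and no `(r - D + 1)`-IT. -/
noncomputable def nExtremal (r D Δ : ℕ) : ℕ :=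
  sSup {n : ℕ | ExistsGraphWithoutIT r D Δ n}

/-!
Suppose that `n` exceeds the bound, put `D = d + 1`, and pass to a counterexample with fewest edges.
The alternating structures of Szabó and Tardos produce induced matchings whose edges form a forest
on a set `S` of classes with `D` components and dominate all vertices of `S`. In one of maximum size
this domination is nearly tight, as `n` is close to `2Δ`; hence every end of an edge can be replaced
by many other vertices, and the vertices which the ends become under repeated replacement split the
vertices of `S` into pairs of completely joined blocks.

Since `r < (q + 1) D`, some component `C` of this forest has at most `q` classes, and by the second
bound exactly `q`. Edge-criticality shows that all edges between blocks of `C` join opposite ones,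
so the ends in `C` may be chosen independently, and each choice gives a spanning tree on `C`. Such a
system of trees splits `C` into `X` and `Y` meeting at most `2|X| - 1` and `2|Y| - 1` blocks. As `q`
is odd, one of them, say `X`, has at most `(q - 1) / 2` classes. Each block is dominated by one
vertex of the opposite block, whence `n|X| ≤ Δ(2|X| - 1)`, contrary to the second bound.
-/

namespace IndepTransversal

open scoped Classical

section Linked

variable {ι ι' J J' : Type*}

/-- Connectedness in the multigraph on `ι` whose edges are `e i false – e i true`, `i ∈ A`.
Loops and parallel edges are allowed. -/
def Linked (e : J → Bool → ι) (A : Set J) : ι → ι → Prop :=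
  Relation.EqvGen fun c d => ∃ i ∈ A, c = e i false ∧ d = e i true

/-- The multigraph with edge set `A` is a forest: no edge in `A` has its ends linked by the
others. -/
def IsForest (e : J → Bool → ι) (A : Set J) : Prop :=
  ∀ i ∈ A, ¬ Linked e (A \ {i}) (e i false) (e i true)

/-- Connectedness as a setoid, whose quotient is the set of components. -/
def linkedSetoid (e : J → Bool → ι) (A : Set J) : Setoid ι where
  r := Linked e A
  iseqv := Relation.EqvGen.is_equivalence _

/-- The type of components of the multigraph with edge set `A`. -/
def Component (e : J → Bool → ι) (A : Set J) : Type _ := Quotient (linkedSetoid e A)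

/-- The component of a vertex of the multigraph with edge set `A`. -/
def component (e : J → Bool → ι) (A : Set J) (c : ι) : Component e A :=
  Quotient.mk (linkedSetoid e A) c

variable {e : J → Bool → ι} {A B : Set J} {c d x : ι}

theorem Linked.refl (c : ι) : Linked e A c c := Relation.EqvGen.refl c

theorem Linked.of_eq (h : c = d) : Linked e A c d := h ▸ Linked.refl c

theorem Linked.symm (h : Linked e A c d) : Linked e A d c := Relation.EqvGen.symm _ _ h

theorem Linked.trans (h : Linked e A c d) (h' : Linked e A d x) : Linked e A c x :=
  Relation.EqvGen.trans _ _ _ h h'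

theorem Linked.edge {i : J} (hi : i ∈ A) (b b' : Bool) : Linked e A (e i b) (e i b') := by
  have h : Linked e A (e i false) (e i true) := Relation.EqvGen.rel _ _ ⟨i, hi, rfl, rfl⟩
  cases b <;> cases b'
  · exact Linked.refl _
  · exact h
  · exact h.symm
  · exact Linked.refl _

theorem Linked.lift {e' : J' → Bool → ι'} {A' : Set J'} {g : ι → ι'}
    (h : ∀ i ∈ A, Linked e' A' (g (e i false)) (g (e i true))) (hcd : Linked e A c d) :
    Linked e' A' (g c) (g d) := by
  induction hcd with
  | rel x y hxy =>
    obtain ⟨i, hi, rfl, rfl⟩ := hxy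
    exact h i hi
  | refl x => exact Linked.refl _
  | symm x y _ ih => exact ih.symm
  | trans x y z _ _ ih ih' => exact ih.trans ih'

theorem Linked.mono (h : A ⊆ B) (hcd : Linked e A c d) : Linked e B c d :=
  hcd.lift (g := id) fun _ hi => Linked.edge (h hi) false true

theorem Linked.congr {e' : J → Bool → ι} (h : ∀ i ∈ A, ∀ b, e i b = e' i b)
    (hcd : Linked e A c d) : Linked e' A c d :=
  hcd.lift (g := id) fun i hi => by
    rw [h i hi, h i hi]
    exact Linked.edge hi _ _

theorem Linked.mem_iff {S : Set ι} (h : ∀ i ∈ A, e i false ∈ S ↔ e i true ∈ S)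
    (hcd : Linked e A c d) : c ∈ S ↔ d ∈ S := by
  induction hcd with
  | rel x y hxy =>
    obtain ⟨i, hi, rfl, rfl⟩ := hxy
    exact h i hi
  | refl x => rfl
  | symm x y _ ih => exact ih.symm
  | trans x y z _ _ ih ih' => exact ih.trans ih'

theorem Linked.insert_cases {i : J} (hcd : Linked e (insert i A) c d) :
    Linked e A c d ∨ ∃ b, Linked e A c (e i b) ∧ Linked e A (e i !b) d := by
  induction hcd with
  | rel x y hxy =>
    obtain ⟨j, hj, rfl, rfl⟩ := hxy
    rcases hj with rfl | hj
    · exact Or.inr ⟨false, Linked.refl _, Linked.refl _⟩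
    · exact Or.inl (Linked.edge hj _ _)
  | refl x => exact Or.inl (Linked.refl _)
  | symm x y _ ih =>
    rcases ih with h | ⟨b, h, h'⟩
    · exact Or.inl h.symm
    · exact Or.inr ⟨!b, h'.symm, by simpa using h.symm⟩
  | trans x y z _ _ ih ih' =>
    rcases ih with h | ⟨b, h1, h2⟩
    · rcases ih' with h' | ⟨b', h1', h2'⟩
      · exact Or.inl (h.trans h')
      · exact Or.inr ⟨b', h.trans h1', h2'⟩
    · rcases ih' with h' | ⟨b', h1', h2'⟩
      · exact Or.inr ⟨b, h1, h2.trans h'⟩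
      · obtain rfl | rfl := Bool.eq_or_eq_not b b'
        · exact Or.inr ⟨b, h1, h2'⟩
        · exact Or.inl (h1.trans h2')

theorem Linked.sdiff_singleton_cases (hcd : Linked e A c d) (i : J) :
    Linked e (A \ {i}) c d ∨
      ∃ b, Linked e (A \ {i}) c (e i b) ∧ Linked e (A \ {i}) (e i !b) d :=
  (hcd.mono (Set.subset_insert_sdiff_singleton i A)).insert_cases

theorem Linked.compl_cases (hcd : Linked e Set.univ c d) (i : J) :
    Linked e {i}ᶜ c d ∨ ∃ b, Linked e {i}ᶜ c (e i b) ∧ Linked e {i}ᶜ (e i !b) d := by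
  simpa only [Set.compl_eq_univ_sdiff] using hcd.sdiff_singleton_cases i

theorem component_eq_iff : component e A c = component e A d ↔ Linked e A c d :=
  Quotient.eq (r := linkedSetoid e A)

theorem component_surjective : Function.Surjective (component e A) := Quotient.mk_surjective

theorem IsForest.mono (h : A ⊆ B) (hB : IsForest e B) : IsForest e A := fun i hi hc =>
  hB i (h hi) (hc.mono (Set.sdiff_subset_sdiff_left h))

theorem IsForest.congr {e' : J → Bool → ι} (h : ∀ i ∈ A, ∀ b, e i b = e' i b)
    (hA : IsForest e A) : IsForest e' A := fun i hi hc => hA i hi <| by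
  rw [h i hi, h i hi]
  exact hc.congr fun j hj b => (h j hj.1 b).symm

theorem IsForest.insert_edge {i : J} (hA : IsForest e A) (h : ¬ Linked e A (e i false) (e i true)) :
    IsForest e (insert i A) := by
  have h' : ∀ b, ¬ Linked e A (e i b) (e i !b) := by
    intro b hb
    cases b
    · exact h hb
    · exact h hb.symm
  intro j hj hc
  by_cases hji : j = i
  · subst hji
    exact h (hc.mono (by intro _ hk; simpa [hk.2] using hk.1.resolve_left hk.2))
  · have hjA : j ∈ A := hj.resolve_left hji
    have hc' : Linked e (insert i (A \ {j})) (e j false) (e j true) := hc.mono (by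
      rintro k ⟨rfl | hk, hkj⟩
      · exact Or.inl rfl
      · exact Or.inr ⟨hk, hkj⟩)
    rcases hc'.insert_cases with h1 | ⟨b, h1, h2⟩
    · exact hA j hjA h1
    · exact h' b ((h1.symm.mono Set.sdiff_subset).trans
        ((Linked.edge hjA _ _).trans (h2.symm.mono Set.sdiff_subset)))

theorem IsForest.not_linked {i : J} (hi : i ∉ A) (h : IsForest e (insert i A)) :
    ¬ Linked e A (e i false) (e i true) := fun hc =>
  h i (Or.inl rfl) (hc.mono fun _ hk => ⟨Or.inr hk, fun hki => hi (hki ▸ hk)⟩)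

theorem IsForest.not_linked_compl (hA : IsForest e Set.univ) (i : J) (b : Bool) :
    ¬ Linked e {i}ᶜ (e i b) (e i !b) := by
  intro h
  rw [Set.compl_eq_univ_sdiff] at h
  cases b
  · exact hA i (Set.mem_univ i) h
  · exact hA i (Set.mem_univ i) h.symm

theorem linked_comp_iff {f : J' → J} (A' : Set J') :
    Linked (fun i => e (f i)) A' c d ↔ Linked e (f '' A') c d := by
  constructor
  · exact fun h => h.lift (g := id) fun i hi =>
      Linked.edge (e := e) (Set.mem_image_of_mem f hi) false true
  · refine fun h => h.lift (g := id) ?_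
    rintro _ ⟨i, hi, rfl⟩
    exact Linked.edge (e := fun i => e (f i)) hi false true

theorem IsForest.comp_label {f : J' → J} (hf : f.Injective) {A' : Set J'}
    (h : IsForest e (f '' A')) : IsForest (fun i => e (f i)) A' := fun i hi hc => by
  rw [linked_comp_iff, Set.image_sdiff hf, Set.image_singleton] at hc
  exact h _ (Set.mem_image_of_mem f hi) hc

theorem IsForest.of_comp_label {f : J' → J} (hf : f.Injective) {A' : Set J'}
    (h : IsForest (fun i => e (f i)) A') : IsForest e (f '' A') := by
  rintro _ ⟨i, hi, rfl⟩ hc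
  rw [← Set.image_singleton, ← Set.image_sdiff hf, ← linked_comp_iff] at hc
  exact h i hi hc

theorem IsForest.exists_end_not_linked {i : J} (hA : IsForest e (insert i A)) (hi : i ∉ A)
    {T : Set ι} (hT : T.InjOn (component e (insert i A))) :
    ∃ b, ∀ t ∈ T, ¬ Linked e A (e i b) t := by
  by_contra! h
  obtain ⟨t, ht, hit⟩ := h false
  obtain ⟨t', ht', hit'⟩ := h true
  have hsub := Set.subset_insert i A
  obtain rfl : t = t' := hT ht ht' <| component_eq_iff.2 <|
    (hit.mono hsub).symm.trans <| (Linked.edge (Set.mem_insert i A) _ _).trans (hit'.mono hsub)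
  exact hA.not_linked hi (hit.trans hit'.symm)

theorem IsForest.exists_injOn_end (A : Finset J) (hA : IsForest e (A : Set J)) (T : Set ι)
    (hT : T.InjOn (component e (A : Set J))) :
    ∃ f : J → Bool, Set.InjOn (fun i => e i (f i)) (A : Set J) ∧ ∀ i ∈ A, e i (f i) ∉ T := by
  induction A using Finset.induction_on generalizing T with
  | empty => exact ⟨fun _ => false, by simp, by simp⟩
  | insert i A hi ih =>
    rw [Finset.coe_insert] at hA hT
    have hsub := Set.subset_insert i (A : Set J)
    obtain ⟨b, hb⟩ := hA.exists_end_not_linked (Finset.mem_coe.not.2 hi) hT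
    have hT' : (insert (e i b) T).InjOn (component e (A : Set J)) := by
      rintro s (rfl | hs) t (rfl | ht) hst
      · rfl
      · exact (hb t ht (component_eq_iff.1 hst)).elim
      · exact (hb s hs (component_eq_iff.1 hst).symm).elim
      · exact hT hs ht (component_eq_iff.2 ((component_eq_iff.1 hst).mono hsub))
    obtain ⟨f, hf, hfT⟩ := ih (hA.mono hsub) _ hT'
    have hupd : ∀ j ∈ A, Function.update f i b j = f j := fun j hj =>
      Function.update_of_ne (ne_of_mem_of_not_mem hj hi) _ _
    refine ⟨Function.update f i b, ?_, fun j hj => ?_⟩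
    · rw [Finset.coe_insert, Set.injOn_insert (Finset.mem_coe.not.2 hi)]
      refine ⟨fun j hj k hk hjk => hf hj hk ?_, ?_⟩
      · simpa only [hupd j hj, hupd k hk] using hjk
      · rintro ⟨j, hj, hji⟩
        simp only [hupd j hj, Function.update_self] at hji
        exact hfT j hj (Or.inl hji)
    · rcases Finset.mem_insert.1 hj with rfl | hj
      · rw [Function.update_self]
        exact fun h => hb _ h (Linked.refl _)
      · rw [hupd j hj]
        exact fun h => hfT j hj (Or.inr h)

theorem IsForest.card_add_card_le {A : Finset J} (hA : IsForest e (A : Set J)) {X T : Finset ι}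
    (hTX : T ⊆ X) (hT : Set.InjOn (component e (A : Set J)) T) (h : ∀ i ∈ A, ∀ b, e i b ∈ X) :
    A.card + T.card ≤ X.card := by
  obtain ⟨f, hf, hfT⟩ := hA.exists_injOn_end A T hT
  have hle : A.card ≤ (X \ T).card := Finset.card_le_card_of_injOn (fun i => e i (f i))
    (fun i hi => Finset.mem_sdiff.2 ⟨h i hi _, hfT i hi⟩) hf
  have hXT := Finset.card_sdiff_add_card_eq_card hTX
  omega

theorem IsForest.card_lt {A : Finset J} (hA : IsForest e (A : Set J)) {X : Finset ι}
    (hX : X.Nonempty) (h : ∀ i ∈ A, ∀ b, e i b ∈ X) : A.card < X.card := by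
  obtain ⟨x, hx⟩ := hX
  exact hA.card_add_card_le (Finset.singleton_subset_iff.2 hx) (by simp) h

theorem card_image_component_le_insert (X : Finset ι) (i : J) :
    (X.image (component e A)).card ≤ (X.image (component e (insert i A))).card + 1 := by
  have hsub := Set.subset_insert i A
  let merge : Component e A → Component e (insert i A) :=
    Quotient.map id fun _ _ h => Linked.mono hsub h
  have hinj : Set.InjOn merge {component e A (e i false)}ᶜ := by
    rintro ⟨c⟩ hc ⟨d⟩ hd hcd
    change component e A c ≠ _ at hc
    change component e A d ≠ _ at hd
    refine component_eq_iff.2 ?_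
    rcases (component_eq_iff.1 hcd).insert_cases with h | ⟨_ | _, h, h'⟩
    · exact h
    · exact (hc (component_eq_iff.2 h)).elim
    · exact (hd (component_eq_iff.2 h'.symm)).elim
  have hmaps : Set.MapsTo merge ((X.image (component e A)).erase (component e A (e i false)))
      (X.image (component e (insert i A))) := by
    intro _ hc
    obtain ⟨c, hcX, rfl⟩ := Finset.mem_image.1 (Finset.mem_of_mem_erase hc)
    exact Finset.mem_image_of_mem _ hcX
  have hle := Finset.card_le_card_of_injOn merge hmaps
    (hinj.mono fun _ hc => Finset.ne_of_mem_erase hc)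
  exact Nat.le_add_of_sub_le (Finset.pred_card_le_card_erase.trans hle)

theorem card_le_card_image_component_add (A : Finset J) (X : Finset ι) :
    X.card ≤ (X.image (component e (A : Set J))).card + A.card := by
  induction A using Finset.induction_on with
  | empty =>
    rw [Finset.card_image_of_injective, Finset.card_empty, Nat.add_zero]
    intro c d hcd
    have := (component_eq_iff.1 hcd).mem_iff (S := {c}) (by simp)
    simpa [eq_comm] using this
  | insert i A hi ih =>
    have := card_image_component_le_insert (e := e) (A := (A : Set J)) X i
    rw [Finset.card_insert_of_notMem hi, Finset.coe_insert]
    omega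

theorem IsForest.card_image_component {A : Finset J} (hA : IsForest e (A : Set J)) {X : Finset ι}
    (h : ∀ i ∈ A, ∀ b, e i b ∈ X) :
    (X.image (component e (A : Set J))).card + A.card = X.card := by
  obtain ⟨T, hTX, hT, himage⟩ := Finset.exists_subset_injOn_image_eq_of_surjOn
    (f := component e (A : Set J)) (X : Set ι) (X.image (component e (A : Set J)))
    (by rw [Finset.coe_image]; exact Set.surjOn_image _ _)
  have hle := hA.card_add_card_le (Finset.coe_subset.1 hTX) hT h
  rw [← Finset.card_image_of_injOn hT, himage] at hle
  have hge := card_le_card_image_component_add (e := e) A X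
  omega

theorem IsForest.card_image_component_univ [Fintype J] (he : IsForest e Set.univ) {X : Finset ι}
    (h : ∀ i b, e i b ∈ X) : (X.image (component e Set.univ)).card + Fintype.card J = X.card := by
  rw [← Finset.coe_univ] at he ⊢
  exact he.card_image_component fun i _ => h i

theorem IsForest.sum [Finite J'] {e₁ : J → Bool → ι} {e₂ : J' → Bool → ι}
    (h₁ : IsForest e₁ Set.univ)
    (h₂ : IsForest (fun i b => component e₁ Set.univ (e₂ i b)) Set.univ) :
    IsForest (Sum.elim e₁ e₂) Set.univ := by
  have := Fintype.ofFinite J'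
  have key : ∀ (A' : Set J') c d, Linked (Sum.elim e₁ e₂) (Set.range Sum.inl ∪ Sum.inr '' A') c d →
      Linked (fun i b => component e₁ Set.univ (e₂ i b)) A' (component e₁ Set.univ c)
        (component e₁ Set.univ d) := by
    intro A' c d h
    refine h.lift ?_
    rintro _ (⟨i, rfl⟩ | ⟨i, hi, rfl⟩)
    · exact Linked.of_eq (component_eq_iff.2 (Linked.edge (Set.mem_univ i) _ _))
    · exact Linked.edge (e := fun i b => component e₁ Set.univ (e₂ i b)) hi _ _
  have ind : ∀ A' : Finset J',
      IsForest (Sum.elim e₁ e₂) (Set.range Sum.inl ∪ Sum.inr '' (A' : Set J')) := by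
    intro A'
    induction A' using Finset.induction_on with
    | empty =>
      simpa using IsForest.of_comp_label (e := Sum.elim e₁ e₂) Sum.inl_injective h₁
    | insert i A' hi ih =>
      rw [Finset.coe_insert, Set.image_insert_eq, Set.union_insert]
      refine ih.insert_edge fun hc => ?_
      exact h₂ i (Set.mem_univ i) ((key _ _ _ hc).mono fun j hj =>
        ⟨Set.mem_univ j, fun hji => hi (hji ▸ hj)⟩)
  refine (ind Finset.univ).mono ?_
  rintro (i | i) _
  · exact Or.inl ⟨i, rfl⟩
  · exact Or.inr ⟨i, by simp, rfl⟩

/-- The edge family `z` with the end `z j b` replaced by `w`. -/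
noncomputable def replaceEnd (z : J → Bool → ι) (j : J) (b : Bool) (w : ι) : J → Bool → ι :=
  Function.update z j (Function.update (z j) b w)

variable {z : J → Bool → ι} {i j : J}

@[simp]
theorem replaceEnd_self (j : J) (b : Bool) (w : ι) : replaceEnd z j b w j b = w := by
  simp [replaceEnd]

@[simp]
theorem replaceEnd_not (j : J) (b : Bool) (w : ι) : replaceEnd z j b w j (!b) = z j !b := by
  simp [replaceEnd]

theorem replaceEnd_of_ne (h : i ≠ j) (b : Bool) (w : ι) : replaceEnd z j b w i = z i :=
  Function.update_of_ne h _ _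

@[simp]
theorem replaceEnd_replaceEnd (j : J) (b : Bool) (w w' : ι) :
    replaceEnd (replaceEnd z j b w) j b w' = replaceEnd z j b w' := by
  simp [replaceEnd]

@[simp]
theorem replaceEnd_eq (j : J) (b : Bool) : replaceEnd z j b (z j b) = z := by
  simp [replaceEnd]

theorem replaceEnd_apply_of_ne {b b' : Bool} (h : ¬(i = j ∧ b' = b)) (w : ι) :
    replaceEnd z j b w i b' = z i b' := by
  obtain rfl | hij := eq_or_ne i j
  · rw [replaceEnd, Function.update_self, Function.update_of_ne fun hb => h ⟨rfl, hb⟩]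
  · rw [replaceEnd_of_ne hij]

theorem replaceEnd_mem {f : J → Bool → Finset ι} (hz : ∀ i b, z i b ∈ f i b) {b : Bool} {w : ι}
    (hw : w ∈ f j b) (i : J) (b' : Bool) : replaceEnd z j b w i b' ∈ f i b' := by
  obtain rfl | hij := eq_or_ne i j
  · obtain rfl | rfl := Bool.eq_or_eq_not b' b
    · rwa [replaceEnd_self]
    · rw [replaceEnd_not]
      exact hz i _
  · rw [replaceEnd_of_ne hij]
    exact hz i b'

theorem linked_replaceEnd_iff {b : Bool} {w : ι} (hj : j ∉ A) :
    Linked (replaceEnd z j b w) A c d ↔ Linked z A c d := by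
  have hne : ∀ i ∈ A, replaceEnd z j b w i = z i := fun i hi =>
    replaceEnd_of_ne (ne_of_mem_of_not_mem hi hj) b w
  exact ⟨fun h => h.congr fun i hi b' => by rw [hne i hi],
    fun h => h.congr fun i hi b' => by rw [hne i hi]⟩

theorem isForest_replaceEnd {b : Bool} {w : ι} (hz : IsForest z {j}ᶜ)
    (h : ¬ Linked z {j}ᶜ w (z j !b)) : IsForest (replaceEnd z j b w) Set.univ := by
  rw [← Set.union_compl_self {j}, ← Set.insert_eq]
  have hz' : IsForest (replaceEnd z j b w) {j}ᶜ :=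
    hz.congr fun i hi b' => by rw [replaceEnd_of_ne hi]
  refine hz'.insert_edge fun hl => h ?_
  rw [linked_replaceEnd_iff (Set.notMem_compl_iff.2 (Set.mem_singleton j))] at hl
  cases b
  · rwa [replaceEnd_self, ← Bool.not_false, replaceEnd_not] at hl
  · rw [replaceEnd_self, ← Bool.not_true, replaceEnd_not] at hl
    exact hl.symm

theorem Linked.of_replaceEnd {b : Bool} {w : ι} (hw : Linked z {j}ᶜ w (z j b))
    (h : Linked (replaceEnd z j b w) Set.univ c d) : Linked z Set.univ c d := by
  have hlinked : ∀ i b', Linked z Set.univ (replaceEnd z j b w i b') (z i b') := by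
    intro i b'
    obtain rfl | hij := eq_or_ne i j
    · obtain rfl | rfl := Bool.eq_or_eq_not b' b
      · rw [replaceEnd_self]
        exact hw.mono (Set.subset_univ _)
      · exact Linked.of_eq (replaceEnd_not _ _ _)
    · exact Linked.of_eq (by rw [replaceEnd_of_ne hij])
  exact h.lift (g := id) fun i _ => (hlinked i false).trans <|
    (Linked.edge (Set.mem_univ i) false true).trans (hlinked i true).symm

theorem linked_replaceEnd_univ_iff {b : Bool} {w : ι} (hw : Linked z {j}ᶜ w (z j b)) :
    Linked (replaceEnd z j b w) Set.univ c d ↔ Linked z Set.univ c d := by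
  refine ⟨.of_replaceEnd hw, fun h => .of_replaceEnd (j := j) (b := b) (w := z j b) ?_ ?_⟩
  · rw [linked_replaceEnd_iff (Set.notMem_compl_iff.2 (Set.mem_singleton j)), replaceEnd_self]
    exact hw.symm
  · rwa [replaceEnd_replaceEnd, replaceEnd_eq]

/-- The multigraph induced on the classes of `κ` by a family of pairs of vertices. -/
abbrev classEnds (κ : ι → ι') (z : J → Bool → ι) : J → Bool → ι' := fun j b => κ (z j b)

theorem classEnds_replaceEnd (κ : ι → ι') (j : J) (b : Bool) (w : ι) :
    classEnds κ (replaceEnd z j b w) = replaceEnd (classEnds κ z) j b (κ w) := by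
  funext i b'
  obtain rfl | hij := eq_or_ne i j
  · obtain rfl | rfl := Bool.eq_or_eq_not b' b <;> simp [classEnds]
  · simp only [classEnds, replaceEnd_of_ne hij]

end Linked

section TreeSystem

variable {ι L : Type*} {C Y : Finset ι} {f : L → Bool → Finset ι} {s : L → Bool → ι}
  {j l : L} {a b : Bool} {c d x : ι}

/-- `s` picks an element of every member of the family `f` of pairs of sets, which makes it the
edge family of a multigraph. -/
def IsChoice (f : L → Bool → Finset ι) (s : L → Bool → ι) : Prop := ∀ l b, s l b ∈ f l b

/-- The vertices in `C` lying on the side of the end `s j b` after the removal of the edge `j`. -/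
noncomputable def side (C : Finset ι) (s : L → Bool → ι) (j : L) (b : Bool) : Finset ι :=
  C.filter fun c => Linked s {j}ᶜ c (s j b)

theorem mem_side : c ∈ side C s j b ↔ c ∈ C ∧ Linked s {j}ᶜ c (s j b) := Finset.mem_filter

variable [Fintype L]

/-- A family of pairs of sets of vertices such that each choice of ends yields a spanning tree
of `C`; the tree is encoded as a forest with one edge less than `C` has vertices. -/
structure TreeSystem (C : Finset ι) (f : L → Bool → Finset ι) : Prop where
  nonempty : ∀ l b, (f l b).Nonempty
  subset : ∀ l b, f l b ⊆ C
  isForest : ∀ s : L → Bool → ι, IsChoice f s → IsForest s Set.univ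
  card_eq : Fintype.card L + 1 = C.card

/-- The pairs both of whose members are contained in `Y`. -/
noncomputable def inner (f : L → Bool → Finset ι) (Y : Finset ι) : Finset L :=
  Finset.univ.filter fun l => ∀ b, f l b ⊆ Y

theorem mem_inner : l ∈ inner f Y ↔ ∀ b, f l b ⊆ Y := by
  simp only [inner, Finset.mem_filter_univ]

/-- The members of the family that meet `X`. -/
noncomputable def meeting (f : L → Bool → Finset ι) (X : Finset ι) : Finset (L × Bool) :=
  Finset.univ.filter fun p => ∃ c ∈ f p.1 p.2, c ∈ X

theorem mem_meeting : (l, b) ∈ meeting f Y ↔ ∃ c ∈ f l b, c ∈ Y := by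
  simp only [meeting, Finset.mem_filter_univ]

namespace TreeSystem

theorem exists_isChoice (hf : TreeSystem C f) : ∃ s, IsChoice f s := by
  choose s hs using hf.nonempty
  exact ⟨s, hs⟩

theorem linked (hf : TreeSystem C f) (hs : IsChoice f s) (hc : c ∈ C) (hd : d ∈ C) :
    Linked s Set.univ c d := by
  have hcard := (hf.isForest s hs).card_image_component_univ fun l b => hf.subset l b (hs l b)
  have hC := hf.card_eq
  exact component_eq_iff.1 (Finset.card_le_one.1 (by omega) _ (Finset.mem_image_of_mem _ hc) _
    (Finset.mem_image_of_mem _ hd))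

theorem card_inner_lt (hf : TreeSystem C f) (hY : Y.Nonempty) : (inner f Y).card < Y.card := by
  obtain ⟨s, hs⟩ := hf.exists_isChoice
  exact ((hf.isForest s hs).mono (Set.subset_univ _)).card_lt hY
    fun l hl b => mem_inner.1 hl b (hs l b)

theorem linked_inner (hf : TreeSystem C f) (hs : IsChoice f s)
    (hY : Y.card ≤ (inner f Y).card + 1) (hc : c ∈ Y) (hd : d ∈ Y) :
    Linked s (inner f Y : Set L) c d := by
  have hcard := ((hf.isForest s hs).mono (Set.subset_univ _)).card_image_component (X := Y)
    fun l hl b => mem_inner.1 hl b (hs l b)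
  exact component_eq_iff.1 (Finset.card_le_one.1 (by omega) _ (Finset.mem_image_of_mem _ hc) _
    (Finset.mem_image_of_mem _ hd))

theorem not_linked_compl (hf : TreeSystem C f) (hs : IsChoice f s) (j : L) (b : Bool) :
    ¬ Linked s {j}ᶜ (s j b) (s j !b) :=
  (hf.isForest s hs).not_linked_compl j b

theorem linked_compl_or (hf : TreeSystem C f) (hs : IsChoice f s) (hc : c ∈ C) (j : L)
    (b : Bool) : Linked s {j}ᶜ c (s j b) ∨ Linked s {j}ᶜ c (s j !b) := by
  rcases (hf.linked hs hc (hf.subset _ _ (hs j b))).compl_cases j with h | ⟨b', h, -⟩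
  · exact Or.inl h
  · obtain rfl | rfl := Bool.eq_or_eq_not b' b
    · exact Or.inl h
    · exact Or.inr h

/-- Otherwise moving the end `s l a` of an edge on the side of `s j b` to the vertex `x` on the
other side would close a cycle. -/
theorem not_linked_fixed_end (hf : TreeSystem C f) (hs : IsChoice f s) (hlj : l ≠ j)
    (hl : Linked s {j}ᶜ (s l a) (s j b)) (hx : x ∈ f l a) (hxj : ¬ Linked s {j}ᶜ x (s j b)) :
    ¬ Linked s ({j}ᶜ \ {l}) (s l !a) (s j b) := by
  intro hfixed
  have hsub : {j}ᶜ \ {l} ⊆ ({j}ᶜ : Set L) := Set.sdiff_subset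
  have hl' : ∀ b', Linked s {j}ᶜ (s l b') (s j b) := fun b' =>
    (Linked.edge (Set.mem_compl_singleton_iff.2 hlj) b' a).trans hl
  have hxfar : Linked s ({j}ᶜ \ {l}) x (s j !b) := by
    have hx' := (hf.linked_compl_or hs (hf.subset _ _ hx) j b).resolve_left hxj
    rcases hx'.sdiff_singleton_cases l with h | ⟨b', h, -⟩
    · exact h
    · exact (hxj ((h.mono hsub).trans (hl' b'))).elim
  set s' := replaceEnd s l a x with hs'
  have hchoice : IsChoice f s' := replaceEnd_mem hs hx
  have hs'j : s' j = s j := replaceEnd_of_ne hlj.symm _ _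
  have hmoved : Linked s' {j}ᶜ (s l !a) x := by
    have := Linked.edge (e := s') (Set.mem_compl_singleton_iff.2 hlj) (!a) a
    rwa [hs', replaceEnd_self, replaceEnd_not] at this
  have hlift : ∀ {y y'}, Linked s ({j}ᶜ \ {l}) y y' → Linked s' {j}ᶜ y y' := fun h =>
    ((linked_replaceEnd_iff fun hl => hl.2 rfl).2 h).mono hsub
  refine hf.not_linked_compl hchoice j b ?_
  rw [hs'j]
  exact (hlift hfixed).symm.trans (hmoved.trans (hlift hxfar))

theorem linked_of_linked_replaceEnd (hf : TreeSystem C f) (hs : IsChoice f s) (hlj : l ≠ j)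
    (hl : Linked s {j}ᶜ (s l a) (s j b)) (hx : x ∈ f l a) (hxj : ¬ Linked s {j}ᶜ x (s j b))
    (hd : Linked (replaceEnd s l a x) {j}ᶜ d (s j b)) :
    Linked s ({j}ᶜ \ {l}) d (s j b) := by
  have hiff : ∀ {y y'}, Linked (replaceEnd s l a x) ({j}ᶜ \ {l}) y y' ↔
      Linked s ({j}ᶜ \ {l}) y y' := linked_replaceEnd_iff fun hl => hl.2 rfl
  rcases hd.sdiff_singleton_cases l with h | ⟨b', -, h⟩
  · exact hiff.1 h
  · rw [hiff] at h
    obtain rfl | rfl := Bool.eq_or_eq_not b' a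
    · rw [replaceEnd_not] at h
      exact (hf.not_linked_fixed_end hs hlj hl hx hxj h).elim
    · rw [Bool.not_not, replaceEnd_self] at h
      exact (hxj (h.mono Set.sdiff_subset)).elim

theorem side_replaceEnd_ssubset (hf : TreeSystem C f) (hs : IsChoice f s) (hlj : l ≠ j)
    (hl : Linked s {j}ᶜ (s l a) (s j b)) (hx : x ∈ f l a) (hxj : ¬ Linked s {j}ᶜ x (s j b)) :
    side C (replaceEnd s l a x) j b ⊂ side C s j b := by
  have hback : ∀ d ∈ side C (replaceEnd s l a x) j b, Linked s ({j}ᶜ \ {l}) d (s j b) := by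
    intro d hd
    rw [mem_side, replaceEnd_of_ne hlj.symm] at hd
    exact hf.linked_of_linked_replaceEnd hs hlj hl hx hxj hd.2
  refine (Finset.ssubset_iff_of_subset fun d hd => ?_).2 ⟨s l !a, ?_, fun h => ?_⟩
  · exact mem_side.2 ⟨(mem_side.1 hd).1, (hback d hd).mono Set.sdiff_subset⟩
  · exact mem_side.2 ⟨hf.subset _ _ (hs l _),
      (Linked.edge (Set.mem_compl_singleton_iff.2 hlj) _ _).trans hl⟩
  · exact hf.not_linked_fixed_end hs hlj hl hx hxj (hback _ h)

theorem exists_inner_side (hf : TreeSystem C f) (hc : c ∈ f j b) :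
    ∃ s, IsChoice f s ∧ s j b = c ∧
      ∀ l ≠ j, ∀ a, s l a ∈ side C s j b → l ∈ inner f (side C s j b) := by
  -- A choice with a smallest side: an edge in it cannot be moved out of it.
  obtain ⟨s, ⟨hs, hsj⟩, hmin⟩ := exists_minimalFor_of_wellFoundedLT
    (fun s => IsChoice f s ∧ s j b = c) (fun s => side C s j b) <| by
      obtain ⟨s, hs⟩ := hf.exists_isChoice
      exact ⟨replaceEnd s j b c, replaceEnd_mem hs hc, replaceEnd_self _ _ _⟩
  refine ⟨s, hs, hsj, fun l hlj a hla => mem_inner.2 fun a' x hx =>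
    mem_side.2 ⟨hf.subset _ _ hx, ?_⟩⟩
  by_contra hxj
  have hl : Linked s {j}ᶜ (s l a') (s j b) :=
    (Linked.edge (Set.mem_compl_singleton_iff.2 hlj) _ _).trans (mem_side.1 hla).2
  have hss := hf.side_replaceEnd_ssubset hs hlj hl hx hxj
  exact hss.2 (hmin ⟨replaceEnd_mem hs hx, by rw [replaceEnd_of_ne hlj.symm, hsj]⟩ hss.1)

end TreeSystem

/-- `Y` is a largest proper subset of `C` among those that contain `|Y| - 1` pairs of the family,
the largest number possible for a nonempty set. -/
structure IsMaxTight (C : Finset ι) (f : L → Bool → Finset ι) (Y : Finset ι) : Prop where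
  nonempty : Y.Nonempty
  ssubset : Y ⊂ C
  card_le : Y.card ≤ (inner f Y).card + 1
  max : ∀ Z, Z ⊂ C → Z.card ≤ (inner f Z).card + 1 → Z.card ≤ Y.card

theorem exists_isMaxTight (hC : 2 ≤ C.card) (f : L → Bool → Finset ι) :
    ∃ Y, IsMaxTight C f Y := by
  obtain ⟨c, hc⟩ := Finset.card_pos.1 (Nat.zero_lt_two.trans_le hC)
  have hcC : {c} ⊂ C := Finset.ssubset_iff_subset_ne.2
    ⟨Finset.singleton_subset_iff.2 hc, by rintro rfl; simp at hC⟩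
  have hmem : ∀ Z, Z ∈ C.ssubsets.filter (fun Z => Z.card ≤ (inner f Z).card + 1) ↔
      Z ⊂ C ∧ Z.card ≤ (inner f Z).card + 1 := by simp
  obtain ⟨Y, hY, hmax⟩ := Finset.exists_max_image _ Finset.card
    ⟨{c}, (hmem {c}).2 ⟨hcC, by simp⟩⟩
  refine ⟨Y, Finset.card_pos.1 (hmax {c} ((hmem {c}).2 ⟨hcC, by simp⟩)), ((hmem Y).1 hY).1,
    ((hmem Y).1 hY).2, fun Z hZ hZ' => hmax Z ((hmem Z).2 ⟨hZ, hZ'⟩)⟩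

namespace IsMaxTight

theorem exists_mem (hY : IsMaxTight C f Y) (hf : TreeSystem C f) (hs : IsChoice f s) :
    ∃ l ∉ inner f Y, ∃ b, s l b ∈ Y := by
  by_contra! hcon
  have hne : (C \ Y).Nonempty := Finset.sdiff_nonempty.2 hY.ssubset.2
  have houter := ((hf.isForest s hs).mono (Set.subset_univ _)).card_lt (A := (inner f Y)ᶜ) hne
    fun l hl b => Finset.mem_sdiff.2
      ⟨hf.subset _ _ (hs l b), hcon l (Finset.mem_compl.1 hl) b⟩
  have hcard := Finset.card_sdiff_add_card_eq_card hY.ssubset.1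
  have hcompl := Finset.card_add_card_compl (inner f Y)
  have hC := hf.card_eq
  have hle := hY.card_le
  have hlt := hf.card_inner_lt hY.nonempty
  omega

theorem not_mem_end (hY : IsMaxTight C f Y) (hf : TreeSystem C f) (hs : IsChoice f s)
    (hj : j ∉ inner f Y) (hb : s j b ∈ Y) : s j (!b) ∉ Y := fun hb' =>
  hf.not_linked_compl hs j b <| (hf.linked_inner hs hY.card_le hb hb').mono
    fun _ hl => Set.mem_compl_singleton_iff.2 (ne_of_mem_of_not_mem hl hj)

theorem exists_isolated_crossing (hY : IsMaxTight C f Y) (hf : TreeSystem C f)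
    (hj : j ∉ inner f Y) (hc : c ∈ f j b) (hcY : c ∈ Y) :
    ∃ s, IsChoice f s ∧ s j b ∈ Y ∧ ∀ l ≠ j, l ∉ inner f Y → ∀ a, s l a ∉ Y := by
  obtain ⟨s, hs, rfl, hinner⟩ := hf.exists_inner_side hc
  set Z := side C s j b
  have hYZ : Y ⊆ Z := fun c hc => mem_side.2 ⟨hY.ssubset.1 hc,
    (hf.linked_inner hs hY.card_le hc hcY).mono
      fun _ hl => Set.mem_compl_singleton_iff.2 (ne_of_mem_of_not_mem hl hj)⟩
  have hjZ : s j (!b) ∉ Z := fun h => hf.not_linked_compl hs j b (mem_side.1 h).2.symm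
  have hjC : s j (!b) ∈ C := hf.subset _ _ (hs j !b)
  have hZC : Z ⊂ C := (Finset.ssubset_iff_of_subset (Finset.filter_subset _ _)).2 ⟨_, hjC, hjZ⟩
  have hcard : Z.card ≤ (inner f Z).card + 1 := by
    have houter := ((hf.isForest s hs).mono (Set.subset_univ _)).card_lt
      (A := (inner f Z)ᶜ.erase j) ⟨_, Finset.mem_sdiff.2 ⟨hjC, hjZ⟩⟩ fun l hl b' => by
        rw [Finset.mem_erase, Finset.mem_compl] at hl
        exact Finset.mem_sdiff.2 ⟨hf.subset _ _ (hs l b'), fun h => hl.2 (hinner l hl.1 b' h)⟩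
    have hsdiff := Finset.card_sdiff_add_card_eq_card hZC.1
    have hcompl := Finset.card_add_card_compl (inner f Z)
    have herase := Finset.pred_card_le_card_erase (s := (inner f Z)ᶜ) (a := j)
    have hC := hf.card_eq
    omega
  obtain rfl : Y = Z := Finset.eq_of_subset_of_card_le hYZ (hY.max Z hZC hcard)
  exact ⟨s, hs, hcY, fun l hl hlY a h => hlY (hinner l hl a h)⟩

theorem subset_of_meets (hY : IsMaxTight C f Y) (hf : TreeSystem C f) (hj : j ∉ inner f Y)
    (hc : c ∈ f j b) (hcY : c ∈ Y) : f j b ⊆ Y := by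
  obtain ⟨s, hs, hsj, hrest⟩ := hY.exists_isolated_crossing hf hj hc hcY
  intro x hx
  by_contra hxY
  obtain ⟨l, hl, a, hla⟩ := hY.exists_mem hf (s := replaceEnd s j b x) (replaceEnd_mem hs hx)
  obtain rfl | hlj := eq_or_ne l j
  · obtain rfl | rfl := Bool.eq_or_eq_not a b
    · rw [replaceEnd_self] at hla
      exact hxY hla
    · rw [replaceEnd_not] at hla
      exact hY.not_mem_end hf hs hl hsj hla
  · rw [replaceEnd_of_ne hlj] at hla
    exact hrest l hlj hl a hla

theorem disjoint_not_of_meets (hY : IsMaxTight C f Y) (hf : TreeSystem C f)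
    (hj : j ∉ inner f Y) (hc : c ∈ f j b) (hcY : c ∈ Y) : Disjoint (f j !b) Y := by
  obtain ⟨s, hs, hsj, -⟩ := hY.exists_isolated_crossing hf hj hc hcY
  refine Finset.disjoint_left.2 fun x hx => ?_
  have hend := hY.not_mem_end hf (replaceEnd_mem hs hx) (b := b) hj
  rw [replaceEnd_self] at hend
  refine hend ?_
  have hb := replaceEnd_not (z := s) j (!b) x
  rw [Bool.not_not] at hb
  rwa [hb]

theorem exists_unique_crossing (hY : IsMaxTight C f Y) (hf : TreeSystem C f) :
    ∃ j ∉ inner f Y, ∃ b, f j b ⊆ Y ∧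
      ∀ l ∉ inner f Y, ∀ a, (l, a) ∈ meeting f Y → (l, a) = (j, b) := by
  obtain ⟨s, hs⟩ := hf.exists_isChoice
  obtain ⟨j, hj, b, hjb⟩ := hY.exists_mem hf hs
  refine ⟨j, hj, b, hY.subset_of_meets hf hj (hs j b) hjb, fun l hl a hla => ?_⟩
  obtain ⟨c, hc, hcY⟩ := mem_meeting.1 hla
  obtain rfl : l = j := by
    by_contra hlj
    obtain ⟨s', hs', -, hrest⟩ := hY.exists_isolated_crossing hf hj (hs j b) hjb
    exact hrest l hlj hl a (hY.subset_of_meets hf hl hc hcY (hs' l a))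
  obtain rfl | rfl := Bool.eq_or_eq_not a b
  · rfl
  · exact (Finset.disjoint_left.1 (hY.disjoint_not_of_meets hf hj (hs l b) hjb) hc hcY).elim

end IsMaxTight

theorem TreeSystem.exists_partition (hf : TreeSystem C f) (hC : 2 ≤ C.card) :
    ∃ X Y : Finset ι, X ⊆ C ∧ Y ⊆ C ∧ X.card + Y.card = C.card ∧
      (meeting f X).card + 1 ≤ 2 * X.card ∧ (meeting f Y).card + 1 ≤ 2 * Y.card := by
  obtain ⟨Y, hY⟩ := exists_isMaxTight hC f
  obtain ⟨j, hj, b, hjY, honly⟩ := hY.exists_unique_crossing hf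
  have hinner := hf.card_inner_lt hY.nonempty
  have hsdiff := Finset.card_sdiff_add_card_eq_card hY.ssubset.1
  have hcompl := Finset.card_add_card_compl (inner f Y)
  have hL := hf.card_eq
  have hle := hY.card_le
  have hbool := Finset.card_univ (α := Bool)
  rw [Fintype.card_bool] at hbool
  have hmeetX : meeting f (C \ Y) ⊆ ((inner f Y)ᶜ ×ˢ Finset.univ).erase (j, b) := by
    rintro ⟨l, a⟩ hla
    obtain ⟨c, hc, hcX⟩ := mem_meeting.1 hla
    have hcY := (Finset.mem_sdiff.1 hcX).2
    rw [Finset.mem_erase, Finset.mem_product, Finset.mem_compl]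
    refine ⟨?_, fun hl => hcY (mem_inner.1 hl a hc), Finset.mem_univ _⟩
    rintro ⟨⟩
    exact hcY (hjY hc)
  have hmeetY : meeting f Y ⊆ insert (j, b) (inner f Y ×ˢ Finset.univ) := by
    rintro ⟨l, a⟩ hla
    rw [Finset.mem_insert, Finset.mem_product]
    by_cases hl : l ∈ inner f Y
    · exact Or.inr ⟨hl, Finset.mem_univ _⟩
    · exact Or.inl (honly l hl a hla)
  refine ⟨C \ Y, Y, Finset.sdiff_subset, hY.ssubset.1, hsdiff, ?_, ?_⟩
  · have hcard := Finset.card_le_card hmeetX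
    rw [Finset.card_erase_of_mem (Finset.mem_product.2 ⟨Finset.mem_compl.2 hj, Finset.mem_univ _⟩),
      Finset.card_product, hbool] at hcard
    have hpos := Finset.card_pos.2 ⟨j, Finset.mem_compl.2 hj⟩
    omega
  · have hcard := (Finset.card_le_card hmeetY).trans (Finset.card_insert_le _ _)
    rw [Finset.card_product, hbool] at hcard
    omega

end TreeSystem

section Alternation

variable {V K : Type*} {G : SimpleGraph V} {κ : V → K}

/-- A partial independent transversal of the classes of `κ`. -/
structure IsPartialTransversal (G : SimpleGraph V) (κ : V → K) (T : Finset V) : Prop where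
  indep : G.IsIndepSet (T : Set V)
  injOn : Set.InjOn κ (T : Set V)

/-- An induced matching, given by the two ends `z j false` and `z j true` of its edges, whose
edges form a forest on the classes of `κ`. -/
structure IsInducedMatchingConfig {J : Type*} (G : SimpleGraph V) (κ : V → K)
    (z : J → Bool → V) : Prop where
  adj : ∀ j b, G.Adj (z j b) (z j !b)
  induced : ∀ i j, i ≠ j → ∀ b b', ¬ G.Adj (z i b) (z j b')
  isForest : IsForest (classEnds κ z) Set.univ

/-- A partial transversal of the classes in `S` inside `U`. -/
structure IsTransversalIn (G : SimpleGraph V) (κ : V → K) (U : Set V) (S : Finset K)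
    (T : Finset V) : Prop extends IsPartialTransversal G κ T where
  mem_U : ∀ v ∈ T, v ∈ U
  mem_S : ∀ v ∈ T, κ v ∈ S

/-- The classes in `S` that are missed by `T`. -/
noncomputable def missed (κ : V → K) (S : Finset K) (T : Finset V) : Finset K :=
  S \ T.image κ

/-- The vertices of `T` with a neighbour in `ws`. -/
noncomputable def leaves (G : SimpleGraph V) (T : Finset V) (ws : List V) : Finset V :=
  T.filter fun v => ∃ w ∈ ws, G.Adj w v

/-- The classes in `M` and those of the leaves of `ws`. -/
noncomputable def reached (G : SimpleGraph V) (κ : V → K) (M : Finset K) (T : Finset V)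
    (ws : List V) : Finset K :=
  M ∪ (leaves G T ws).image κ

/-- A vertex of a reached class that is dominated neither by `ws` nor by its leaves. -/
structure IsCandidate (G : SimpleGraph V) (κ : V → K) (U : Set V) (M : Finset K) (T : Finset V)
    (ws : List V) (w : V) : Prop where
  mem_U : w ∈ U
  mem_reached : κ w ∈ reached G κ M T ws
  not_adj : ∀ u ∈ ws, ¬ G.Adj u w
  not_adj_leaves : ∀ v ∈ leaves G T ws, ¬ G.Adj w v

/-- An alternating structure of Szabó and Tardos: `T` is a transversal missing exactly the classes
in `M`, and the list is built by adding candidates with a neighbour in `T` one by one. -/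
def IsAlt (G : SimpleGraph V) (κ : V → K) (U : Set V) (S M : Finset K)
    (T : Finset V) : List V → Prop
  | [] => IsTransversalIn G κ U S T ∧ missed κ S T = M
  | w :: ws => IsAlt G κ U S M T ws ∧ IsCandidate G κ U M T ws w ∧
      (T.filter (G.Adj w)).Nonempty

/-- The potential of an alternating structure. For `N` larger than the number of vertices it
compares the sequences of the numbers of leaves lexicographically, a smaller number being better
and a longer list being better than its initial segments. -/
noncomputable def altPot (G : SimpleGraph V) (N : ℕ) (T : Finset V) : List V → ℕ
  | [] => 0
  | w :: ws => altPot G N T ws + (N - (T.filter (G.Adj w)).card) * N ^ (N - ws.length - 1)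

variable {U : Set V} {S M : Finset K} {T T' : Finset V} {v w : V} {ws : List V} {N : ℕ}

theorem IsPartialTransversal.not_adj (hT : IsPartialTransversal G κ T) (hv : v ∈ T)
    (hw : w ∈ T) : ¬ G.Adj v w := fun hadj =>
  hT.indep hv hw hadj.ne hadj

theorem IsPartialTransversal.mono (hT : IsPartialTransversal G κ T) (h : T' ⊆ T) :
    IsPartialTransversal G κ T' :=
  ⟨hT.indep.mono (Finset.coe_subset.2 h), hT.injOn.mono (Finset.coe_subset.2 h)⟩

theorem IsPartialTransversal.union (hT : IsPartialTransversal G κ T)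
    (hT' : IsPartialTransversal G κ T') (hadj : ∀ v ∈ T, ∀ w ∈ T', ¬ G.Adj v w)
    (hκ : ∀ v ∈ T, ∀ w ∈ T', κ v ≠ κ w) : IsPartialTransversal G κ (T ∪ T') where
  indep := by
    intro v hv w hw _
    rcases Finset.mem_union.1 (Finset.mem_coe.1 hv) with hv | hv <;>
      rcases Finset.mem_union.1 (Finset.mem_coe.1 hw) with hw | hw
    · exact hT.not_adj hv hw
    · exact hadj v hv w hw
    · exact fun h => hadj w hw v hv h.symm
    · exact hT'.not_adj hv hw
  injOn := by
    intro v hv w hw hvw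
    rcases Finset.mem_union.1 (Finset.mem_coe.1 hv) with hv | hv <;>
      rcases Finset.mem_union.1 (Finset.mem_coe.1 hw) with hw | hw
    · exact hT.injOn hv hw hvw
    · exact (hκ v hv w hw hvw).elim
    · exact (hκ w hw v hv hvw.symm).elim
    · exact hT'.injOn hv hw hvw

protected theorem IsTransversalIn.erase (hT : IsTransversalIn G κ U S T) (v : V) :
    IsTransversalIn G κ U S (T.erase v) where
  toIsPartialTransversal := hT.mono (Finset.erase_subset v T)
  mem_U u hu := hT.mem_U u (Finset.mem_of_mem_erase hu)
  mem_S u hu := hT.mem_S u (Finset.mem_of_mem_erase hu)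

protected theorem IsTransversalIn.insert (hT : IsTransversalIn G κ U S T) (hU : w ∈ U)
    (hS : κ w ∈ S) (hadj : ∀ v ∈ T, ¬ G.Adj w v) (hκ : ∀ v ∈ T, κ v ≠ κ w) :
    IsTransversalIn G κ U S (insert w T) where
  toIsPartialTransversal := by
    rw [Finset.insert_eq]
    refine IsPartialTransversal.union ⟨by simp, by simp⟩ hT.toIsPartialTransversal ?_ ?_
    · simpa using hadj
    · simpa [eq_comm] using hκ
  mem_U := Finset.forall_mem_insert _ _ _ |>.2 ⟨hU, hT.mem_U⟩
  mem_S := Finset.forall_mem_insert _ _ _ |>.2 ⟨hS, hT.mem_S⟩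

theorem IsTransversalIn.exchange (hT : IsTransversalIn G κ U S T) (hU : w ∈ U) (hv : v ∈ T)
    (hκ : κ w = κ v) (hadj : ∀ u ∈ T, ¬ G.Adj w u) :
    IsTransversalIn G κ U S (insert w (T.erase v)) :=
  (hT.erase v).insert hU (hκ ▸ hT.mem_S v hv) (fun u hu => hadj u (Finset.mem_of_mem_erase hu))
    fun _ hu h => Finset.ne_of_mem_erase hu
      (hT.injOn (Finset.mem_of_mem_erase hu) hv (h.trans hκ))

theorem missed_insert_erase (hv : v ∈ T) (hκ : κ w = κ v) :
    missed κ S (insert w (T.erase v)) = missed κ S T := by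
  rw [missed, missed, Finset.image_insert, hκ, ← Finset.image_insert, Finset.insert_erase hv]

theorem class_notMem_missed (hv : v ∈ T) : κ v ∉ missed κ S T := fun h =>
  (Finset.mem_sdiff.1 h).2 (Finset.mem_image_of_mem κ hv)

theorem IsTransversalIn.card_add_card_missed (hT : IsTransversalIn G κ U S T) :
    T.card + (missed κ S T).card = S.card := by
  rw [missed, ← Finset.card_image_of_injOn hT.injOn, add_comm]
  exact Finset.card_sdiff_add_card_eq_card (Finset.image_subset_iff.2 hT.mem_S)

theorem filter_adj_insert_erase {u : V} (h : ¬ G.Adj u w) :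
    (insert w (T.erase v)).filter (G.Adj u) = (T.filter (G.Adj u)).erase v := by
  rw [Finset.filter_insert, if_neg h, Finset.filter_erase]

theorem mem_leaves : v ∈ leaves G T ws ↔ v ∈ T ∧ ∃ w ∈ ws, G.Adj w v :=
  Finset.mem_filter

theorem leaves_cons : leaves G T (w :: ws) = leaves G T ws ∪ T.filter (G.Adj w) := by
  simp only [leaves, List.mem_cons, exists_eq_or_imp, Finset.filter_or, Finset.union_comm]

theorem mem_reached {c : K} :
    c ∈ reached G κ M T ws ↔ c ∈ M ∨ ∃ v ∈ leaves G T ws, κ v = c := by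
  simp only [reached, Finset.mem_union, Finset.mem_image]

theorem reached_subset_reached_cons : reached G κ M T ws ⊆ reached G κ M T (w :: ws) := by
  rw [reached, reached, leaves_cons]
  gcongr
  exact Finset.subset_union_left

theorem IsCandidate.of_cons {u : V} (h : IsCandidate G κ U M T (u :: ws) w)
    (hr : κ w ∈ reached G κ M T ws) : IsCandidate G κ U M T ws w where
  mem_U := h.mem_U
  mem_reached := hr
  not_adj v hv := h.not_adj v (List.mem_cons_of_mem _ hv)
  not_adj_leaves v hv := h.not_adj_leaves v (leaves_cons ▸ Finset.mem_union_left _ hv)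

theorem IsCandidate.congr (h : IsCandidate G κ U M T ws w)
    (hl : leaves G T' ws = leaves G T ws) : IsCandidate G κ U M T' ws w where
  mem_U := h.mem_U
  mem_reached := by simpa only [reached, hl] using h.mem_reached
  not_adj := h.not_adj
  not_adj_leaves := hl ▸ h.not_adj_leaves

namespace IsAlt

theorem base (h : IsAlt G κ U S M T ws) : IsTransversalIn G κ U S T ∧ missed κ S T = M := by
  induction ws with
  | nil => exact h
  | cons w ws ih => exact ih h.1

theorem class_notMem (h : IsAlt G κ U S M T ws) (hv : v ∈ T) : κ v ∉ M :=
  h.base.2 ▸ class_notMem_missed hv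

theorem card_leaves_cons (h : IsAlt G κ U S M T (w :: ws)) :
    (leaves G T (w :: ws)).card = (leaves G T ws).card + (T.filter (G.Adj w)).card := by
  rw [leaves_cons, Finset.card_union_of_disjoint]
  rw [Finset.disjoint_left]
  exact fun v hv hv' => h.2.1.not_adj_leaves v hv (Finset.mem_filter.1 hv').2

theorem length_le (h : IsAlt G κ U S M T ws) : ws.length ≤ (leaves G T ws).card := by
  induction ws with
  | nil => simp
  | cons w ws ih =>
    rw [h.card_leaves_cons, List.length_cons]
    exact Nat.add_le_add (ih h.1) (Finset.card_pos.2 h.2.2)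

theorem card_reached (h : IsAlt G κ U S M T ws) :
    (reached G κ M T ws).card = M.card + (leaves G T ws).card := by
  rw [reached, Finset.card_union_of_disjoint, Finset.card_image_of_injOn]
  · exact h.base.1.injOn.mono (Finset.coe_subset.2 (Finset.filter_subset _ _))
  · rw [Finset.disjoint_right]
    intro c hc
    obtain ⟨v, hv, rfl⟩ := Finset.mem_image.1 hc
    exact h.class_notMem (mem_leaves.1 hv).1

theorem reached_subset (h : IsAlt G κ U S M T ws) : reached G κ M T ws ⊆ S := by
  rw [reached, ← h.base.2]
  exact Finset.union_subset Finset.sdiff_subset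
    (Finset.image_subset_iff.2 fun v hv => h.base.1.mem_S v (mem_leaves.1 hv).1)

theorem mem_of_mem (h : IsAlt G κ U S M T ws) :
    ∀ w ∈ ws, w ∈ U ∧ κ w ∈ reached G κ M T ws := by
  induction ws with
  | nil => simp
  | cons w ws ih =>
    refine List.forall_mem_cons.2 ⟨⟨h.2.1.mem_U, ?_⟩, fun u hu => ⟨(ih h.1 u hu).1, ?_⟩⟩
    · exact reached_subset_reached_cons h.2.1.mem_reached
    · exact reached_subset_reached_cons (ih h.1 u hu).2

theorem mem_of_mem_or_mem_leaves (h : IsAlt G κ U S M T ws) (hv : v ∈ ws ∨ v ∈ leaves G T ws) :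
    v ∈ U ∧ κ v ∈ reached G κ M T ws := by
  rcases hv with hv | hv
  · exact h.mem_of_mem v hv
  · exact ⟨h.base.1.mem_U v (mem_leaves.1 hv).1, mem_reached.2 (Or.inr ⟨v, hv, rfl⟩)⟩

end IsAlt

theorem IsInducedMatchingConfig.cons {m : ℕ} {z : Fin m → Bool → V}
    (hz : IsInducedMatchingConfig G κ z) {x : Bool → V} (hx : ∀ b, G.Adj (x b) (x !b))
    (hxz : ∀ b j b', ¬ G.Adj (x b) (z j b'))
    (hκ : ¬ Linked (classEnds κ z) Set.univ (κ (x false)) (κ (x true))) :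
    IsInducedMatchingConfig G κ (Fin.cons x z : Fin (m + 1) → Bool → V) where
  adj := Fin.cases hx hz.adj
  induced := by
    refine Fin.cases (Fin.cases (fun h => (h rfl).elim) fun j _ b b' => hxz b j b') fun i => ?_
    refine Fin.cases (fun _ b b' h => hxz b' i b h.symm) fun j hij => ?_
    exact hz.induced i j fun h => hij (congrArg _ h)
  isForest := by
    have hsucc : IsForest (classEnds κ (Fin.cons x z : Fin (m + 1) → Bool → V))
        (Fin.succ '' Set.univ) :=
      IsForest.of_comp_label (Fin.succ_injective m) hz.isForest
    refine (hsucc.insert_edge (i := 0) ?_).mono fun j _ => ?_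
    · exact fun h => hκ ((linked_comp_iff (f := Fin.succ) _).2 h)
    · rcases Fin.eq_zero_or_eq_succ j with rfl | ⟨j, rfl⟩
      · exact Or.inl rfl
      · exact Or.inr ⟨j, trivial, rfl⟩

/-- The hypothesis says that every vertex of `ws` has exactly one leaf, which it is matched to. -/
theorem IsAlt.exists_isInducedMatchingConfig (h : IsAlt G κ U S M T ws)
    (hcard : (leaves G T ws).card = ws.length) :
    ∃ z : Fin ws.length → Bool → V, IsInducedMatchingConfig G κ z ∧
      ∀ v, (∃ j b, z j b = v) ↔ v ∈ ws ∨ v ∈ leaves G T ws := by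
  induction ws with
  | nil => exact ⟨Fin.elim0, ⟨Fin.rec0, Fin.rec0, Fin.rec0⟩, fun v => by simp [leaves]⟩
  | cons w ws ih =>
    have hle := h.1.length_le
    have hpos := Finset.card_pos.2 h.2.2
    rw [h.card_leaves_cons, List.length_cons] at hcard
    obtain ⟨z, hz, hmem⟩ := ih h.1 (by omega)
    obtain ⟨v, hv⟩ := Finset.card_eq_one.1 (show (T.filter (G.Adj w)).card = 1 by omega)
    obtain ⟨hvT, hwv⟩ := Finset.mem_filter.1 (hv ▸ Finset.mem_singleton_self v)
    have hvl : v ∉ leaves G T ws := fun hl => h.2.1.not_adj_leaves v hl hwv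
    have hz' j b : z j b ∈ ws ∨ z j b ∈ leaves G T ws := (hmem _).1 ⟨j, b, rfl⟩
    refine ⟨Fin.cons (Bool.rec w v) z, hz.cons ?_ ?_ fun hlink => ?_, fun u => ?_⟩
    · exact Bool.forall_bool.2 ⟨hwv, hwv.symm⟩
    · refine Bool.forall_bool.2 ⟨fun j b hadj => ?_, fun j b hadj => ?_⟩
      · exact (hz' j b).elim (fun hj => h.2.1.not_adj _ hj hadj.symm)
          fun hj => h.2.1.not_adj_leaves _ hj hadj
      · exact (hz' j b).elim (fun hj => hvl (mem_leaves.2 ⟨hvT, _, hj, hadj.symm⟩))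
          fun hj => h.base.1.not_adj hvT (mem_leaves.1 hj).1 hadj
    · -- `w` lies in a reached class, `v` does not, and all earlier edges join reached classes.
      have hreach : κ v ∈ reached G κ M T ws := by
        refine (hlink.mem_iff (S := reached G κ M T ws) fun j _ => iff_of_true ?_ ?_).1
          h.2.1.mem_reached
        exacts [(h.1.mem_of_mem_or_mem_leaves (hz' j _)).2,
          (h.1.mem_of_mem_or_mem_leaves (hz' j _)).2]
      rcases mem_reached.1 hreach with hM | ⟨u, hu, huv⟩
      · exact h.class_notMem hvT hM
      · exact hvl (h.base.1.injOn (mem_leaves.1 hu).1 hvT huv ▸ hu)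
    · refine Fin.exists_fin_succ.trans ?_
      simp only [Fin.cons_zero, Fin.cons_succ, hmem]
      simp only [Bool.exists_bool, leaves_cons, hv, List.mem_cons, Finset.mem_union,
        Finset.mem_singleton, eq_comm (b := u)]
      tauto

/-- Otherwise `w` could be added to `T`. -/
theorem IsAlt.class_notMem_of_filter_eq_empty (h : IsAlt G κ U S M T ws)
    (hmax : ∀ T', IsTransversalIn G κ U S T' → M.card ≤ (missed κ S T').card) (hU : w ∈ U)
    (hw : T.filter (G.Adj w) = ∅) : κ w ∉ M := by
  intro hM
  have hwS : κ w ∈ S := (Finset.mem_sdiff.1 (h.base.2 ▸ hM)).1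
  have hins := hmax _ (h.base.1.insert hU hwS (fun v hv => Finset.filter_eq_empty_iff.1 hw hv)
    fun v hv hvw => h.class_notMem hv (hvw ▸ hM))
  refine hins.not_gt (Finset.card_lt_card ?_)
  rw [missed, Finset.image_insert, Finset.sdiff_insert, ← missed, h.base.2]
  exact Finset.erase_ssubset hM

theorem IsAlt.congr (h : IsAlt G κ U S M T ws) (hT' : IsAlt G κ U S M T' [])
    (hc : ∀ w ∈ ws, T'.filter (G.Adj w) = T.filter (G.Adj w)) (N : ℕ) :
    IsAlt G κ U S M T' ws ∧ leaves G T' ws = leaves G T ws ∧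
      altPot G N T' ws = altPot G N T ws := by
  induction ws with
  | nil => exact ⟨hT', by simp [leaves], rfl⟩
  | cons w ws ih =>
    obtain ⟨hAlt, hleaves, hpot⟩ := ih h.1 fun u hu => hc u (List.mem_cons_of_mem _ hu)
    have hw := hc w List.mem_cons_self
    refine ⟨⟨hAlt, h.2.1.congr hleaves, hw ▸ h.2.2⟩, ?_, ?_⟩
    · rw [leaves_cons, leaves_cons, hleaves, hw]
    · simp only [altPot, hpot, hw]

/-- The leaf of `u` in the class of `w` is replaced by `w`. -/
theorem IsAlt.exists_exchange {u : V} (h : IsAlt G κ U S M T (u :: ws))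
    (hw : IsCandidate G κ U M T (u :: ws) w) (hwT : T.filter (G.Adj w) = ∅)
    (hr : κ w ∉ reached G κ M T ws) (N : ℕ) :
    ∃ T', ∃ v ∈ T.filter (G.Adj u), T'.filter (G.Adj u) = (T.filter (G.Adj u)).erase v ∧
      IsAlt G κ U S M T' ws ∧ leaves G T' ws = leaves G T ws ∧
      altPot G N T' ws = altPot G N T ws := by
  rw [mem_reached, not_or, not_exists] at hr
  obtain ⟨v, hv, hvw⟩ := (mem_reached.1 hw.mem_reached).resolve_left hr.1
  have hvl : v ∉ leaves G T ws := fun hl => hr.2 v ⟨hl, hvw⟩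
  rw [leaves_cons, Finset.mem_union, or_iff_right hvl] at hv
  have hvT := (Finset.mem_filter.1 hv).1
  have hT' : IsAlt G κ U S M (insert w (T.erase v)) [] :=
    ⟨h.base.1.exchange hw.mem_U hvT hvw.symm fun x hx => Finset.filter_eq_empty_iff.1 hwT hx,
      (missed_insert_erase hvT hvw.symm).trans h.base.2⟩
  refine ⟨_, v, hv, filter_adj_insert_erase (hw.not_adj u List.mem_cons_self),
    h.1.congr hT' (fun x hx => ?_) N⟩
  rw [filter_adj_insert_erase (hw.not_adj x (List.mem_cons_of_mem _ hx)),
    Finset.erase_eq_of_notMem]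
  exact fun hvx => hvl (mem_leaves.2 ⟨hvT, x, hx, (Finset.mem_filter.1 hvx).2⟩)

theorem IsAlt.length_lt [Fintype V] (h : IsAlt G κ U S M T ws) (hN : Fintype.card V < N) :
    ws.length < N :=
  (h.length_le.trans (Finset.card_le_univ _)).trans_lt hN

theorem altPot_lt_altPot_cons [Fintype V] (hN : Fintype.card V < N) :
    altPot G N T ws < altPot G N T (w :: ws) := by
  have hcard := (T.filter (G.Adj w)).card_le_univ
  exact Nat.lt_add_of_pos_right (Nat.mul_pos (by omega) (Nat.pow_pos (by omega)))

theorem IsAlt.altPot_cons_add_le [Fintype V] (h : IsAlt G κ U S M T (w :: ws))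
    (hN : Fintype.card V < N) :
    altPot G N T (w :: ws) + N ^ (N - (ws.length + 1)) ≤
      altPot G N T ws + N ^ (N - ws.length) := by
  have hlen := h.1.length_lt hN
  have hpos := Finset.card_pos.2 h.2.2
  calc altPot G N T (w :: ws) + N ^ (N - (ws.length + 1))
      = altPot G N T ws + (N - (T.filter (G.Adj w)).card + 1) * N ^ (N - ws.length - 1) := by
        rw [altPot, Nat.sub_add_eq, add_mul, one_mul, add_assoc]
    _ ≤ altPot G N T ws + N * N ^ (N - ws.length - 1) := by
        gcongr
        omega
    _ = altPot G N T ws + N ^ (N - ws.length) := by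
        rw [← pow_succ', Nat.sub_add_cancel (by omega)]

theorem IsAlt.altPot_add_le [Fintype V] (h : IsAlt G κ U S M T ws)
    (hN : Fintype.card V < N) : altPot G N T ws + N ^ (N - ws.length) ≤ N ^ N := by
  induction ws with
  | nil => simp [altPot]
  | cons w ws ih => exact (h.altPot_cons_add_le hN).trans (ih h.1)

theorem IsAlt.exists_improvement [Fintype V] (hN : Fintype.card V < N)
    (hmax : ∀ T, IsTransversalIn G κ U S T → M.card ≤ (missed κ S T).card)
    (h : IsAlt G κ U S M T ws) (hw : IsCandidate G κ U M T ws w)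
    (hwT : T.filter (G.Adj w) = ∅) :
    ∃ T' ws', IsAlt G κ U S M T' ws' ∧
      altPot G N T ws + N ^ (N - ws.length) ≤ altPot G N T' ws' := by
  induction ws generalizing T w with
  | nil =>
    refine (h.class_notMem_of_filter_eq_empty hmax hw.mem_U hwT ?_).elim
    simpa [reached, leaves] using hw.mem_reached
  | cons u ws ih =>
    by_cases hr : κ w ∈ reached G κ M T ws
    · obtain ⟨T', ws', hAlt, hpot⟩ := ih h.1 (hw.of_cons hr) hwT
      exact ⟨T', ws', hAlt, (h.altPot_cons_add_le hN).trans hpot⟩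
    obtain ⟨T', v, hv, hfilter, hAlt, hleaves, hpot⟩ := h.exists_exchange hw hwT hr N
    have hu := h.2.1.congr hleaves
    rcases (T'.filter (G.Adj u)).eq_empty_or_nonempty with hempty | hne
    · obtain ⟨T'', ws', hAlt', hpot'⟩ := ih hAlt hu hempty
      exact ⟨T'', ws', hAlt', (h.altPot_cons_add_le hN).trans (hpot ▸ hpot')⟩
    · refine ⟨T', u :: ws, ⟨hAlt, hu, hne⟩, ?_⟩
      have hcard := (T.filter (G.Adj u)).card_le_univ
      have hpos := Finset.card_pos.2 ⟨v, hv⟩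
      simp only [altPot, hpot, hfilter, Finset.card_erase_of_mem hv, List.length_cons]
      rw [Nat.sub_add_eq, show N - ((T.filter (G.Adj u)).card - 1) =
        N - (T.filter (G.Adj u)).card + 1 by omega, add_mul, one_mul, add_assoc]

theorem IsAlt.exists_terminal [Finite V] (h : IsAlt G κ U S M T [])
    (hmax : ∀ T', IsTransversalIn G κ U S T' → M.card ≤ (missed κ S T').card) :
    ∃ T ws, IsAlt G κ U S M T ws ∧ ∀ w, ¬ IsCandidate G κ U M T ws w := by
  by_contra! hcon
  have := Fintype.ofFinite V
  obtain ⟨N, hN⟩ := exists_gt (Fintype.card V)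
  have hstep : ∀ n, ∃ T ws, IsAlt G κ U S M T ws ∧ n ≤ altPot G N T ws := by
    intro n
    induction n with
    | zero => exact ⟨T, [], h, Nat.zero_le _⟩
    | succ n ih =>
      obtain ⟨T, ws, hAlt, hn⟩ := ih
      obtain ⟨w, hw⟩ := hcon T ws hAlt
      rcases (T.filter (G.Adj w)).eq_empty_or_nonempty with hempty | hne
      · obtain ⟨T', ws', hAlt', hpot⟩ := hAlt.exists_improvement hN hmax hw hempty
        have : 0 < N ^ (N - ws.length) := Nat.pow_pos (by omega)
        exact ⟨T', ws', hAlt', by omega⟩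
      · exact ⟨T, w :: ws, ⟨hAlt, hw, hne⟩, hn.trans_lt (altPot_lt_altPot_cons hN)⟩
  obtain ⟨T, ws, hAlt, hn⟩ := hstep (N ^ N + 1)
  have := hAlt.altPot_add_le hN
  omega

theorem IsAlt.exists_adj_of_terminal (h : ∀ w, ¬ IsCandidate G κ U M T ws w) (hU : v ∈ U)
    (hv : κ v ∈ reached G κ M T ws) : ∃ w, (w ∈ ws ∨ w ∈ leaves G T ws) ∧ G.Adj w v := by
  by_contra! hcon
  exact h v ⟨hU, hv, fun u hu => hcon u (Or.inl hu), fun u hu hadj => hcon u (Or.inr hu) hadj.symm⟩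

/-- A form of a lemma of Szabó and Tardos. -/
theorem exists_dominating [Finite V] (hT : IsTransversalIn G κ U S T)
    (hmax : ∀ T', IsTransversalIn G κ U S T' → T'.card ≤ T.card) :
    ∃ Q ⊆ S, missed κ S T ⊆ Q ∧
      ((∃ W : Finset V, 2 * (missed κ S T).card + W.card + 1 ≤ 2 * Q.card ∧
          ∀ v ∈ U, κ v ∈ Q → ∃ w ∈ W, G.Adj w v) ∨
        ∃ (m : ℕ) (z : Fin m → Bool → V), IsInducedMatchingConfig G κ z ∧
          (∀ j b, z j b ∈ U ∧ κ (z j b) ∈ Q) ∧ m + (missed κ S T).card = Q.card ∧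
          ∀ v ∈ U, κ v ∈ Q → ∃ j b, G.Adj (z j b) v) := by
  obtain ⟨T₁, ws, hAlt, hterm⟩ := IsAlt.exists_terminal (M := missed κ S T) ⟨hT, rfl⟩
    fun T' hT' => by
      have := hT.card_add_card_missed
      have := hT'.card_add_card_missed
      have := hmax T' hT'
      omega
  have hcard := hAlt.card_reached
  refine ⟨reached G κ (missed κ S T) T₁ ws, hAlt.reached_subset, Finset.subset_union_left, ?_⟩
  rcases hAlt.length_le.lt_or_eq with hlt | heq
  · refine Or.inl ⟨ws.toFinset ∪ leaves G T₁ ws, ?_, fun v hU hv => ?_⟩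
    · have := Finset.card_union_le ws.toFinset (leaves G T₁ ws)
      have := ws.toFinset_card_le
      omega
    · obtain ⟨w, hw, hadj⟩ := IsAlt.exists_adj_of_terminal hterm hU hv
      exact ⟨w, by simpa using hw, hadj⟩
  · obtain ⟨z, hz, hmem⟩ := hAlt.exists_isInducedMatchingConfig heq.symm
    refine Or.inr ⟨ws.length, z, hz, fun j b => ?_, by omega, fun v hU hv => ?_⟩
    · exact hAlt.mem_of_mem_or_mem_leaves ((hmem _).1 ⟨j, b, rfl⟩)
    · obtain ⟨w, hw, hadj⟩ := IsAlt.exists_adj_of_terminal hterm hU hv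
      obtain ⟨j, b, rfl⟩ := (hmem w).2 hw
      exact ⟨j, b, hadj⟩

end Alternation

section DeficientPartition

variable {V ι J J₁ J₂ : Type*} {G : SimpleGraph V} {κ : V → ι} {n Δ D : ℕ}

/-- The union of the classes in `X`. -/
noncomputable def classUnion [Fintype V] (κ : V → ι) (X : Finset ι) : Finset V :=
  {v | κ v ∈ X}

theorem mem_classUnion [Fintype V] {X : Finset ι} {v : V} :
    v ∈ classUnion κ X ↔ κ v ∈ X := by
  simp only [classUnion, Finset.mem_filter_univ]

/-- A graph of maximum degree at most `Δ` with classes of size at least `n` all of whose partial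
independent transversals miss at least `D` classes. The last field says that
`n > 2 * Δ * (1 - (6 * D + 1) / (6 * y))` for all positive `y` up to the number of classes. -/
structure DeficientPartition [Fintype V] (G : SimpleGraph V) (κ : V → ι) (n Δ D : ℕ) :
    Prop where
  degree_le : ∀ v, G.degree v ≤ Δ
  size : ∀ c, n ≤ (classUnion κ {c}).card
  missing : ∀ T, IsPartialTransversal G κ T → T.card + D ≤ Nat.card ι
  one_le : 1 ≤ D
  tight : ∀ y, 1 ≤ y → y ≤ Nat.card ι → 6 * Δ * y < 3 * n * y + 6 * Δ * D + Δ

namespace DeficientPartition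

variable [Fintype V]

theorem finite (H : DeficientPartition G κ n Δ D) : Finite ι := by
  have := H.missing ∅ ⟨by simp, by simp⟩
  have := H.one_le
  exact Nat.finite_of_card_ne_zero (by omega)

theorem mul_card_le_card_classUnion (H : DeficientPartition G κ n Δ D) (X : Finset ι) :
    n * X.card ≤ (classUnion κ X).card := by
  have hX : classUnion κ X = X.biUnion fun c => classUnion κ {c} := by
    ext v
    simp only [mem_classUnion, Finset.mem_biUnion, Finset.mem_singleton, exists_eq_right']
  rw [hX, Finset.card_biUnion, mul_comm, ← smul_eq_mul]
  · exact Finset.card_nsmul_le_sum _ _ _ fun c _ => H.size c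
  · refine fun c _ d _ hcd => Finset.disjoint_left.2 fun v hc hd => hcd ?_
    rw [mem_classUnion, Finset.mem_singleton] at hc hd
    exact hc.symm.trans hd

theorem card_le_of_cover (H : DeficientPartition G κ n Δ D) {X : Finset V} (W E : Finset V)
    (h : ∀ v ∈ X, v ∈ E ∨ ∃ w ∈ W, G.Adj w v) : X.card ≤ Δ * W.card + E.card := by
  have hX : X ⊆ W.biUnion (fun w => G.neighborFinset w) ∪ E := fun v hv => by
    simpa only [Finset.mem_union, Finset.mem_biUnion, G.mem_neighborFinset, or_comm] using h v hv
  have hW : (W.biUnion fun w => G.neighborFinset w).card ≤ W.card * Δ :=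
    Finset.card_biUnion_le_card_mul _ _ _ fun w _ => H.degree_le w
  have := (Finset.card_le_card hX).trans (Finset.card_union_le _ _)
  rw [mul_comm] at hW
  omega

theorem tight_cover (H : DeficientPartition G κ n Δ D) {X : Finset ι} (hX : X.Nonempty)
    (W E : Finset V) (h : ∀ v, κ v ∈ X → v ∈ E ∨ ∃ w ∈ W, G.Adj w v) :
    6 * Δ * X.card < 3 * Δ * W.card + 3 * E.card + 6 * Δ * D + Δ := by
  have := H.finite
  have := Fintype.ofFinite ι
  have h1 := H.card_le_of_cover (X := classUnion κ X) W E fun v hv => h v (mem_classUnion.1 hv)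
  have h2 := H.mul_card_le_card_classUnion X
  have h3 := H.tight X.card (Finset.card_pos.2 hX)
    (Nat.card_eq_fintype_card (α := ι) ▸ Finset.card_le_univ _)
  nlinarith

theorem two_mul_card_le (H : DeficientPartition G κ n Δ D) {X : Finset ι} (hX : X.Nonempty)
    (W : Finset V) (h : ∀ v, κ v ∈ X → ∃ w ∈ W, G.Adj w v) : 2 * X.card ≤ W.card + 2 * D := by
  have h1 := H.tight_cover hX W ∅ fun v hv => Or.inr (h v hv)
  by_contra! hc
  have : 3 * Δ * (W.card + 2 * D + 1) ≤ 3 * Δ * (2 * X.card) := Nat.mul_le_mul_left _ hc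
  simp only [Finset.card_empty] at h1
  nlinarith

end DeficientPartition

/-- The transversal is enlarged by one end of each edge with label in `A`, chosen so that no
class is used twice. -/
theorem IsInducedMatchingConfig.exists_isPartialTransversal_card_eq {z : J → Bool → V}
    (hz : IsInducedMatchingConfig G κ z) (A : Finset J) {T : Finset V}
    (hT : IsPartialTransversal G (fun v => component (classEnds κ z) (A : Set J) (κ v)) T)
    (hTz : ∀ t ∈ T, ∀ j ∈ A, ∀ b, ¬ G.Adj (z j b) t) :
    ∃ T', IsPartialTransversal G κ T' ∧ T'.card = T.card + A.card := by
  have hTκ : Set.InjOn (component (classEnds κ z) (A : Set J)) (κ '' T) := by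
    rintro _ ⟨u, hu, rfl⟩ _ ⟨v, hv, rfl⟩ huv
    rw [hT.injOn hu hv huv]
  obtain ⟨f, hf, hfT⟩ :=
    (hz.isForest.mono (Set.subset_univ _)).exists_injOn_end A (κ '' T) hTκ
  have hne : ∀ t ∈ T, ∀ i ∈ A, κ t ≠ κ (z i (f i)) := fun t ht i hi h => hfT i hi ⟨t, ht, h⟩
  have hends : IsPartialTransversal G κ (A.image fun i => z i (f i)) := by
    constructor <;> simp only [Finset.coe_image, Set.InjOn, SimpleGraph.IsIndepSet, Set.Pairwise,
      Set.forall_mem_image]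
    · exact fun i _ j _ hij => hz.induced i j (fun h => hij (by rw [h])) _ _
    · exact fun i hi j hj hij => by rw [hf hi hj hij]
  refine ⟨_, (⟨hT.indep, fun u hu v hv huv => hT.injOn hu hv (congrArg _ huv)⟩ :
    IsPartialTransversal G κ T).union hends ?_ ?_, ?_⟩
  · exact fun t ht => Finset.forall_mem_image.2 fun i hi h => hTz t ht i hi _ h.symm
  · exact fun t ht => Finset.forall_mem_image.2 fun i hi => hne t ht i hi
  · rw [Finset.card_union_of_disjoint,
      Finset.card_image_of_injOn fun i hi j hj hij => hf hi hj (congrArg κ hij)]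
    refine Finset.disjoint_left.2 fun t ht htA => ?_
    obtain ⟨i, hi, rfl⟩ := Finset.mem_image.1 htA
    exact hne _ ht i hi rfl

theorem DeficientPartition.card_add_card_add_le [Fintype V] (H : DeficientPartition G κ n Δ D)
    {z : J → Bool → V} (hz : IsInducedMatchingConfig G κ z) (A : Finset J) {T : Finset V}
    (hT : IsPartialTransversal G (fun v => component (classEnds κ z) (A : Set J) (κ v)) T)
    (hTz : ∀ t ∈ T, ∀ j ∈ A, ∀ b, ¬ G.Adj (z j b) t) : T.card + A.card + D ≤ Nat.card ι := by
  obtain ⟨T', hT', hcard⟩ := hz.exists_isPartialTransversal_card_eq A hT hTz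
  exact hcard ▸ H.missing T' hT'

/-- The map from the classes of `κ` to those obtained by contracting the edges of the matching
`z`. -/
def contractedClass (κ : V → ι) (z : J → Bool → V) : ι → Component (classEnds κ z) Set.univ :=
  component (classEnds κ z) Set.univ

/-- The set of vertices not dominated by the matching `z`. -/
def undominated (G : SimpleGraph V) (z : J → Bool → V) : Set V := {v | ∀ j b, ¬ G.Adj (z j b) v}

theorem notMem_undominated {z : J → Bool → V} {v : V} :
    v ∉ undominated G z ↔ ∃ j b, G.Adj (z j b) v := by
  simp only [undominated, Set.mem_ofPred_eq, not_forall, not_not]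

/-- Every transversal of `Q` among the contracted classes, using only undominated vertices, misses
`D` of them. -/
def HasDeficiency (G : SimpleGraph V) (κ : V → ι) (D : ℕ) (z : J → Bool → V)
    (Q : Finset (Component (classEnds κ z) Set.univ)) : Prop :=
  ∀ T, IsTransversalIn G (fun v => contractedClass κ z (κ v)) (undominated G z) Q T →
    T.card + D ≤ Q.card

theorem IsInducedMatchingConfig.sum [Finite J₂] {z₁ : J₁ → Bool → V} {z₂ : J₂ → Bool → V}
    (h₁ : IsInducedMatchingConfig G κ z₁)
    (h₂ : IsInducedMatchingConfig G (fun v => contractedClass κ z₁ (κ v)) z₂)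
    (h : ∀ j b, z₂ j b ∈ undominated G z₁) :
    IsInducedMatchingConfig G κ (Sum.elim z₁ z₂) where
  adj := Sum.rec h₁.adj h₂.adj
  induced := by
    rintro (i | i) (j | j) hij b b'
    · exact h₁.induced i j (fun h => hij (congrArg _ h)) b b'
    · exact h j b' i b
    · exact fun hadj => h i b j b' hadj.symm
    · exact h₂.induced i j (fun h => hij (congrArg _ h)) b b'
  isForest := by
    have hsum : classEnds κ (Sum.elim z₁ z₂) = Sum.elim (classEnds κ z₁) (classEnds κ z₂) := by
      funext i
      rcases i with i | i <;> rfl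
    exact hsum ▸ h₁.isForest.sum h₂.isForest

theorem HasDeficiency.exists_extension [Finite V] {z₁ : J₁ → Bool → V}
    (h₁ : IsInducedMatchingConfig G κ z₁) {Q : Finset (Component (classEnds κ z₁) Set.univ)}
    {c : Component (classEnds κ z₁) Set.univ} (hc : c ∈ Q) (hQ : HasDeficiency G κ D z₁ Q)
    (hQ' : ¬ HasDeficiency G κ D z₁ (Q.erase c)) :
    ∃ Q' ⊆ Q, c ∈ Q' ∧
      ((∃ W : Finset V, W.card + 2 * D + 1 ≤ 2 * Q'.card ∧
          ∀ v ∈ undominated G z₁, contractedClass κ z₁ (κ v) ∈ Q' → ∃ w ∈ W, G.Adj w v) ∨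
        ∃ (m : ℕ) (z₂ : Fin m → Bool → V), IsInducedMatchingConfig G κ (Sum.elim z₁ z₂) ∧
          (∀ j b, contractedClass κ z₁ (κ (z₂ j b)) ∈ Q') ∧ m + D = Q'.card ∧
          ∀ v ∈ undominated G z₁, contractedClass κ z₁ (κ v) ∈ Q' →
            ∃ j b, G.Adj (z₂ j b) v) := by
  unfold HasDeficiency at hQ'
  push Not at hQ'
  obtain ⟨T, hT, hcard⟩ := hQ'
  have hTQ : IsTransversalIn G (fun v => contractedClass κ z₁ (κ v)) (undominated G z₁) Q T :=
    { hT with mem_S := fun v hv => Finset.mem_of_mem_erase (hT.mem_S v hv) }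
  have hTD := hQ T hTQ
  have hQc := Finset.card_erase_add_one hc
  have hcM : c ∈ missed (fun v => contractedClass κ z₁ (κ v)) Q T := by
    refine Finset.mem_sdiff.2 ⟨hc, fun hcT => ?_⟩
    obtain ⟨v, hv, rfl⟩ := Finset.mem_image.1 hcT
    exact Finset.ne_of_mem_erase (hT.mem_S v hv) rfl
  have hM := hTQ.card_add_card_missed
  obtain ⟨Q', hQ'Q, hMQ', hdom⟩ := exists_dominating hTQ fun T' hT' => by
    have := hQ T' hT'
    omega
  refine ⟨Q', hQ'Q, hMQ' hcM, hdom.imp ?_ ?_⟩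
  · exact fun ⟨W, hW, hdom⟩ => ⟨W, by omega, hdom⟩
  · exact fun ⟨m, z₂, hz₂, hmem, hm, hdom⟩ =>
      ⟨m, z₂, h₁.sum hz₂ fun j b => (hmem j b).1, fun j b => (hmem j b).2, by omega, hdom⟩

/-- A full pair: a forest-like induced matching on the classes of `S` which dominates all of them
and has the maximum possible number of edges. -/
structure IsFullPair [Fintype J] (G : SimpleGraph V) (κ : V → ι) (D : ℕ) (S : Finset ι)
    (z : J → Bool → V) : Prop extends IsInducedMatchingConfig G κ z where
  mem : ∀ j b, κ (z j b) ∈ S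
  card_eq : Fintype.card J + D = S.card
  dom : ∀ v, κ v ∈ S → ∃ j b, G.Adj (z j b) v

/-- The vertices of the edges with labels in `A`. -/
noncomputable def ends (z : J → Bool → V) (A : Finset J) : Finset V :=
  (A ×ˢ Finset.univ).image fun s => z s.1 s.2

theorem mem_ends {z : J → Bool → V} {A : Finset J} {v : V} :
    v ∈ ends z A ↔ ∃ j ∈ A, ∃ b, z j b = v := by
  simp only [ends, Finset.mem_image, Finset.mem_product, Finset.mem_univ, and_true, Prod.exists,
    exists_and_left]

theorem card_ends_le (z : J → Bool → V) (A : Finset J) : (ends z A).card ≤ 2 * A.card := by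
  refine Finset.card_image_le.trans ?_
  rw [Finset.card_product, Finset.card_univ, Fintype.card_bool, mul_comm]

theorem card_image_contractedClass [Fintype J] {z : J → Bool → V}
    (hz : IsInducedMatchingConfig G κ z) {X : Finset ι} (h : ∀ i b, κ (z i b) ∈ X) :
    (X.image (contractedClass κ z)).card + Fintype.card J = X.card :=
  hz.isForest.card_image_component_univ h

end DeficientPartition

section FullPair

variable {V ι J J₁ J₂ : Type*} {G : SimpleGraph V} {κ : V → ι} {n Δ D : ℕ}
  {S : Finset ι}

theorem exists_isTransversalIn_forall_card_le [Finite V] (G : SimpleGraph V) (κ : V → ι)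
    (U : Set V) (S : Finset ι) :
    ∃ T, IsTransversalIn G κ U S T ∧ ∀ T', IsTransversalIn G κ U S T' → T'.card ≤ T.card := by
  have := Fintype.ofFinite V
  obtain ⟨T, hT, hmax⟩ := Finset.exists_max_image {T | IsTransversalIn G κ U S T} Finset.card
    ⟨∅, (Finset.mem_filter_univ _).2 ⟨⟨by simp, by simp⟩, by simp, by simp⟩⟩
  simp only [Finset.mem_filter_univ] at hT hmax
  exact ⟨T, hT, hmax⟩

/-- A form of Haxell's theorem. -/
theorem exists_isTransversalIn_or_exists_dominating [Finite V] (G : SimpleGraph V) (κ : V → ι)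
    (U : Set V) (S : Finset ι) :
    (∃ T, IsTransversalIn G κ U S T ∧ T.card = S.card) ∨
      ∃ Q ⊆ S, ∃ W : Finset V, W.card + 2 ≤ 2 * Q.card ∧
        ∀ v ∈ U, κ v ∈ Q → ∃ w ∈ W, G.Adj w v := by
  obtain ⟨T, hT, hmax⟩ := exists_isTransversalIn_forall_card_le G κ U S
  have hcard := hT.card_add_card_missed
  rcases (missed κ S T).card.eq_zero_or_pos with h0 | hpos
  · exact Or.inl ⟨T, hT, by omega⟩
  right
  obtain ⟨Q, hQS, -, ⟨W, hW, hdom⟩ | ⟨m, z, -, -, hm, hdom⟩⟩ := exists_dominating hT hmax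
  · exact ⟨Q, hQS, W, by omega, hdom⟩
  · refine ⟨Q, hQS, ends z Finset.univ, ?_, fun v hv hvQ => ?_⟩
    · have := card_ends_le z Finset.univ
      rw [Finset.card_univ, Fintype.card_fin] at this
      omega
    · obtain ⟨i, b, h⟩ := hdom v hv hvQ
      exact ⟨_, mem_ends.2 ⟨i, Finset.mem_univ _, b, rfl⟩, h⟩

theorem isPartialTransversal_pair {x y : V} (hadj : ¬ G.Adj x y) (hκ : κ x ≠ κ y) :
    IsPartialTransversal G κ {x, y} where
  indep := by
    rw [Finset.coe_pair, SimpleGraph.IsIndepSet, Set.pairwise_pair]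
    exact fun _ => ⟨hadj, fun h => hadj h.symm⟩
  injOn := by
    rw [Finset.coe_pair, Set.injOn_pair]
    exact fun h => (hκ h).elim

theorem DeficientPartition.hasDeficiency_univ [Fintype V] [Fintype ι] [Finite J₁]
    (H : DeficientPartition G κ n Δ D) {z₁ : J₁ → Bool → V}
    (h₁ : IsInducedMatchingConfig G κ z₁) :
    HasDeficiency G κ D z₁ (Finset.univ.image (contractedClass κ z₁)) := fun T hT => by
  have := Fintype.ofFinite J₁
  have hTz := H.card_add_card_add_le h₁ Finset.univ (T := T)
    (by rw [Finset.coe_univ]; exact hT.toIsPartialTransversal) fun t ht j _ b => hT.mem_U t ht j b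
  have hcard := card_image_contractedClass h₁ (X := Finset.univ) fun _ _ => Finset.mem_univ _
  rw [Finset.card_univ] at hcard hTz
  rw [Nat.card_eq_fintype_card] at hTz
  omega

theorem DeficientPartition.two_mul_card_image_le [Fintype V] [Finite J₁]
    (H : DeficientPartition G κ n Δ D) {z₁ : J₁ → Bool → V}
    (h₁ : IsInducedMatchingConfig G κ z₁) {X : Finset ι} (hX : X.Nonempty)
    (hz₁ : ∀ j b, κ (z₁ j b) ∈ X) (W : Finset V)
    (hW : ∀ v ∈ undominated G z₁, κ v ∈ X → ∃ w ∈ W, G.Adj w v) :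
    2 * (X.image (contractedClass κ z₁)).card ≤ W.card + 2 * D := by
  have := Fintype.ofFinite J₁
  have hcover := H.two_mul_card_le hX (ends z₁ Finset.univ ∪ W) fun v hv => by
    by_cases hvU : v ∈ undominated G z₁
    · obtain ⟨w, hw, h⟩ := hW v hvU hv
      exact ⟨w, Finset.mem_union_right _ hw, h⟩
    · obtain ⟨i, b, h⟩ := notMem_undominated.1 hvU
      exact ⟨_, Finset.mem_union_left _ (mem_ends.2 ⟨i, Finset.mem_univ _, b, rfl⟩), h⟩
  have hunion := Finset.card_union_le (ends z₁ Finset.univ) W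
  have hends := card_ends_le z₁ Finset.univ
  rw [Finset.card_univ] at hends
  have hcard := card_image_contractedClass h₁ hz₁
  omega

theorem IsInducedMatchingConfig.isFullPair_sum [Fintype J₁] [Fintype J₂] {z₁ : J₁ → Bool → V}
    {z₂ : J₂ → Bool → V} (h₁ : IsInducedMatchingConfig G κ z₁)
    (h : IsInducedMatchingConfig G κ (Sum.elim z₁ z₂)) (hz₁ : ∀ j b, κ (z₁ j b) ∈ S)
    (hz₂ : ∀ j b, contractedClass κ z₁ (κ (z₂ j b)) ∈ S.image (contractedClass κ z₁))
    (hcard : Fintype.card J₂ + D = (S.image (contractedClass κ z₁)).card)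
    (hdom : ∀ v ∈ undominated G z₁, contractedClass κ z₁ (κ v) ∈ S.image (contractedClass κ z₁) →
      ∃ j b, G.Adj (z₂ j b) v) :
    IsFullPair G κ D S (Sum.elim z₁ z₂) where
  toIsInducedMatchingConfig := h
  mem := by
    rintro (j | j) b
    · exact hz₁ j b
    · obtain ⟨c, hc, hcj⟩ := Finset.mem_image.1 (hz₂ j b)
      have hlinked : Linked (classEnds κ z₁) Set.univ c (κ (z₂ j b)) := component_eq_iff.1 hcj
      exact (hlinked.mem_iff (S := (S : Set ι)) fun i _ => iff_of_true (hz₁ i _) (hz₁ i _)).1 hc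
  card_eq := by
    have := card_image_contractedClass h₁ hz₁
    rw [Fintype.card_sum]
    omega
  dom v hv := by
    by_cases hvU : v ∈ undominated G z₁
    · obtain ⟨j, b, hj⟩ := hdom v hvU (Finset.mem_image_of_mem _ hv)
      exact ⟨Sum.inr j, b, hj⟩
    · obtain ⟨j, b, hj⟩ := notMem_undominated.1 hvU
      exact ⟨Sum.inl j, b, hj⟩

namespace IsFullPair

variable [Fintype J] {z : J → Bool → V} {A : Set J} {j : J}

theorem eq_of_linked (hF : IsFullPair G κ D S z) {c d : ι} (hc : c ∉ S)
    (h : Linked (classEnds κ z) A c d) : c = d := by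
  have := h.mem_iff (S := {c}) fun i _ =>
    iff_of_false (fun h => hc (h ▸ hF.mem i _)) (fun h => hc (h ▸ hF.mem i _))
  exact (this.1 rfl).symm

theorem isPartialTransversal_union (hF : IsFullPair G κ D S z) {X T : Finset V}
    (hX : IsPartialTransversal G (fun v => component (classEnds κ z) A (κ v)) X)
    (hXS : ∀ v ∈ X, κ v ∈ S) (hT : IsPartialTransversal G κ T) (hTS : ∀ t ∈ T, κ t ∉ S)
    (hadj : ∀ v ∈ X, ∀ t ∈ T, ¬ G.Adj v t) :
    IsPartialTransversal G (fun v => component (classEnds κ z) A (κ v)) (X ∪ T) := by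
  have hisolated : ∀ t ∈ T, ∀ v, component (classEnds κ z) A (κ t) =
      component (classEnds κ z) A (κ v) → κ t = κ v := fun t ht v h =>
    hF.eq_of_linked (hTS t ht) (component_eq_iff.1 h)
  refine hX.union ⟨hT.indep, fun t ht u hu h => hT.injOn ht hu (hisolated t ht u h)⟩ hadj
    fun v hv t ht h => hTS t ht ?_
  exact hisolated t ht v h.symm ▸ hXS v hv

theorem two_mul_card_le [Fintype V] (H : DeficientPartition G κ n Δ D) (hF : IsFullPair G κ D S z)
    {Q : Finset ι} (hQ : Q.Nonempty) (hSQ : Disjoint S Q) (W : Finset V)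
    (hW : ∀ v ∈ undominated G z, κ v ∈ Q → ∃ w ∈ W, G.Adj w v) : 2 * Q.card ≤ W.card := by
  have hcover := H.two_mul_card_image_le hF.toIsInducedMatchingConfig (X := S ∪ Q)
    (hQ.mono Finset.subset_union_right) (fun j b => Finset.mem_union_left _ (hF.mem j b)) W
    fun v hv hvSQ => hW v hv ((Finset.mem_union.1 hvSQ).resolve_left fun hvS =>
      notMem_undominated.2 (hF.dom v hvS) hv)
  have himage := card_image_contractedClass hF.toIsInducedMatchingConfig (X := S ∪ Q)
    fun j b => Finset.mem_union_left _ (hF.mem j b)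
  rw [Finset.card_union_of_disjoint hSQ] at himage
  have := hF.card_eq
  omega

theorem card_lt_card_compl [Fintype V] [Fintype ι] (H : DeficientPartition G κ n Δ D)
    (hF : IsFullPair G κ D S z) {x y : V} (hx : κ x ∈ S) (hy : κ y ∈ S)
    (hzx : ∀ i ≠ j, ∀ b, ¬ G.Adj (z i b) x) (hzy : ∀ i ≠ j, ∀ b, ¬ G.Adj (z i b) y)
    (hlinked : ¬ Linked (classEnds κ z) {j}ᶜ (κ x) (κ y)) (hxy : ¬ G.Adj x y) {U : Set V}
    (hU : ∀ v ∈ U, (∀ i ≠ j, ∀ b, ¬ G.Adj (z i b) v) ∧ ¬ G.Adj x v ∧ ¬ G.Adj y v) {T : Finset V}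
    (hT : IsTransversalIn G κ U Sᶜ T) : T.card < Sᶜ.card := by
  have hpair : ∀ {P : V → Prop}, P x → P y → ∀ v ∈ ({x, y} : Finset V), P v := by
    simp +contextual
  have hTS : ∀ t ∈ T, κ t ∉ S := fun t ht => Finset.mem_compl.1 (hT.mem_S t ht)
  have hj : ((Finset.univ.erase j : Finset J) : Set J) = {j}ᶜ := by ext; simp
  have hunion := hF.isPartialTransversal_union (A := (Finset.univ.erase j : Finset J))
    (isPartialTransversal_pair hxy fun h => hlinked (hj ▸ component_eq_iff.1 h))
    (hpair hx hy) hT.toIsPartialTransversal hTS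
    (hpair (fun t ht => (hU t (hT.mem_U t ht)).2.1) fun t ht => (hU t (hT.mem_U t ht)).2.2)
  have hlarge := H.card_add_card_add_le hF.toIsInducedMatchingConfig (Finset.univ.erase j) hunion
    fun t ht i hi => by
      have hij := Finset.ne_of_mem_erase hi
      rcases Finset.mem_union.1 ht with ht | ht
      · exact hpair (P := fun t => ∀ b, ¬ G.Adj (z i b) t) (hzx i hij) (hzy i hij) t ht
      · exact (hU t (hT.mem_U t ht)).1 i hij
  rw [Finset.card_union_of_disjoint (Finset.disjoint_left.2
      (hpair (fun h => hTS _ h hx) fun h => hTS _ h hy)),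
    Finset.card_pair fun h => hlinked (Linked.of_eq (by rw [h])),
    Nat.card_eq_fintype_card, ← Finset.card_add_card_compl S] at hlarge
  have hcard := hF.card_eq
  have := Finset.card_erase_add_one (Finset.mem_univ j)
  rw [Finset.card_univ] at this
  omega

/-- Otherwise `z j b` and `w` together extend to a transversal that is too large. -/
theorem adj_of_not_linked [Fintype V] (H : DeficientPartition G κ n Δ D)
    (hF : IsFullPair G κ D S z) {w : V} (hwS : κ w ∈ S) (hw : ∀ i ≠ j, ∀ b, ¬ G.Adj (z i b) w)
    {b : Bool} (hnc : ¬ Linked (classEnds κ z) {j}ᶜ (κ w) (κ (z j b))) : G.Adj (z j b) w := by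
  have := H.finite
  have := Fintype.ofFinite ι
  by_contra hnadj
  let U : Set V := {v | (∀ i ≠ j, ∀ b', ¬ G.Adj (z i b') v) ∧ ¬ G.Adj w v ∧ ¬ G.Adj (z j b) v}
  rcases exists_isTransversalIn_or_exists_dominating G κ U Sᶜ with
    ⟨T, hT, hcard⟩ | ⟨Q, hQS, W, hW, hdom⟩
  · exact (hF.card_lt_card_compl H hwS (hF.mem j b) hw (fun i hi b' => hF.induced i j hi b' b) hnc
      (fun h => hnadj h.symm) (fun v hv => hv) hT).ne hcard
  · have hcover := hF.two_mul_card_le H (Finset.card_pos.1 (by omega))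
      (Finset.disjoint_right.2 fun c hc => Finset.mem_compl.1 (hQS hc)) (insert w W)
      fun v hv hvQ => by
        by_cases hwv : G.Adj w v
        · exact ⟨w, Finset.mem_insert_self _ _, hwv⟩
        · obtain ⟨u, hu, h⟩ := hdom v ⟨fun i _ => hv i, hwv, hv j b⟩ hvQ
          exact ⟨u, Finset.mem_insert_of_mem hu, h⟩
    have := Finset.card_insert_le w W
    omega

end IsFullPair

end FullPair

section Enlargement

variable {V ι J : Type*} {G : SimpleGraph V} {κ : V → ι} {n Δ D : ℕ} {S : Finset ι}
  {z : J → Bool → V} {j : J}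

/-- The matching without the edge `j`. -/
def dropEdge (z : J → Bool → V) (j : J) : {i // i ≠ j} → Bool → V := fun i b => z i b

theorem IsInducedMatchingConfig.dropEdge (hz : IsInducedMatchingConfig G κ z) (j : J) :
    IsInducedMatchingConfig G κ (dropEdge z j) where
  adj i b := hz.adj i b
  induced i i' h b b' := hz.induced i i' (fun h' => h (Subtype.ext h')) b b'
  isForest := IsForest.comp_label (e := classEnds κ z) Subtype.val_injective
    (hz.isForest.mono (Set.subset_univ _))

theorem contractedClass_dropEdge {c d : ι} :
    contractedClass κ (dropEdge z j) c = contractedClass κ (dropEdge z j) d ↔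
      Linked (classEnds κ z) {j}ᶜ c d := by
  have hj : Subtype.val '' (Set.univ : Set {i // i ≠ j}) = {j}ᶜ := by ext; simp
  rw [← hj, ← linked_comp_iff]
  exact component_eq_iff

theorem card_ne_add_one [Fintype J] (j : J) : Fintype.card {i // i ≠ j} + 1 = Fintype.card J := by
  rw [Fintype.card_subtype, Finset.filter_ne', ← Finset.card_univ]
  exact Finset.card_erase_add_one (Finset.mem_univ j)

theorem exists_superset_erase {α : Type*} {P : Finset α → Prop} {X Y : Finset α} (hXY : X ⊆ Y)
    (hX : ¬ P X) (hY : P Y) : ∃ Z, X ⊆ Z ∧ P Z ∧ ∃ c ∈ Z, c ∉ X ∧ ¬ P (Z.erase c) := by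
  induction Y using Finset.strongInduction with
  | H Y ih =>
    by_cases h : ∃ c ∈ Y, c ∉ X ∧ P (Y.erase c)
    · obtain ⟨c, hcY, hcX, hc⟩ := h
      exact ih _ (Finset.erase_ssubset hcY) (Finset.subset_erase.2 ⟨hXY, hcX⟩) hc
    · obtain ⟨c, hcY, hcX⟩ := Finset.exists_of_ssubset (hXY.ssubset_of_ne fun h => hX (h ▸ hY))
      exact ⟨Y, hXY, hY, c, hcY, hcX, fun hc => h ⟨c, hcY, hcX, hc⟩⟩

theorem HasDeficiency.add_two_le_card {J₁ : Type*} {z₁ : J₁ → Bool → V}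
    {Q : Finset (Component (classEnds κ z₁) Set.univ)} (hQ : HasDeficiency G κ D z₁ Q) {x y : V}
    (hx : x ∈ undominated G z₁) (hy : y ∈ undominated G z₁) (hxQ : contractedClass κ z₁ (κ x) ∈ Q)
    (hyQ : contractedClass κ z₁ (κ y) ∈ Q)
    (hne : contractedClass κ z₁ (κ x) ≠ contractedClass κ z₁ (κ y)) (hxy : ¬ G.Adj x y) :
    D + 2 ≤ Q.card := by
  have := hQ {x, y} ⟨isPartialTransversal_pair hxy hne, by simp [hx, hy], by simp [hxQ, hyQ]⟩
  rw [Finset.card_pair fun h => hne (by rw [h])] at this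
  omega

namespace IsFullPair

variable [Fintype J]

theorem card_image_contractedClass_dropEdge (hF : IsFullPair G κ D S z) (j : J) {Y : Finset ι}
    (hSY : S ⊆ Y) :
    (Y.image (contractedClass κ (dropEdge z j))).card + Fintype.card J = Y.card + 1 := by
  have := card_image_contractedClass (hF.toIsInducedMatchingConfig.dropEdge j)
    fun i b => hSY (hF.mem i b)
  have := card_ne_add_one j
  omega

theorem image_contractedClass_dropEdge_erase (hF : IsFullPair G κ D S z) (j : J) (Y : Finset ι)
    {c : ι} (hc : c ∉ S) :
    (Y.erase c).image (contractedClass κ (dropEdge z j)) =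
      (Y.image (contractedClass κ (dropEdge z j))).erase (contractedClass κ (dropEdge z j) c) := by
  have hisolated : ∀ d, contractedClass κ (dropEdge z j) d = contractedClass κ (dropEdge z j) c ↔
      d = c := fun d =>
    ⟨fun h => (hF.eq_of_linked hc (contractedClass_dropEdge.1 h.symm)).symm, fun h => h ▸ rfl⟩
  ext q
  simp only [Finset.mem_image, Finset.mem_erase]
  constructor
  · rintro ⟨d, ⟨hdc, hd⟩, rfl⟩
    exact ⟨fun h => hdc ((hisolated d).1 h), d, hd, rfl⟩
  · rintro ⟨hne, d, hd, rfl⟩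
    exact ⟨d, ⟨fun h => hne ((hisolated d).2 h), hd⟩, rfl⟩

/-- An undominated vertex outside `Q` lies in `S`, hence is dominated by an end of the dropped
edge; one such end suffices for each contracted class. -/
theorem card_image_add_card_le [Fintype V] (H : DeficientPartition G κ n Δ D)
    (hF : IsFullPair G κ D S z) (j : J) {Y : Finset ι} (hSY : S ⊆ Y)
    {Q : Finset (Component (classEnds κ (dropEdge z j)) Set.univ)}
    (hQ : Q ⊆ Y.image (contractedClass κ (dropEdge z j)))
    (hYQ : ∀ c ∈ Y, c ∈ S ∨ contractedClass κ (dropEdge z j) c ∈ Q) (W : Finset V)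
    (hW : ∀ v ∈ undominated G (dropEdge z j), contractedClass κ (dropEdge z j) (κ v) ∈ Q →
      ∃ w ∈ W, G.Adj w v) :
    (Y.image (contractedClass κ (dropEdge z j))).card + Q.card ≤ W.card + 2 * D := by
  set mk := contractedClass κ (dropEdge z j) with hmk
  have hend : ∀ q, ∃ b, mk (κ (z j b)) ≠ q := fun q => by
    by_contra! hcon
    exact hF.isForest.not_linked_compl j false
      (contractedClass_dropEdge.1 ((hcon false).trans (hcon true).symm))
  choose β hβ using hend
  set E : Finset V := (Y.image mk \ Q).image fun q => z j (β q)
  have hcover := H.two_mul_card_image_le (hF.toIsInducedMatchingConfig.dropEdge j)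
    ⟨κ (z j false), hSY (hF.mem j false)⟩ (fun i b => hSY (hF.mem i b)) (E ∪ W) fun v hv hvY => by
      by_cases hvQ : mk (κ v) ∈ Q
      · obtain ⟨w, hw, h⟩ := hW v hv hvQ
        exact ⟨w, Finset.mem_union_right _ hw, h⟩
      · refine ⟨z j (β (mk (κ v))), Finset.mem_union_left _ (Finset.mem_image_of_mem _
          (Finset.mem_sdiff.2 ⟨Finset.mem_image_of_mem _ hvY, hvQ⟩)), ?_⟩
        exact hF.adj_of_not_linked H ((hYQ _ hvY).resolve_right hvQ) (fun i hi => hv ⟨i, hi⟩)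
          fun h => hβ (mk (κ v)) (contractedClass_dropEdge.2 h.symm)
  rw [← hmk] at hcover
  have hunion := Finset.card_union_le E W
  have hE : E.card ≤ (Y.image mk \ Q).card := Finset.card_image_le
  rw [Finset.card_sdiff_of_subset hQ] at hE
  have := Finset.card_le_card hQ
  omega

/-- Because of `x` and `y` the contracted classes of `S` have no deficiency after deletion of `j`,
and a minimal larger set of classes that has one supports a full pair. -/
theorem exists_card_lt [Fintype V] (H : DeficientPartition G κ n Δ D)
    (hF : IsFullPair G κ D S z) {x y : V} (hx : κ x ∈ S) (hy : κ y ∈ S)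
    (hzx : ∀ i ≠ j, ∀ b, ¬ G.Adj (z i b) x) (hzy : ∀ i ≠ j, ∀ b, ¬ G.Adj (z i b) y)
    (hlinked : ¬ Linked (classEnds κ z) {j}ᶜ (κ x) (κ y)) (hxy : ¬ G.Adj x y) :
    ∃ (S' : Finset ι) (m : ℕ) (z' : {i // i ≠ j} ⊕ Fin m → Bool → V),
      IsFullPair G κ D S' z' ∧ S.card < S'.card ∧ ∀ i, z' (Sum.inl i) = z i := by
  have := H.finite
  have := Fintype.ofFinite ι
  have h₁ := hF.toIsInducedMatchingConfig.dropEdge j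
  set mk := contractedClass κ (dropEdge z j) with hmk
  have hcard := hF.card_eq
  have hS : ¬ HasDeficiency G κ D (dropEdge z j) (S.image mk) := fun hS => by
    have := hS.add_two_le_card (fun i => hzx i i.2) (fun i => hzy i i.2)
      (Finset.mem_image_of_mem mk hx) (Finset.mem_image_of_mem mk hy)
      (fun h => hlinked (contractedClass_dropEdge.1 h)) hxy
    have hcard' := hF.card_image_contractedClass_dropEdge j subset_rfl
    rw [← hmk] at hcard'
    omega
  obtain ⟨X, hSX, hX, c, hcX, hcS, hXc⟩ := exists_superset_erase
    (P := fun X => HasDeficiency G κ D (dropEdge z j) (X.image mk)) (Finset.subset_univ S) hS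
    (H.hasDeficiency_univ h₁)
  rw [hF.image_contractedClass_dropEdge_erase j X hcS] at hXc
  obtain ⟨Q, hQX, hcQ, hQ⟩ := hX.exists_extension h₁ (Finset.mem_image_of_mem mk hcX) hXc
  set Y : Finset ι := X.filter fun d => d ∈ S ∨ mk d ∈ Q
  have hSY : S ⊆ Y := fun d hd => Finset.mem_filter.2 ⟨hSX hd, Or.inl hd⟩
  have hQY : Q ⊆ Y.image mk := fun q hq => by
    obtain ⟨d, hd, rfl⟩ := Finset.mem_image.1 (hQX hq)
    exact Finset.mem_image_of_mem _ (Finset.mem_filter.2 ⟨hd, Or.inr hq⟩)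
  have hcover := hF.card_image_add_card_le H j hSY hQY fun d hd => (Finset.mem_filter.1 hd).2
  rw [← hmk] at hcover
  obtain ⟨W, hW, hdom⟩ | ⟨m, z₂, hz₂, hmem, hm, hdom⟩ := hQ
  · have := hcover W hdom
    have := Finset.card_le_card hQY
    omega
  · have hends := card_ends_le z₂ Finset.univ
    rw [Finset.card_univ, Fintype.card_fin] at hends
    have hle := hcover (ends z₂ Finset.univ) fun v hv hvQ => by
      obtain ⟨i, b, h⟩ := hdom v hv hvQ
      exact ⟨_, mem_ends.2 ⟨i, Finset.mem_univ _, b, rfl⟩, h⟩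
    have hQ' : Q = Y.image mk := Finset.eq_of_subset_of_card_le hQY (by omega)
    rw [hQ'] at hmem hm hdom
    refine ⟨Y, m, Sum.elim (dropEdge z j) z₂, h₁.isFullPair_sum hz₂ (fun i b => hSY (hF.mem i b))
      hmem (by rw [Fintype.card_fin]; exact hm) hdom, ?_, fun i => rfl⟩
    exact Finset.card_lt_card ((Finset.ssubset_iff_of_subset hSY).2
      ⟨c, Finset.mem_filter.2 ⟨hcX, Or.inr hcQ⟩, hcS⟩)

end IsFullPair

end Enlargement

section MaxFullPair

variable {V ι : Type*} {G : SimpleGraph V} {κ : V → ι} {n Δ D : ℕ} {f : Bool → V} {T : Finset V}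

theorem isInducedMatchingConfig_const (hf : G.Adj (f false) (f true))
    (hκ : κ (f false) ≠ κ (f true)) : IsInducedMatchingConfig G κ fun _ : Unit => f where
  adj _ := Bool.rec hf hf.symm
  induced _ _ h := (h rfl).elim
  isForest _ _ h := hκ <| Eq.symm <|
    (h.mem_iff (S := {κ (f false)}) fun _ hi => (hi.2 rfl).elim).1 rfl

theorem eq_of_contractedClass_const_eq {c d : ι} (hc : ∀ b, c ≠ κ (f b))
    (h : contractedClass κ (fun _ : Unit => f) c = contractedClass κ (fun _ => f) d) : c = d :=
  Eq.symm <| ((component_eq_iff.1 h).mem_iff (S := {c}) fun _ _ =>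
    iff_of_false (hc false).symm (hc true).symm).1 rfl

theorem not_adj_of_notMem_ends
    (hT : IsPartialTransversal (G.deleteEdges {s(f false, f true)}) κ T) {u v : V} (hu : u ∈ T)
    (hv : v ∈ T) (hvf : ∀ b, v ≠ f b) : ¬ G.Adj u v := fun h =>
  hT.indep hu hv h.ne <| SimpleGraph.deleteEdges_adj.2 ⟨h, fun heq => by
    obtain ⟨-, hv⟩ | ⟨-, hv⟩ := Sym2.eq_iff.1 heq
    exacts [hvf _ hv, hvf _ hv]⟩

namespace DeficientPartition

variable [Fintype V]

theorem exists_isFullPair_of_hasDeficiency {J₁ : Type} [Finite J₁]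
    (H : DeficientPartition G κ n Δ D) {z₁ : J₁ → Bool → V}
    (h₁ : IsInducedMatchingConfig G κ z₁) {Q : Finset (Component (classEnds κ z₁) Set.univ)}
    {c : Component (classEnds κ z₁) Set.univ} (hc : c ∈ Q) (hQ : HasDeficiency G κ D z₁ Q)
    (hQc : ¬ HasDeficiency G κ D z₁ (Q.erase c))
    (hz₁ : ∀ j b, contractedClass κ z₁ (κ (z₁ j b)) = c) :
    ∃ (S : Finset ι) (J : Type) (_ : Fintype J) (z : J → Bool → V), IsFullPair G κ D S z ∧
      ∀ i, ∃ i', z i' = z₁ i := by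
  have := H.finite
  have := Fintype.ofFinite ι
  have := Fintype.ofFinite J₁
  obtain ⟨Q', -, hcQ', hext⟩ := hQ.exists_extension h₁ hc hQc
  set X : Finset ι := {d | contractedClass κ z₁ d ∈ Q'}
  have hmemX : ∀ {d}, d ∈ X ↔ contractedClass κ z₁ d ∈ Q' := Finset.mem_filter_univ _
  have himage : X.image (contractedClass κ z₁) = Q' := by
    ext q
    obtain ⟨d, rfl⟩ := component_surjective q
    refine ⟨fun h => ?_, fun h => Finset.mem_image_of_mem _ (hmemX.2 h)⟩
    obtain ⟨d', hd', h⟩ := Finset.mem_image.1 h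
    exact h ▸ hmemX.1 hd'
  have hends : ∀ j b, κ (z₁ j b) ∈ X := fun j b => hmemX.2 (hz₁ j b ▸ hcQ')
  obtain ⟨W, hW, hdom⟩ | ⟨m, z₂, hz₂, hmem, hm, hdom⟩ := hext
  · have hX : X.Nonempty := Finset.Nonempty.of_image (by rw [himage]; exact ⟨c, hcQ'⟩)
    have := H.two_mul_card_image_le h₁ hX hends W fun v hv hvX => hdom v hv (hmemX.1 hvX)
    rw [himage] at this
    omega
  · rw [← himage] at hmem hm hdom
    exact ⟨X, J₁ ⊕ Fin m, inferInstance, Sum.elim z₁ z₂,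
      h₁.isFullPair_sum hz₂ hends hmem (by rw [Fintype.card_fin]; exact hm) hdom,
      fun i => ⟨Sum.inl i, rfl⟩⟩

theorem exists_isFullPair (H : DeficientPartition G κ n Δ D) :
    ∃ (S : Finset ι) (J : Type) (_ : Fintype J) (z : J → Bool → V), IsFullPair G κ D S z := by
  have := H.finite
  have := Fintype.ofFinite ι
  have h₁ : IsInducedMatchingConfig G κ (Empty.elim : Empty → Bool → V) :=
    ⟨Empty.rec, Empty.rec, Empty.rec⟩
  have hempty : ¬ HasDeficiency G κ D (Empty.elim : Empty → Bool → V) ∅ := fun h => by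
    have := h ∅ ⟨⟨by simp, by simp⟩, by simp, by simp⟩
    have := H.one_le
    simp_all
  obtain ⟨Q, -, hQ, c, hc, -, hQc⟩ :=
    exists_superset_erase (Finset.empty_subset _) hempty (H.hasDeficiency_univ h₁)
  obtain ⟨S, J, hJ, z, hF, -⟩ := H.exists_isFullPair_of_hasDeficiency h₁ hc hQ hQc Empty.rec
  exact ⟨S, J, hJ, z, hF⟩

theorem mem_of_card_lt (H : DeficientPartition G κ n Δ D)
    (hT : IsPartialTransversal (G.deleteEdges {s(f false, f true)}) κ T)
    (hcard : Nat.card ι < T.card + D) (b : Bool) : f b ∈ T := by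
  by_contra hb
  have hindep : G.IsIndepSet (T : Set V) := fun u hu v hv hne h =>
    hT.indep hu hv hne <| SimpleGraph.deleteEdges_adj.2 ⟨h, fun heq => hb <| by
      obtain ⟨rfl, rfl⟩ | ⟨rfl, rfl⟩ := Sym2.eq_iff.1 heq
      all_goals cases b; assumption; assumption⟩
  have := H.missing T ⟨hindep, hT.injOn⟩
  omega

/-- Without its ends on the edge `f`, the transversal `T` still covers too many of the other
classes. -/
theorem not_hasDeficiency_erase [Fintype ι] (H : DeficientPartition G κ n Δ D)
    (hf : G.Adj (f false) (f true))
    (hT : IsPartialTransversal (G.deleteEdges {s(f false, f true)}) κ T)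
    (hcard : Nat.card ι < T.card + D) :
    ¬ HasDeficiency G κ D (fun _ : Unit => f)
      ((Finset.univ.image (contractedClass κ fun _ : Unit => f)).erase
        (contractedClass κ (fun _ => f) (κ (f false)))) := fun hQ => by
  have hfT := H.mem_of_card_lt hT hcard
  have h₁ := isInducedMatchingConfig_const hf fun h => hf.ne (hT.injOn (hfT _) (hfT _) h)
  set T' : Finset V := {v ∈ T | ∀ b, v ≠ f b} with hT'
  have hmem : ∀ {v}, v ∈ T' ↔ v ∈ T ∧ ∀ b, v ≠ f b := Finset.mem_filter
  have hκ : ∀ {v}, v ∈ T' → ∀ b, κ v ≠ κ (f b) := fun hv b h =>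
    (hmem.1 hv).2 b (hT.injOn (hmem.1 hv).1 (hfT b) h)
  have hT'card : T.card ≤ T'.card + 2 := by
    have : T ⊆ T' ∪ {f false, f true} := fun v hv => by
      by_cases h : ∀ b, v ≠ f b
      · exact Finset.mem_union_left _ (hmem.2 ⟨hv, h⟩)
      · obtain ⟨_ | _, rfl⟩ := not_forall_not.1 h <;> simp
    exact (Finset.card_le_card this).trans
      ((Finset.card_union_le _ _).trans (Nat.add_le_add_left Finset.card_le_two _))
  have hle := hQ T'
    { indep := fun u hu v hv _ =>
        not_adj_of_notMem_ends hT (hmem.1 hu).1 (hmem.1 hv).1 (hmem.1 hv).2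
      injOn := fun u hu v hv h => hT.injOn (hmem.1 hu).1 (hmem.1 hv).1
        (eq_of_contractedClass_const_eq (hκ hu) h)
      mem_U := fun v hv _ b => not_adj_of_notMem_ends hT (hfT b) (hmem.1 hv).1 (hmem.1 hv).2
      mem_S := fun v hv => Finset.mem_erase.2
        ⟨fun h => hκ hv false (eq_of_contractedClass_const_eq (hκ hv) h),
          Finset.mem_image_of_mem _ (Finset.mem_univ _)⟩ }
  have hcardQ := card_image_contractedClass h₁ (X := Finset.univ) fun _ _ => Finset.mem_univ _
  have herase := Finset.card_erase_add_one (Finset.mem_image_of_mem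
    (contractedClass κ fun _ : Unit => f) (Finset.mem_univ (κ (f false))))
  rw [Finset.card_univ, Fintype.card_unit] at hcardQ
  rw [Nat.card_eq_fintype_card] at hcard
  omega

theorem exists_isFullPair_edge (H : DeficientPartition G κ n Δ D) (hf : G.Adj (f false) (f true))
    (hT : IsPartialTransversal (G.deleteEdges {s(f false, f true)}) κ T)
    (hcard : Nat.card ι < T.card + D) :
    ∃ (S : Finset ι) (J : Type) (_ : Fintype J) (z : J → Bool → V), IsFullPair G κ D S z ∧
      ∃ i, z i = f := by
  have := H.finite
  have := Fintype.ofFinite ι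
  have hfT := H.mem_of_card_lt hT hcard
  have h₁ := isInducedMatchingConfig_const hf fun h => hf.ne (hT.injOn (hfT _) (hfT _) h)
  obtain ⟨S, J, hJ, z, hF, hz⟩ := H.exists_isFullPair_of_hasDeficiency h₁
    (Finset.mem_image_of_mem _ (Finset.mem_univ _)) (H.hasDeficiency_univ h₁)
    (H.not_hasDeficiency_erase hf hT hcard)
    fun _ b => component_eq_iff.2 (Linked.edge (Set.mem_univ ()) b false)
  exact ⟨S, J, hJ, z, hF, hz ()⟩

end DeficientPartition

/-- A full pair of maximum size among those containing the edges in `F`; the edges with labels in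
`A` are free to be changed. -/
structure IsMaxFullPair {J : Type} [Fintype J] (G : SimpleGraph V) (κ : V → ι) (D : ℕ)
    (F : Set (Bool → V)) (A : Set J) (S : Finset ι) (z : J → Bool → V) : Prop where
  full : IsFullPair G κ D S z
  fix : ∀ f ∈ F, ∃ i, i ∉ A ∧ z i = f
  max : ∀ (S' : Finset ι) (J' : Type) (_ : Fintype J') (z' : J' → Bool → V),
    IsFullPair G κ D S' z' → (∀ f ∈ F, ∃ i, z' i = f) → S'.card ≤ S.card

theorem exists_max_isFullPair [Finite ι] (F : Set (Bool → V))
    (h : ∃ (S : Finset ι) (J : Type) (_ : Fintype J) (z : J → Bool → V), IsFullPair G κ D S z ∧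
      ∀ f ∈ F, ∃ i, z i = f) :
    ∃ (S : Finset ι) (J : Type) (_ : Fintype J) (z : J → Bool → V), IsFullPair G κ D S z ∧
      (∀ f ∈ F, ∃ i, z i = f) ∧ ∀ (S' : Finset ι) (J' : Type) (_ : Fintype J')
        (z' : J' → Bool → V), IsFullPair G κ D S' z' → (∀ f ∈ F, ∃ i, z' i = f) →
          S'.card ≤ S.card := by
  have := Fintype.ofFinite ι
  obtain ⟨S, ⟨J, hJ, z, hF, hz⟩, hmax⟩ := Set.exists_max_image
    {S : Finset ι | ∃ (J : Type) (_ : Fintype J) (z : J → Bool → V), IsFullPair G κ D S z ∧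
      ∀ f ∈ F, ∃ i, z i = f} Finset.card (Set.toFinite _) h
  exact ⟨S, J, hJ, z, hF, hz, fun S' J' hJ' z' hF' hz' => hmax S' ⟨J', hJ', z', hF', hz'⟩⟩

theorem DeficientPartition.exists_isMaxFullPair [Fintype V] (H : DeficientPartition G κ n Δ D) :
    ∃ (S : Finset ι) (J : Type) (_ : Fintype J) (z : J → Bool → V),
      IsMaxFullPair G κ D ∅ Set.univ S z := by
  have := H.finite
  obtain ⟨S, J, hJ, z, hF⟩ := H.exists_isFullPair
  obtain ⟨S, J, hJ, z, hF, -, hmax⟩ := exists_max_isFullPair ∅ ⟨S, J, hJ, z, hF, by simp⟩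
  exact ⟨S, J, hJ, z, hF, by simp, hmax⟩

theorem DeficientPartition.exists_isMaxFullPair_edge [Fintype V]
    (H : DeficientPartition G κ n Δ D) (hf : G.Adj (f false) (f true))
    (hT : IsPartialTransversal (G.deleteEdges {s(f false, f true)}) κ T)
    (hcard : Nat.card ι < T.card + D) :
    ∃ (S : Finset ι) (J : Type) (_ : Fintype J) (z : J → Bool → V) (j : J), z j = f ∧
      IsMaxFullPair G κ D {f} {j}ᶜ S z := by
  have := H.finite
  obtain ⟨S, J, hJ, z, hF, hz⟩ := H.exists_isFullPair_edge hf hT hcard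
  obtain ⟨S, J, hJ, z, hF, hz, hmax⟩ :=
    exists_max_isFullPair {f} ⟨S, J, hJ, z, hF, by simpa using hz⟩
  obtain ⟨j, hj⟩ := hz f rfl
  refine ⟨S, J, hJ, z, j, hj, hF, ?_, hmax⟩
  rintro _ rfl
  exact ⟨j, by simp, hj⟩

end MaxFullPair

section Replacement

variable {V ι : Type*} {J : Type} {G : SimpleGraph V} {κ : V → ι} {n Δ D : ℕ} {S : Finset ι}
  {z z' : J → Bool → V} {F : Set (Bool → V)} {A : Set J} {j j' : J} {b b' : Bool} {v w x y : V}
  {c d : ι}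

theorem isInducedMatchingConfig_replaceEnd (hz : IsInducedMatchingConfig G κ z)
    (hadj : G.Adj w (z j !b)) (hw : ∀ i ≠ j, ∀ b', ¬ G.Adj (z i b') w)
    (hlinked : ¬ Linked (classEnds κ z) {j}ᶜ (κ w) (κ (z j !b))) :
    IsInducedMatchingConfig G κ (replaceEnd z j b w) where
  adj i b' := by
    obtain rfl | hij := eq_or_ne i j
    · obtain rfl | rfl := Bool.eq_or_eq_not b' b
      · simpa using hadj
      · simpa using hadj.symm
    · rw [replaceEnd_of_ne hij]
      exact hz.adj i b'
  induced := by
    have hself : ∀ i ≠ j, ∀ b' b'', ¬ G.Adj (z i b') (replaceEnd z j b w j b'') := by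
      intro i hi b' b''
      obtain rfl | rfl := Bool.eq_or_eq_not b'' b
      · rw [replaceEnd_self]
        exact hw i hi b'
      · rw [replaceEnd_not]
        exact hz.induced i j hi _ _
    intro i i' hii' b' b''
    obtain rfl | hi := eq_or_ne i j
    · rw [replaceEnd_of_ne hii'.symm]
      exact fun h => hself i' hii'.symm b'' b' h.symm
    · rw [replaceEnd_of_ne hi]
      obtain rfl | hi' := eq_or_ne i' j
      · exact hself i hi b' b''
      · rw [replaceEnd_of_ne hi']
        exact hz.induced i i' hii' b' b''
  isForest := by
    rw [classEnds_replaceEnd]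
    exact isForest_replaceEnd (hz.isForest.mono (Set.subset_univ _)) hlinked

variable [Fintype V]

/-- The vertices of the classes in `S` which no edge of `z` except possibly `j` dominates. -/
noncomputable def looseVerts (G : SimpleGraph V) (κ : V → ι) (S : Finset ι) (z : J → Bool → V)
    (j : J) : Finset V :=
  Finset.univ.filter fun w => κ w ∈ S ∧ ∀ i ≠ j, ∀ b, ¬ G.Adj (z i b) w

theorem mem_looseVerts :
    w ∈ looseVerts G κ S z j ↔ κ w ∈ S ∧ ∀ i ≠ j, ∀ b, ¬ G.Adj (z i b) w := by
  simp [looseVerts]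

theorem exists_adj_of_notMem_looseVerts (hv : κ v ∈ S) (h : v ∉ looseVerts G κ S z j) :
    ∃ i ≠ j, ∃ b, G.Adj (z i b) v := by
  by_contra! hcon
  exact h (mem_looseVerts.2 ⟨hv, hcon⟩)

/-- The vertices by which the end `b` of the edge `j` may be replaced. -/
noncomputable def replacements (G : SimpleGraph V) (κ : V → ι) (S : Finset ι) (z : J → Bool → V)
    (j : J) (b : Bool) : Finset V :=
  (looseVerts G κ S z j).filter fun w => Linked (classEnds κ z) {j}ᶜ (κ w) (κ (z j b))

theorem mem_replacements :
    w ∈ replacements G κ S z j b ↔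
      w ∈ looseVerts G κ S z j ∧ Linked (classEnds κ z) {j}ᶜ (κ w) (κ (z j b)) :=
  Finset.mem_filter

theorem linked_replaceEnd_of_mem_replacements (hw : w ∈ replacements G κ S z j b) :
    Linked (classEnds κ (replaceEnd z j b w)) Set.univ c d ↔
      Linked (classEnds κ z) Set.univ c d := by
  rw [classEnds_replaceEnd]
  exact linked_replaceEnd_univ_iff (mem_replacements.1 hw).2

namespace IsFullPair

variable [Fintype J]

theorem end_mem_looseVerts (hF : IsFullPair G κ D S z) (j : J) (b : Bool) :
    z j b ∈ looseVerts G κ S z j :=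
  mem_looseVerts.2 ⟨hF.mem j b, fun i hi b' => hF.induced i j hi b' b⟩

theorem end_mem_replacements (hF : IsFullPair G κ D S z) (j : J) (b : Bool) :
    z j b ∈ replacements G κ S z j b :=
  mem_replacements.2 ⟨hF.end_mem_looseVerts j b, Linked.refl _⟩

theorem not_linked_of_mem_replacements (hF : IsFullPair G κ D S z)
    (hx : x ∈ replacements G κ S z j b) (hy : y ∈ replacements G κ S z j !b) :
    ¬ Linked (classEnds κ z) {j}ᶜ (κ x) (κ y) := fun h =>
  hF.isForest.not_linked_compl j b <|
    (mem_replacements.1 hx).2.symm.trans (h.trans (mem_replacements.1 hy).2)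

theorem eq_of_mem_replacements (hF : IsFullPair G κ D S z)
    (h : w ∈ replacements G κ S z j b) (h' : w ∈ replacements G κ S z j' b') :
    j = j' ∧ b = b' := by
  have hloose := mem_looseVerts.1 (mem_replacements.1 h).1
  have hloose' := mem_looseVerts.1 (mem_replacements.1 h').1
  obtain rfl : j = j' := by
    obtain ⟨i, b'', hi⟩ := hF.dom w hloose.1
    have hij : i = j := by_contra fun hij => hloose.2 i hij b'' hi
    have hij' : i = j' := by_contra fun hij' => hloose'.2 i hij' b'' hi
    rw [← hij, hij']
  obtain rfl | rfl := Bool.eq_or_eq_not b' b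
  · exact ⟨rfl, rfl⟩
  · exact (hF.not_linked_of_mem_replacements h h' (Linked.refl _)).elim

theorem three_mul_card_inter_lt (H : DeficientPartition G κ n Δ D) (hF : IsFullPair G κ D S z)
    (hne : ¬(j = j' ∧ b = b')) :
    3 * (G.neighborFinset (z j b) ∩ G.neighborFinset (z j' b')).card < Δ := by
  set W : Finset V := ((Finset.univ : Finset (J × Bool)).erase (j', b')).image fun s => z s.1 s.2
  have hW : W.card + 1 ≤ 2 * Fintype.card J := by
    have h₁ : W.card ≤ _ := Finset.card_image_le
    have h₂ := Finset.card_erase_add_one (Finset.mem_univ (j', b'))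
    rw [Finset.card_univ, Fintype.card_prod, Fintype.card_bool] at h₂
    omega
  have hmem : ∀ i b'', ¬(i = j' ∧ b'' = b') → z i b'' ∈ W := fun i b'' h =>
    Finset.mem_image.2
      ⟨(i, b''), Finset.mem_erase.2 ⟨fun h' => h (by simpa using h'), Finset.mem_univ _⟩, rfl⟩
  have hcover := H.tight_cover ⟨_, hF.mem j b⟩ W
    (G.neighborFinset (z j' b') \ G.neighborFinset (z j b)) fun v hv => by
      obtain ⟨i, b'', h⟩ := hF.dom v hv
      by_cases hi : i = j' ∧ b'' = b'
      · by_cases hv' : G.Adj (z j b) v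
        · exact Or.inr ⟨_, hmem j b hne, hv'⟩
        · obtain ⟨rfl, rfl⟩ := hi
          simp [h, hv']
      · exact Or.inr ⟨_, hmem i b'' hi, h⟩
  have hsdiff := Finset.card_sdiff_add_card_inter (G.neighborFinset (z j' b'))
    (G.neighborFinset (z j b))
  rw [Finset.inter_comm] at hsdiff
  have hdeg := H.degree_le (z j' b')
  rw [← SimpleGraph.card_neighborFinset_eq_degree] at hdeg
  have hle : 3 * Δ * (W.card + 1) ≤ 3 * Δ * (2 * Fintype.card J) := Nat.mul_le_mul_left _ hW
  rw [← hF.card_eq] at hcover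
  linarith

theorem lt_card_looseVerts (H : DeficientPartition G κ n Δ D) (hF : IsFullPair G κ D S z) (j : J) :
    5 * Δ < 3 * (looseVerts G κ S z j).card := by
  have hcover := H.tight_cover ⟨_, hF.mem j false⟩ (ends z (Finset.univ.erase j))
    (looseVerts G κ S z j) fun v hv => by
      refine or_iff_not_imp_left.2 fun h => ?_
      obtain ⟨i, hi, b, hadj⟩ := exists_adj_of_notMem_looseVerts hv h
      exact ⟨_, mem_ends.2 ⟨i, Finset.mem_erase.2 ⟨hi, Finset.mem_univ _⟩, b, rfl⟩, hadj⟩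
  have hends := card_ends_le z (Finset.univ.erase j)
  have herase := Finset.card_erase_add_one (Finset.mem_univ j)
  rw [Finset.card_univ] at herase
  have hle : 3 * Δ * ((ends z (Finset.univ.erase j)).card + 2) ≤ 3 * Δ * (2 * Fintype.card J) :=
    Nat.mul_le_mul_left _ (by omega)
  rw [← hF.card_eq] at hcover
  linarith

end IsFullPair

/-- One replacement of an end of a free edge. -/
def Replacement (G : SimpleGraph V) (κ : V → ι) (S : Finset ι) (A : Set J)
    (z z' : J → Bool → V) : Prop :=
  ∃ j ∈ A, ∃ b, ∃ w ∈ replacements G κ S z j b, z' = replaceEnd z j b w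

/-- Reachability of one matching from another by replacements of ends of free edges. -/
def Reachable (G : SimpleGraph V) (κ : V → ι) (S : Finset ι) (A : Set J) :
    (J → Bool → V) → (J → Bool → V) → Prop :=
  Relation.ReflTransGen (Replacement G κ S A)

theorem Reachable.refl : Reachable G κ S A z z := Relation.ReflTransGen.refl

theorem Reachable.trans {z'' : J → Bool → V} (h : Reachable G κ S A z z')
    (h' : Reachable G κ S A z' z'') : Reachable G κ S A z z'' :=
  Relation.ReflTransGen.trans h h'

theorem Reachable.tail_replaceEnd (h : Reachable G κ S A z z') (hj : j ∈ A)
    (hw : w ∈ replacements G κ S z' j b) :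
    Reachable G κ S A z (replaceEnd z' j b w) :=
  Relation.ReflTransGen.tail h ⟨j, hj, b, w, hw, rfl⟩

theorem Reachable.linked_iff (h : Reachable G κ S A z z') :
    Linked (classEnds κ z') Set.univ c d ↔ Linked (classEnds κ z) Set.univ c d := by
  induction h with
  | refl => rfl
  | tail _ hstep ih =>
    obtain ⟨j, -, b, w, hw, rfl⟩ := hstep
    rw [linked_replaceEnd_of_mem_replacements hw, ih]

theorem Reachable.linked_end (h : Reachable G κ S A z z') (j : J) (b : Bool) :
    Linked (classEnds κ z) Set.univ (κ (z' j b)) (κ (z j b)) := by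
  induction h with
  | refl => exact Linked.refl _
  | @tail y _ hy hstep ih =>
    obtain ⟨i, -, b', w, hw, rfl⟩ := hstep
    by_cases hij : j = i ∧ b = b'
    · obtain ⟨rfl, rfl⟩ := hij
      rw [replaceEnd_self]
      exact ((linked_iff hy).1 ((mem_replacements.1 hw).2.mono (Set.subset_univ _))).trans ih
    · rwa [replaceEnd_apply_of_ne hij]

namespace IsMaxFullPair

variable [Fintype J]

theorem adj_of_not_linked (H : DeficientPartition G κ n Δ D) (hZ : IsMaxFullPair G κ D F A S z)
    (hj : j ∈ A) (hx : x ∈ looseVerts G κ S z j) (hy : y ∈ looseVerts G κ S z j)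
    (hlinked : ¬ Linked (classEnds κ z) {j}ᶜ (κ x) (κ y)) : G.Adj x y := by
  rw [mem_looseVerts] at hx hy
  by_contra hxy
  obtain ⟨S', m, z', hF', hlt, hz'⟩ :=
    hZ.full.exists_card_lt H hx.1 hy.1 hx.2 hy.2 hlinked hxy
  refine (hZ.max S' _ _ z' hF' fun f hf => ?_).not_gt hlt
  obtain ⟨i, hi, rfl⟩ := hZ.fix f hf
  exact ⟨_, hz' ⟨i, fun hij => hi (hij ▸ hj)⟩⟩

theorem adj_of_mem_replacements (H : DeficientPartition G κ n Δ D)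
    (hZ : IsMaxFullPair G κ D F A S z) (hj : j ∈ A) (hx : x ∈ replacements G κ S z j b)
    (hy : y ∈ replacements G κ S z j !b) : G.Adj x y :=
  hZ.adj_of_not_linked H hj (mem_replacements.1 hx).1 (mem_replacements.1 hy).1
    (hZ.full.not_linked_of_mem_replacements hx hy)

theorem replacements_subset_neighborFinset (H : DeficientPartition G κ n Δ D)
    (hZ : IsMaxFullPair G κ D F A S z) (hj : j ∈ A) (hx : x ∈ replacements G κ S z j !b) :
    replacements G κ S z j b ⊆ G.neighborFinset x := fun _ hw =>
  (G.mem_neighborFinset _ _).2 (hZ.adj_of_mem_replacements H hj hw hx).symm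

theorem card_replacements_le (H : DeficientPartition G κ n Δ D)
    (hZ : IsMaxFullPair G κ D F A S z) (hj : j ∈ A) (b : Bool) :
    (replacements G κ S z j b).card ≤ Δ :=
  (Finset.card_le_card <| hZ.replacements_subset_neighborFinset H hj <|
    hZ.full.end_mem_replacements j !b).trans (H.degree_le _)

/-- If a loose vertex were linked to neither end of `j`, the loose vertices would split into three
sets, each missing at most `Δ` of them, although there are more than `5Δ / 3` loose vertices. -/
theorem exists_mem_replacements (H : DeficientPartition G κ n Δ D)
    (hZ : IsMaxFullPair G κ D F A S z) (hj : j ∈ A) (hw : w ∈ looseVerts G κ S z j) :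
    ∃ b, w ∈ replacements G κ S z j b := by
  by_contra! hcon
  have hnot : ∀ b, ¬ Linked (classEnds κ z) {j}ᶜ (κ w) (κ (z j b)) := fun b h =>
    hcon b (mem_replacements.2 ⟨hw, h⟩)
  set L := looseVerts G κ S z j with hL
  let B : V → Finset V := fun x => L.filter fun u => Linked (classEnds κ z) {j}ᶜ (κ u) (κ x)
  have hB : ∀ x ∈ L, L.card ≤ (B x).card + Δ := fun x hx => by
    rw [← Finset.card_filter_add_card_filter_not (s := L)
      (p := fun u => Linked (classEnds κ z) {j}ᶜ (κ u) (κ x))]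
    refine Nat.add_le_add_left ((Finset.card_le_card fun u hu => ?_).trans (H.degree_le x)) _
    obtain ⟨hu, hux⟩ := Finset.mem_filter.1 hu
    exact (G.mem_neighborFinset _ _).2 (hZ.adj_of_not_linked H hj hu hx hux).symm
  have hdisj : ∀ x y, ¬ Linked (classEnds κ z) {j}ᶜ (κ x) (κ y) → Disjoint (B x) (B y) :=
    fun x y hxy => Finset.disjoint_left.2 fun u hu hu' =>
      hxy ((Finset.mem_filter.1 hu).2.symm.trans (Finset.mem_filter.1 hu').2)
  have hends : Disjoint (B (z j false)) (B (z j true)) :=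
    hdisj _ _ (hZ.full.isForest.not_linked_compl j false)
  have hunion : (B w ∪ (B (z j false) ∪ B (z j true))).card ≤ L.card :=
    Finset.card_le_card (Finset.union_subset (Finset.filter_subset _ _)
      (Finset.union_subset (Finset.filter_subset _ _) (Finset.filter_subset _ _)))
  rw [Finset.card_union_of_disjoint
      (Finset.disjoint_union_right.2 ⟨hdisj _ _ (hnot false), hdisj _ _ (hnot true)⟩),
    Finset.card_union_of_disjoint hends] at hunion
  have hBw := hB w hw
  have hBfalse := hB _ (hZ.full.end_mem_looseVerts j false)
  have hBtrue := hB _ (hZ.full.end_mem_looseVerts j true)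
  have hcard := hZ.full.lt_card_looseVerts H j
  rw [← hL] at hcard
  omega

theorem lt_card_replacements_add (H : DeficientPartition G κ n Δ D)
    (hZ : IsMaxFullPair G κ D F A S z) (hj : j ∈ A) (b : Bool) :
    5 * Δ < 3 * ((replacements G κ S z j b).card + (replacements G κ S z j !b).card) := by
  refine (hZ.full.lt_card_looseVerts H j).trans_le (Nat.mul_le_mul_left _ ?_)
  refine (Finset.card_le_card fun w hw => ?_).trans (Finset.card_union_le _ _)
  obtain ⟨b', hb'⟩ := hZ.exists_mem_replacements H hj hw
  obtain rfl | rfl := Bool.eq_or_eq_not b' b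
  · exact Finset.mem_union_left _ hb'
  · exact Finset.mem_union_right _ hb'

theorem lt_card_replacements (H : DeficientPartition G κ n Δ D)
    (hZ : IsMaxFullPair G κ D F A S z) (hj : j ∈ A) (b : Bool) :
    2 * Δ < 3 * (replacements G κ S z j b).card := by
  have hadd := hZ.lt_card_replacements_add H hj b
  have hle := hZ.card_replacements_le H hj !b
  omega

theorem exists_adj_replaceEnd (H : DeficientPartition G κ n Δ D)
    (hZ : IsMaxFullPair G κ D F A S z) (hj : j ∈ A) (hw : w ∈ replacements G κ S z j b)
    (hv : κ v ∈ S) : ∃ i b', G.Adj (replaceEnd z j b w i b') v := by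
  by_cases hvl : v ∈ looseVerts G κ S z j
  · obtain ⟨b', hb'⟩ := hZ.exists_mem_replacements H hj hvl
    refine ⟨j, !b', ?_⟩
    obtain rfl | rfl := Bool.eq_or_eq_not b' b
    · rw [replaceEnd_not]
      exact (hZ.adj_of_mem_replacements H hj hb' (hZ.full.end_mem_replacements j _)).symm
    · rw [Bool.not_not, replaceEnd_self]
      exact hZ.adj_of_mem_replacements H hj hw hb'
  · obtain ⟨i, hi, b', hadj⟩ := exists_adj_of_notMem_looseVerts hv hvl
    exact ⟨i, b', by rwa [replaceEnd_of_ne hi]⟩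

theorem replace (H : DeficientPartition G κ n Δ D) (hZ : IsMaxFullPair G κ D F A S z)
    (hj : j ∈ A) (hw : w ∈ replacements G κ S z j b) :
    IsMaxFullPair G κ D F A S (replaceEnd z j b w) where
  full :=
    { isInducedMatchingConfig_replaceEnd hZ.full.toIsInducedMatchingConfig
        (hZ.adj_of_mem_replacements H hj hw (hZ.full.end_mem_replacements j _))
        (mem_looseVerts.1 (mem_replacements.1 hw).1).2
        (hZ.full.not_linked_of_mem_replacements hw (hZ.full.end_mem_replacements j _)) with
      mem := by
        intro i b'
        by_cases hij : i = j ∧ b' = b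
        · obtain ⟨rfl, rfl⟩ := hij
          rw [replaceEnd_self]
          exact (mem_looseVerts.1 (mem_replacements.1 hw).1).1
        · rw [replaceEnd_apply_of_ne hij]
          exact hZ.full.mem i b'
      card_eq := hZ.full.card_eq
      dom := fun _ => hZ.exists_adj_replaceEnd H hj hw }
  fix f hf := by
    obtain ⟨i, hi, rfl⟩ := hZ.fix f hf
    exact ⟨i, hi, replaceEnd_of_ne (ne_of_mem_of_not_mem hj hi).symm b w⟩
  max := hZ.max

theorem of_reachable (H : DeficientPartition G κ n Δ D) (hZ : IsMaxFullPair G κ D F A S z)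
    (h : Reachable G κ S A z z') : IsMaxFullPair G κ D F A S z' := by
  induction h with
  | refl => exact hZ
  | tail _ hstep ih =>
    obtain ⟨j, hj, b, w, hw, rfl⟩ := hstep
    exact ih.replace H hj hw

end IsMaxFullPair

end Replacement

section Blocks

variable {V ι : Type*} {J : Type} {G : SimpleGraph V} {κ : V → ι} {n Δ D : ℕ} {S : Finset ι}
  {z z₀ : J → Bool → V} {F : Set (Bool → V)} {A : Set J} {j j' : J} {b b' : Bool} {u v w x y : V}

/-- The ends of edges of `z` which are adjacent to `v`. -/
noncomputable def dominators [Fintype J] (G : SimpleGraph V) (z : J → Bool → V) (v : V) :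
    Finset (J × Bool) :=
  Finset.univ.filter fun s => G.Adj (z s.1 s.2) v

theorem mem_dominators [Fintype J] : (j, b) ∈ dominators G z v ↔ G.Adj (z j b) v := by
  simp [dominators]

theorem dominators_replaceEnd_subset [Fintype J] (hw : ¬ G.Adj w v) :
    dominators G (replaceEnd z j b w) v ⊆ (dominators G z v).erase (j, b) := by
  rintro ⟨i, b'⟩ h
  rw [mem_dominators] at h
  have hne : ¬(i = j ∧ b' = b) := by
    rintro ⟨rfl, rfl⟩
    exact hw (replaceEnd_self (z := z) i b' w ▸ h)
  rw [replaceEnd_apply_of_ne hne] at h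
  exact Finset.mem_erase.2 ⟨fun h' => hne (Prod.ext_iff.1 h'), mem_dominators.2 h⟩

theorem card_dominators_replaceEnd_lt [Fintype J] (h : G.Adj (z j b) v) (hw : ¬ G.Adj w v) :
    (dominators G (replaceEnd z j b w) v).card < (dominators G z v).card :=
  (Finset.card_le_card (dominators_replaceEnd_subset hw)).trans_lt
    (Finset.card_erase_lt_of_mem (mem_dominators.2 h))

variable [Fintype V]

/-- `u` and `v` form an edge of a matching reachable from `z₀`. -/
def ReachableEdge (G : SimpleGraph V) (κ : V → ι) (S : Finset ι) (z₀ : J → Bool → V)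
    (u v : V) : Prop :=
  ∃ z, Reachable G κ S Set.univ z₀ z ∧ ∃ j b, z j b = u ∧ z j (!b) = v

/-- The block of the end `b` of the edge `j`: the vertices which this end can become by
replacements. -/
noncomputable def block (G : SimpleGraph V) (κ : V → ι) (S : Finset ι) (z₀ : J → Bool → V) (j : J)
    (b : Bool) : Finset V :=
  Finset.univ.filter fun w => κ w ∈ S ∧ ReachableEdge G κ S z₀ w (z₀ j !b)

theorem mem_block :
    w ∈ block G κ S z₀ j b ↔ κ w ∈ S ∧ ReachableEdge G κ S z₀ w (z₀ j !b) := by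
  simp [block]

namespace IsMaxFullPair

variable [Fintype J]

/-- Among the reachable matchings whose dominators of `v` are original, one with the fewest
dominators of `v` has only one: all replacements of a dominator are adjacent to `v`, and `v` has too
few neighbours for two such sets. -/
theorem exists_mem_replacements_reachable (H : DeficientPartition G κ n Δ D)
    (hZ : IsMaxFullPair G κ D F A S z) (hv : κ v ∈ S) (hvA : ∀ i ∉ A, ∀ b, ¬ G.Adj (z i b) v) :
    ∃ z', Reachable G κ S A z z' ∧
      ∃ j ∈ A, ∃ b, z' j b = z j b ∧ v ∈ replacements G κ S z' j !b := by
  obtain ⟨y, ⟨hzy, hold⟩, hmin⟩ := exists_minimalFor_of_wellFoundedLT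
    (fun y => Reachable G κ S A z y ∧ ∀ j b, G.Adj (y j b) v → y j b = z j b)
    (fun y => (dominators G y v).card) ⟨z, Reachable.refl, fun _ _ _ => rfl⟩
  have hY := hZ.of_reachable H hzy
  have hA : ∀ j b, G.Adj (y j b) v → j ∈ A := fun j b h =>
    by_contra fun hj => hvA j hj b (hold j b h ▸ h)
  have hsub : ∀ j b, G.Adj (y j b) v → replacements G κ S y j b ⊆ G.neighborFinset v := by
    intro j b h w hw
    by_contra hwv
    replace hwv : ¬ G.Adj w v := fun h => hwv ((G.mem_neighborFinset _ _).2 h.symm)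
    have hlt := card_dominators_replaceEnd_lt h hwv
    refine hlt.not_ge (hmin ⟨hzy.tail_replaceEnd (hA j b h) hw, fun i b' hi => ?_⟩ hlt.le)
    obtain ⟨hne, hi'⟩ := Finset.mem_erase.1
      (dominators_replaceEnd_subset hwv (mem_dominators.2 hi))
    rw [replaceEnd_apply_of_ne fun h => hne (Prod.ext_iff.2 h)]
    exact hold i b' (mem_dominators.1 hi')
  obtain ⟨j, b, hjb⟩ := hY.full.dom v hv
  have huniq : ∀ i b', G.Adj (y i b') v → i = j ∧ b' = b := by
    intro i b' h
    have hlt := hY.lt_card_replacements H (hA i b' h) b'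
    have hlt' := hY.lt_card_replacements H (hA j b hjb) b
    have hdeg := H.degree_le v
    rw [← G.card_neighborFinset_eq_degree] at hdeg
    obtain ⟨t, ht⟩ := Finset.inter_nonempty_of_card_lt_card_add_card (hsub i b' h) (hsub j b hjb)
      (by omega)
    exact hY.full.eq_of_mem_replacements (Finset.mem_inter.1 ht).1 (Finset.mem_inter.1 ht).2
  refine ⟨y, hzy, j, hA j b hjb, b, hold j b hjb, ?_⟩
  obtain ⟨b', hb'⟩ := hY.exists_mem_replacements H (hA j b hjb) (w := v)
    (mem_looseVerts.2 ⟨hv, fun i hi b' h => hi (huniq i b' h).1⟩)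
  have hend := (huniq j (!b') (hY.adj_of_mem_replacements H (hA j b hjb) hb'
    (hY.full.end_mem_replacements j _)).symm).2
  rwa [← hend, Bool.not_not]

theorem adj_of_reachableEdge (H : DeficientPartition G κ n Δ D)
    (hZ : IsMaxFullPair G κ D ∅ Set.univ S z₀) (h : ReachableEdge G κ S z₀ u v) : G.Adj u v := by
  obtain ⟨z, hz, j, b, rfl, rfl⟩ := h
  exact (hZ.of_reachable H hz).full.adj j b

theorem exists_reachableEdge (H : DeficientPartition G κ n Δ D)
    (hZ : IsMaxFullPair G κ D ∅ Set.univ S z₀) (hz : Reachable G κ S Set.univ z₀ z)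
    (hv : κ v ∈ S) : ∃ j b, ReachableEdge G κ S z₀ v (z j b) := by
  obtain ⟨z', hz', j, -, b, heq, hmem⟩ :=
    (hZ.of_reachable H hz).exists_mem_replacements_reachable H hv (by simp)
  refine ⟨j, b, _, (hz.trans hz').tail_replaceEnd trivial hmem, j, !b, replaceEnd_self _ _ _, ?_⟩
  rw [replaceEnd_not, Bool.not_not, heq]

theorem exists_biclique_of_reachableEdge (H : DeficientPartition G κ n Δ D)
    (hZ : IsMaxFullPair G κ D ∅ Set.univ S z₀) (h : ReachableEdge G κ S z₀ u v) :
    ∃ X Y : Finset V, 2 * Δ < 3 * X.card ∧ 2 * Δ < 3 * Y.card ∧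
      X ⊆ G.neighborFinset v ∧ Y ⊆ G.neighborFinset u ∧
      ∀ y ∈ Y, X ⊆ G.neighborFinset y := by
  obtain ⟨z, hz, j, b, rfl, rfl⟩ := h
  have hmax := hZ.of_reachable H hz
  refine ⟨replacements G κ S z j b, replacements G κ S z j !b,
    hmax.lt_card_replacements H trivial _, hmax.lt_card_replacements H trivial _,
    hmax.replacements_subset_neighborFinset H trivial (hmax.full.end_mem_replacements j _),
    hmax.replacements_subset_neighborFinset H trivial ?_,
    fun y hy => hmax.replacements_subset_neighborFinset H trivial hy⟩
  rw [Bool.not_not]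
  exact hmax.full.end_mem_replacements j b

/-- Two such edges at `v` would give a common neighbour `t` of two large sets of neighbours of the
two ends, which therefore overlap more than the neighbourhoods of two ends of `z` do. -/
theorem eq_of_reachableEdge (H : DeficientPartition G κ n Δ D)
    (hZ : IsMaxFullPair G κ D ∅ Set.univ S z₀) (hz : Reachable G κ S Set.univ z₀ z)
    (h : ReachableEdge G κ S z₀ v (z j b)) (h' : ReachableEdge G κ S z₀ v (z j' b')) :
    j = j' ∧ b = b' := by
  by_contra hne
  have hinter := (hZ.of_reachable H hz).full.three_mul_card_inter_lt H hne
  obtain ⟨X, Y, hX, hY, hXu, hYv, hXY⟩ := hZ.exists_biclique_of_reachableEdge H h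
  obtain ⟨X', Y', hX', hY', hXu', hYv', hXY'⟩ := hZ.exists_biclique_of_reachableEdge H h'
  have hdeg : ∀ t, (G.neighborFinset t).card ≤ Δ := H.degree_le
  obtain ⟨t, ht⟩ := Finset.inter_nonempty_of_card_lt_card_add_card hYv hYv'
    (by have := hdeg v; omega)
  obtain ⟨ht, ht'⟩ := Finset.mem_inter.1 ht
  have hunion := Finset.card_le_card (Finset.union_subset (hXY t ht) (hXY' t ht'))
  have hcard := Finset.card_union_add_card_inter X X'
  have hle := Finset.card_le_card (Finset.inter_subset_inter hXu hXu')
  have := hdeg t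
  omega

theorem reachableEdge_iff_of_reachable (H : DeficientPartition G κ n Δ D)
    (hZ : IsMaxFullPair G κ D ∅ Set.univ S z₀) (hz : Reachable G κ S Set.univ z₀ z)
    (hv : κ v ∈ S) (j : J) (b : Bool) :
    ReachableEdge G κ S z₀ v (z j b) ↔ ReachableEdge G κ S z₀ v (z₀ j b) := by
  induction hz generalizing j b with
  | refl => rfl
  | @tail y y' hr h ih =>
    have hr' := hr.tail h
    obtain ⟨i, -, c, w, -, rfl⟩ := h
    rw [← ih]
    obtain ⟨k, d, hkd⟩ := hZ.exists_reachableEdge H hr hv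
    obtain ⟨k', d', hkd'⟩ := hZ.exists_reachableEdge H hr' hv
    obtain ⟨rfl, rfl⟩ : k = k' ∧ d = d' := by
      by_cases hk : k = i ∧ d = c
      · by_cases hk' : k' = i ∧ d' = c
        · exact ⟨hk.1.trans hk'.1.symm, hk.2.trans hk'.2.symm⟩
        · rw [replaceEnd_apply_of_ne hk'] at hkd'
          exact hZ.eq_of_reachableEdge H hr hkd hkd'
      · rw [← replaceEnd_apply_of_ne (z := y) hk w] at hkd
        exact hZ.eq_of_reachableEdge H hr' hkd hkd'
    constructor
    · intro h
      obtain ⟨rfl, rfl⟩ := hZ.eq_of_reachableEdge H hr' hkd' h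
      exact hkd
    · intro h
      obtain ⟨rfl, rfl⟩ := hZ.eq_of_reachableEdge H hr hkd h
      exact hkd'

theorem mem_block_iff_of_reachable (H : DeficientPartition G κ n Δ D)
    (hZ : IsMaxFullPair G κ D ∅ Set.univ S z₀) (hz : Reachable G κ S Set.univ z₀ z) :
    w ∈ block G κ S z₀ j b ↔ κ w ∈ S ∧ ReachableEdge G κ S z₀ w (z j !b) := by
  rw [mem_block]
  exact and_congr_right fun hw => (hZ.reachableEdge_iff_of_reachable H hz hw j !b).symm

theorem exists_mem_block (H : DeficientPartition G κ n Δ D)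
    (hZ : IsMaxFullPair G κ D ∅ Set.univ S z₀) (hv : κ v ∈ S) :
    ∃ j b, v ∈ block G κ S z₀ j b := by
  obtain ⟨j, b, h⟩ := hZ.exists_reachableEdge H Reachable.refl hv
  exact ⟨j, !b, mem_block.2 ⟨hv, by rwa [Bool.not_not]⟩⟩

theorem eq_of_mem_block (H : DeficientPartition G κ n Δ D)
    (hZ : IsMaxFullPair G κ D ∅ Set.univ S z₀) (h : v ∈ block G κ S z₀ j b)
    (h' : v ∈ block G κ S z₀ j' b') : j = j' ∧ b = b' :=
  (hZ.eq_of_reachableEdge H Reachable.refl (mem_block.1 h).2 (mem_block.1 h').2).imp_right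
    Bool.not_inj

theorem end_mem_block (H : DeficientPartition G κ n Δ D)
    (hZ : IsMaxFullPair G κ D ∅ Set.univ S z₀) (hz : Reachable G κ S Set.univ z₀ z)
    (j : J) (b : Bool) : z j b ∈ block G κ S z₀ j b :=
  (hZ.mem_block_iff_of_reachable H hz).2
    ⟨(hZ.of_reachable H hz).full.mem j b, z, hz, j, b, rfl, rfl⟩

theorem exists_reachable_of_mem_block (H : DeficientPartition G κ n Δ D)
    (hZ : IsMaxFullPair G κ D ∅ Set.univ S z₀) (hw : w ∈ block G κ S z₀ j b) :
    ∃ z, Reachable G κ S Set.univ z₀ z ∧ z j b = w := by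
  obtain ⟨z, hz, i, c, rfl, -⟩ := (mem_block.1 hw).2
  obtain ⟨rfl, rfl⟩ := hZ.eq_of_mem_block H hw (hZ.end_mem_block H hz i c)
  exact ⟨z, hz, rfl⟩

theorem adj_of_mem_block (H : DeficientPartition G κ n Δ D)
    (hZ : IsMaxFullPair G κ D ∅ Set.univ S z₀) (hx : x ∈ block G κ S z₀ j b)
    (hy : y ∈ block G κ S z₀ j !b) : G.Adj x y := by
  obtain ⟨z, hz, rfl⟩ := hZ.exists_reachable_of_mem_block H hx
  have hedge := ((hZ.mem_block_iff_of_reachable H hz).1 hy).2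
  rw [Bool.not_not] at hedge
  exact (hZ.adj_of_reachableEdge H hedge).symm

theorem replacements_subset_block (H : DeficientPartition G κ n Δ D)
    (hZ : IsMaxFullPair G κ D ∅ Set.univ S z₀) (hz : Reachable G κ S Set.univ z₀ z)
    (j : J) (b : Bool) : replacements G κ S z j b ⊆ block G κ S z₀ j b := fun w hw =>
  (hZ.mem_block_iff_of_reachable H hz).2
    ⟨(mem_looseVerts.1 (mem_replacements.1 hw).1).1, replaceEnd z j b w,
      hz.tail_replaceEnd trivial hw, j, b, replaceEnd_self _ _ _, replaceEnd_not _ _ _⟩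

theorem lt_card_block (H : DeficientPartition G κ n Δ D)
    (hZ : IsMaxFullPair G κ D ∅ Set.univ S z₀) (j : J) (b : Bool) :
    2 * Δ < 3 * (block G κ S z₀ j b).card :=
  (hZ.lt_card_replacements H trivial b).trans_le <| Nat.mul_le_mul_left _ <|
    Finset.card_le_card (hZ.replacements_subset_block H Reachable.refl j b)

theorem linked_of_mem_block (H : DeficientPartition G κ n Δ D)
    (hZ : IsMaxFullPair G κ D ∅ Set.univ S z₀) (hw : w ∈ block G κ S z₀ j b) (b' : Bool) :
    Linked (classEnds κ z₀) Set.univ (κ w) (κ (z₀ j b')) := by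
  obtain ⟨z, hz, rfl⟩ := hZ.exists_reachable_of_mem_block H hw
  exact (hz.linked_end j b).trans (Linked.edge (Set.mem_univ j) b b')

end IsMaxFullPair

end Blocks

section MultiplyDominated

variable {V ι : Type*} {J : Type} [Fintype V] [Fintype J] {G : SimpleGraph V} {κ : V → ι}
  {n Δ D : ℕ} {S : Finset ι} {y : J → Bool → V} {v : V}

/-- The vertices of the classes in `S` that are adjacent to at least two ends of edges of `y`. -/
noncomputable def multiplyDominated (G : SimpleGraph V) (κ : V → ι) (S : Finset ι)
    (y : J → Bool → V) : Finset V :=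
  (classUnion κ S).filter fun v => 1 < (dominators G y v).card

theorem eq_of_notMem_multiplyDominated {j j' : J} {b b' : Bool} (hv : κ v ∈ S)
    (h : v ∉ multiplyDominated G κ S y) (hj : G.Adj (y j b) v) (hj' : G.Adj (y j' b') v) :
    j = j' ∧ b = b' := by
  rw [multiplyDominated, Finset.mem_filter, mem_classUnion, not_and, not_lt] at h
  exact Prod.ext_iff.1 <|
    Finset.card_le_one.1 (h hv) _ (mem_dominators.2 hj) _ (mem_dominators.2 hj')

theorem DeficientPartition.sum_card_dominators_le (H : DeficientPartition G κ n Δ D)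
    (y : J → Bool → V) (X : Finset V) :
    ∑ v ∈ X, (dominators G y v).card ≤ 2 * Fintype.card J * Δ :=
  calc ∑ v ∈ X, (dominators G y v).card
      = ∑ s : J × Bool, (X.filter (G.Adj (y s.1 s.2))).card :=
        Finset.sum_card_bipartiteAbove_eq_sum_card_bipartiteBelow
          fun v (s : J × Bool) => G.Adj (y s.1 s.2) v
    _ ≤ ∑ _s : J × Bool, Δ := Finset.sum_le_sum fun s _ =>
        (Finset.card_le_card fun v hv =>
          (G.mem_neighborFinset _ _).2 (Finset.mem_filter.1 hv).2).trans (H.degree_le _)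
    _ = 2 * Fintype.card J * Δ := by
        rw [Finset.sum_const, Finset.card_univ, Fintype.card_prod, Fintype.card_bool, smul_eq_mul,
          mul_comm 2]

namespace IsFullPair

theorem card_classUnion_add_card_multiplyDominated_le (hF : IsFullPair G κ D S y) :
    (classUnion κ S).card + (multiplyDominated G κ S y).card ≤
      ∑ v ∈ classUnion κ S, (dominators G y v).card := by
  rw [multiplyDominated, Finset.card_filter, Finset.card_eq_sum_ones, ← Finset.sum_add_distrib]
  refine Finset.sum_le_sum fun v hv => ?_
  split_ifs with h
  · exact h
  · obtain ⟨j, b, h⟩ := hF.dom v (mem_classUnion.1 hv)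
    exact Finset.card_pos.2 ⟨(j, b), mem_dominators.2 h⟩

theorem three_mul_card_multiplyDominated_lt (H : DeficientPartition G κ n Δ D)
    (hF : IsFullPair G κ D S y) (hS : S.Nonempty) :
    3 * (multiplyDominated G κ S y).card < Δ := by
  have := H.finite
  have := Fintype.ofFinite ι
  have hn := H.mul_card_le_card_classUnion S
  have htight := H.tight S.card hS.card_pos
    (Nat.card_eq_fintype_card (α := ι) ▸ Finset.card_le_univ _)
  have hsum := hF.card_classUnion_add_card_multiplyDominated_le.trans
    (H.sum_card_dominators_le y _)
  rw [← hF.card_eq] at hn htight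
  nlinarith

end IsFullPair

end MultiplyDominated

section BlockSystem

variable {V ι : Type*} {J L : Type} {G : SimpleGraph V} {κ : V → ι} {n Δ D : ℕ} {S C : Finset ι}
  {y : J → Bool → V} {F : Set (Bool → V)} {A : Set J} {B : L → Bool → Finset V} {i i' j₀ : J}
  {b b' d d' : Bool} {l l' : L} {v w x : V} {k : Bool → L} {c : Bool → Bool}

/-- A cover of the vertices of the classes in `C` by pairs of large blocks, opposite blocks being
completely joined. As in a tree on `C`, there is one pair less than there are classes. -/
structure BlockSystem [Fintype L] (G : SimpleGraph V) (κ : V → ι) (Δ : ℕ) (C : Finset ι)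
    (B : L → Bool → Finset V) : Prop where
  cover : ∀ v, κ v ∈ C → ∃ l b, v ∈ B l b
  mem : ∀ l b, ∀ v ∈ B l b, κ v ∈ C
  adj : ∀ l b, ∀ x ∈ B l b, ∀ y ∈ B l !b, G.Adj x y
  large : ∀ l b, 2 * Δ < 3 * (B l b).card
  card_eq : Fintype.card L + 1 = C.card

/-- The end `b` of the edge `i` of `y` can be replaced by a vertex of the block `B l d`. -/
def MeetsBlock [Fintype V] (G : SimpleGraph V) (κ : V → ι) (S : Finset ι) (y : J → Bool → V)
    (B : L → Bool → Finset V) (i : J) (b : Bool) (l : L) (d : Bool) : Prop :=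
  ∃ w ∈ replacements G κ S y i b, w ∈ B l d

/-- The edges of `y` other than `j₀` that have an end meeting a block. -/
noncomputable def blockEdges [Fintype V] [Fintype J] (G : SimpleGraph V) (κ : V → ι)
    (S : Finset ι) (y : J → Bool → V) (B : L → Bool → Finset V) (j₀ : J) : Finset J :=
  Finset.univ.filter fun i => i ≠ j₀ ∧ ∃ b l d, MeetsBlock G κ S y B i b l d

theorem mem_blockEdges [Fintype V] [Fintype J] :
    i ∈ blockEdges G κ S y B j₀ ↔ i ≠ j₀ ∧ ∃ b l d, MeetsBlock G κ S y B i b l d := by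
  simp [blockEdges]

theorem notMem_blockEdges_self [Fintype V] [Fintype J] : j₀ ∉ blockEdges G κ S y B j₀ := fun h =>
  (mem_blockEdges.1 h).1 rfl

namespace BlockSystem

variable [Fintype L]

theorem nonempty (hB : BlockSystem G κ Δ C B) (l : L) (b : Bool) : (B l b).Nonempty :=
  Finset.card_pos.1 (by have := hB.large l b; omega)

variable [Fintype V]

theorem subset_neighborFinset (hB : BlockSystem G κ Δ C B) (hx : x ∈ B l b) :
    B l (!b) ⊆ G.neighborFinset x := fun y hy =>
  (G.mem_neighborFinset _ _).2 (hB.adj l b x hx y hy)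

variable [Fintype J]

theorem meetsBlock_not (H : DeficientPartition G κ n Δ D) (hB : BlockSystem G κ Δ C B)
    (hY : IsMaxFullPair G κ D F A S y) (hi : i ∈ A) (h : MeetsBlock G κ S y B i b l d) :
    MeetsBlock G κ S y B i (!b) l !d := by
  obtain ⟨w, hw, hwB⟩ := h
  have hdeg : (G.neighborFinset w).card ≤ Δ := H.degree_le w
  have hR := hY.lt_card_replacements H hi !b
  have hlarge := hB.large l !d
  obtain ⟨w', hw'⟩ := Finset.inter_nonempty_of_card_lt_card_add_card
    (hY.replacements_subset_neighborFinset H hi (b := !b) (by rwa [Bool.not_not]))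
    (hB.subset_neighborFinset hwB) (by omega)
  exact ⟨w', Finset.mem_inter.1 hw'⟩

theorem card_add_card_le_card_inter_add (H : DeficientPartition G κ n Δ D)
    (hB : BlockSystem G κ Δ C B) (hY : IsMaxFullPair G κ D F A S y) (hi : i ∈ A)
    (h : MeetsBlock G κ S y B i b l d) :
    (replacements G κ S y i b).card + (B l d).card ≤
      (replacements G κ S y i b ∩ B l d).card + Δ := by
  obtain ⟨w, hw, hwB⟩ := hB.meetsBlock_not H hY hi h
  have hdeg : (G.neighborFinset w).card ≤ Δ := H.degree_le w
  have hsub := hB.subset_neighborFinset hwB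
  rw [Bool.not_not] at hsub
  have hunion := Finset.card_le_card
    (Finset.union_subset (hY.replacements_subset_neighborFinset H hi hw) hsub)
  have hcard := Finset.card_union_add_card_inter (replacements G κ S y i b) (B l d)
  omega

theorem eq_of_meetsBlock (H : DeficientPartition G κ n Δ D) (hB : BlockSystem G κ Δ C B)
    (hY : IsMaxFullPair G κ D F A S y) (hi : i ∈ A) (hi' : i' ∈ A)
    (h : MeetsBlock G κ S y B i b l d) (h' : MeetsBlock G κ S y B i' b' l d) :
    i = i' ∧ b = b' := by
  by_contra hne
  have hinter := hB.card_add_card_le_card_inter_add H hY hi h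
  have hinter' := hB.card_add_card_le_card_inter_add H hY hi' h'
  have hdisj : Disjoint (replacements G κ S y i b ∩ B l d) (replacements G κ S y i' b' ∩ B l d) :=
    Finset.disjoint_left.2 fun x hx hx' => hne <|
      hY.full.eq_of_mem_replacements (Finset.mem_inter.1 hx).1 (Finset.mem_inter.1 hx').1
  have hunion := Finset.card_le_card (Finset.union_subset
    (Finset.inter_subset_right (s₁ := replacements G κ S y i b) (s₂ := B l d))
    (Finset.inter_subset_right (s₁ := replacements G κ S y i' b')))
  rw [Finset.card_union_of_disjoint hdisj] at hunion
  have hlarge := hB.large l d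
  have hR := hY.lt_card_replacements H hi b
  have hR' := hY.lt_card_replacements H hi' b'
  omega

theorem eq_of_meetsBlock_pair (H : DeficientPartition G κ n Δ D) (hB : BlockSystem G κ Δ C B)
    (hY : IsMaxFullPair G κ D F A S y) (hi : i ∈ A) (hi' : i' ∈ A)
    (h : MeetsBlock G κ S y B i b l d) (h' : MeetsBlock G κ S y B i' b' l d') : i = i' := by
  obtain rfl | rfl := Bool.eq_or_eq_not d' d
  · exact (hB.eq_of_meetsBlock H hY hi hi' h h').1
  · exact (hB.eq_of_meetsBlock H hY hi hi' (hB.meetsBlock_not H hY hi h) h').1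

theorem end_notMem_of_meetsBlock (H : DeficientPartition G κ n Δ D) (hB : BlockSystem G κ Δ C B)
    (hY : IsMaxFullPair G κ D F A S y) (hi : i ∈ A) (hij : i ≠ j₀)
    (h : MeetsBlock G κ S y B i b l d) (b' d' : Bool) : y j₀ b' ∉ B l d' := by
  intro hmem
  obtain ⟨b'', w, hw, hwB⟩ : ∃ b'', MeetsBlock G κ S y B i b'' l !d' := by
    obtain rfl | rfl := Bool.eq_or_eq_not d d'
    · exact ⟨_, hB.meetsBlock_not H hY hi h⟩
    · exact ⟨b, h⟩
  exact (mem_looseVerts.1 (mem_replacements.1 hw).1).2 j₀ hij.symm b' (hB.adj l d' _ hmem w hwB)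

theorem card_blockEdges_add_two_le (H : DeficientPartition G κ n Δ D)
    (hB : BlockSystem G κ Δ C B) (hY : IsMaxFullPair G κ D F {j₀}ᶜ S y)
    (hk : Function.Injective k) (hkc : ∀ b, y j₀ b ∈ B (k b) (c b)) :
    (blockEdges G κ S y B j₀).card + 2 ≤ Fintype.card L := by
  have hle : (blockEdges G κ S y B j₀).card ≤ (Finset.univ.image k)ᶜ.card := by
    refine Finset.card_le_card_of_forall_subsingleton
      (fun i l => ∃ b d, MeetsBlock G κ S y B i b l d) (fun i hi => ?_) fun l _ => ?_
    · obtain ⟨hij, b, l, d, h⟩ := mem_blockEdges.1 hi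
      refine ⟨l, Finset.mem_compl.2 fun hl => ?_, b, d, h⟩
      obtain ⟨b', -, rfl⟩ := Finset.mem_image.1 hl
      exact hB.end_notMem_of_meetsBlock H hY hij hij h b' _ (hkc b')
    · rintro i ⟨hi, b, d, h⟩ i' ⟨hi', b', d', h'⟩
      exact hB.eq_of_meetsBlock_pair H hY (mem_blockEdges.1 hi).1 (mem_blockEdges.1 hi').1 h h'
  have hcard := Finset.card_add_card_compl (Finset.univ.image k)
  rw [Finset.card_image_of_injective _ hk, Finset.card_univ, Fintype.card_bool] at hcard
  omega

theorem exists_adj_of_mem_inter (H : DeficientPartition G κ n Δ D) (hB : BlockSystem G κ Δ C B)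
    (hY : IsMaxFullPair G κ D F {j₀}ᶜ S y) (hv : κ v ∈ C ∩ S) :
    ∃ i ∈ insert j₀ (blockEdges G κ S y B j₀), ∃ b, G.Adj (y i b) v := by
  obtain ⟨hvC, hvS⟩ := Finset.mem_inter.1 hv
  by_contra! hcon
  obtain ⟨y', hy', i, hi, b, hyi, hvR⟩ := hY.exists_mem_replacements_reachable H hvS
    fun i hi b => Set.notMem_compl_iff.1 hi ▸ hcon j₀ (Finset.mem_insert_self _ _) b
  have hY' := hY.of_reachable H hy'
  have hend : y i b ∈ replacements G κ S y i !!b := by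
    rw [Bool.not_not]
    exact hY.full.end_mem_replacements i b
  have hend' : y i b ∈ replacements G κ S y' i !!b := by
    rw [Bool.not_not, ← hyi]
    exact hY'.full.end_mem_replacements i b
  have hadj : G.Adj (y i b) v :=
    (G.mem_neighborFinset _ _).1 (hY'.replacements_subset_neighborFinset H hi hend' hvR)
  refine hcon i (Finset.mem_insert_of_mem (mem_blockEdges.2 ⟨hi, !b, ?_⟩)) b hadj
  obtain ⟨l, d, hvB⟩ := hB.cover v hvC
  have hinter := hB.card_add_card_le_card_inter_add H hY' hi ⟨v, hvR, hvB⟩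
  have hlarge := hB.large l d
  have hR' := hY'.lt_card_replacements H hi !b
  have hR := hY.lt_card_replacements H hi !b
  have hdeg : (G.neighborFinset (y i b)).card ≤ Δ := H.degree_le _
  obtain ⟨w, hw⟩ := Finset.inter_nonempty_of_card_lt_card_add_card
    (Finset.inter_subset_left.trans (hY'.replacements_subset_neighborFinset H hi hend'))
    (hY.replacements_subset_neighborFinset H hi hend)
    (show _ < (replacements G κ S y' i (!b) ∩ B l d).card + _ by omega)
  obtain ⟨hw', hwR⟩ := Finset.mem_inter.1 hw
  exact ⟨l, d, w, hwR, (Finset.mem_inter.1 hw').2⟩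

theorem card_inter_le (H : DeficientPartition G κ n Δ D) (hB : BlockSystem G κ Δ C B)
    (hC : ∀ m, m + 1 < C.card → 2 * Δ * m < n * (m + 1)) (hY : IsMaxFullPair G κ D F {j₀}ᶜ S y)
    (hk : Function.Injective k) (hkc : ∀ b, y j₀ b ∈ B (k b) (c b)) :
    (C ∩ S).card ≤ (blockEdges G κ S y B j₀).card + 1 := by
  by_contra! hlt
  set t := (blockEdges G κ S y B j₀).card
  have hcover := H.card_le_of_cover (X := classUnion κ (C ∩ S))
    (ends y (insert j₀ (blockEdges G κ S y B j₀))) ∅ fun v hv => by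
      obtain ⟨i, hi, b, h⟩ := hB.exists_adj_of_mem_inter H hY (mem_classUnion.1 hv)
      exact Or.inr ⟨_, mem_ends.2 ⟨i, hi, b, rfl⟩, h⟩
  have hends := card_ends_le y (insert j₀ (blockEdges G κ S y B j₀))
  rw [Finset.card_insert_of_notMem notMem_blockEdges_self] at hends
  have hL := hB.card_blockEdges_add_two_le H hY hk hkc
  have hCL := hB.card_eq
  refine (hC (t + 1) (by omega)).not_ge ?_
  calc n * (t + 1 + 1) ≤ n * (C ∩ S).card := Nat.mul_le_mul_left _ hlt
    _ ≤ (classUnion κ (C ∩ S)).card := H.mul_card_le_card_classUnion _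
    _ ≤ Δ * (ends y (insert j₀ (blockEdges G κ S y B j₀))).card := hcover
    _ ≤ Δ * (2 * (t + 1)) := Nat.mul_le_mul_left _ hends
    _ = 2 * Δ * (t + 1) := by ring

theorem exists_dominator (H : DeficientPartition G κ n Δ D) (hB : BlockSystem G κ Δ C B)
    (hY : IsMaxFullPair G κ D F {j₀}ᶜ S y) (hk : Function.Injective k)
    (hkc : ∀ b, y j₀ b ∈ B (k b) (c b)) (l : L) (d : Bool) :
    ∃ q, B l d ⊆ G.neighborFinset q ∧ (∀ b, k b = l → (!c b) = d → q = y j₀ b) ∧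
      ∀ i ≠ j₀, ∀ b, MeetsBlock G κ S y B i b l d →
        replacements G κ S y i b ⊆ G.neighborFinset q := by
  have hne : ∀ i ≠ j₀, ∀ b, MeetsBlock G κ S y B i b l d → ∀ b', k b' ≠ l := by
    rintro i hi b h b' rfl
    exact hB.end_notMem_of_meetsBlock H hY hi hi h b' _ (hkc b')
  by_cases hend : ∃ b, k b = l ∧ (!c b) = d
  · obtain ⟨b, rfl, rfl⟩ := hend
    exact ⟨y j₀ b, hB.subset_neighborFinset (hkc b), fun b' hb' _ => by rw [hk hb'],
      fun i hi b' h => (hne i hi b' h b rfl).elim⟩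
  push Not at hend
  by_cases hmeet : ∃ i ≠ j₀, ∃ b, MeetsBlock G κ S y B i b l d
  · obtain ⟨i, hi, b, h⟩ := hmeet
    obtain ⟨w, hw, hwB⟩ := hB.meetsBlock_not H hY hi h
    refine ⟨w, by simpa using hB.subset_neighborFinset hwB, fun b' hb' hd => (hend b' hb' hd).elim,
      fun i' hi' b' h' => ?_⟩
    obtain ⟨rfl, rfl⟩ := hB.eq_of_meetsBlock H hY hi hi' h h'
    exact hY.replacements_subset_neighborFinset H hi hw
  · obtain ⟨w, hw⟩ := hB.nonempty l !d
    exact ⟨w, by simpa using hB.subset_neighborFinset hw, fun b' hb' hd => (hend b' hb' hd).elim,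
      fun i hi b h => (hmeet ⟨i, hi, b, h⟩).elim⟩

/-- The dominating set consists of one vertex for each block and the ends of the edges of `y` not in
`blockEdges`. -/
theorem exists_dominating_union (H : DeficientPartition G κ n Δ D) (hB : BlockSystem G κ Δ C B)
    (hY : IsMaxFullPair G κ D F {j₀}ᶜ S y) (hk : Function.Injective k)
    (hkc : ∀ b, y j₀ b ∈ B (k b) (c b)) :
    ∃ W : Finset V, W.card + 2 * (blockEdges G κ S y B j₀).card + 2 ≤
        2 * Fintype.card L + 2 * Fintype.card J ∧
      ∀ v, κ v ∈ S ∪ C → v ∈ multiplyDominated G κ S y ∨ ∃ w ∈ W, G.Adj w v := by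
  choose q hqB hqend hqR using hB.exists_dominator H hY hk hkc
  set T := insert j₀ (blockEdges G κ S y B j₀)
  set Q : Finset V := (Finset.univ : Finset (L × Bool)).image fun s => q s.1 s.2 with hQ
  have hqQ : ∀ l d, q l d ∈ Q := fun l d =>
    Finset.mem_image.2 ⟨(l, d), Finset.mem_univ _, rfl⟩
  refine ⟨Q ∪ ends y Tᶜ, ?_, fun v hv => or_iff_not_imp_left.2 fun hmult => ?_⟩
  · have hQcard : Q.card ≤ Fintype.card L * 2 := by
      simpa [hQ] using Finset.card_image_le (s := Finset.univ) (f := fun s : L × Bool => q s.1 s.2)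
    have hunion := Finset.card_union_le Q (ends y Tᶜ)
    have hends := card_ends_le y Tᶜ
    have hcompl := Finset.card_add_card_compl T
    have hTcard : T.card = _ := Finset.card_insert_of_notMem notMem_blockEdges_self
    omega
  by_cases hvC : κ v ∈ C
  · obtain ⟨l, d, hvB⟩ := hB.cover v hvC
    exact ⟨q l d, Finset.mem_union_left _ (hqQ l d), (G.mem_neighborFinset _ _).1 (hqB l d hvB)⟩
  have hvS := (Finset.mem_union.1 hv).resolve_right hvC
  obtain ⟨i, b, hadj⟩ := hY.full.dom v hvS
  by_cases hiT : i ∈ T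
  · obtain rfl | hi := Finset.mem_insert.1 hiT
    · refine ⟨y i b, Finset.mem_union_left _ ?_, hadj⟩
      rw [← hqend (k b) (!c b) b rfl rfl]
      exact hqQ _ _
    · obtain ⟨hij, b', l, d, hmeet⟩ := mem_blockEdges.1 hi
      obtain ⟨b'', hvR⟩ := hY.exists_mem_replacements H hij <| mem_looseVerts.2
        ⟨hvS, fun i' hi' b'' h =>
          hi' (eq_of_notMem_multiplyDominated hvS hmult hadj h).1.symm⟩
      obtain ⟨d', hmeet'⟩ : ∃ d', MeetsBlock G κ S y B i b'' l d' := by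
        obtain rfl | rfl := Bool.eq_or_eq_not b'' b'
        · exact ⟨d, hmeet⟩
        · exact ⟨!d, hB.meetsBlock_not H hY hij hmeet⟩
      exact ⟨q l d', Finset.mem_union_left _ (hqQ _ _),
        (G.mem_neighborFinset _ _).1 (hqR l d' i hij b'' hmeet' hvR)⟩
  · exact ⟨y i b, Finset.mem_union_right _ (mem_ends.2 ⟨i, Finset.mem_compl.2 hiT, b, rfl⟩), hadj⟩

theorem not_injective (H : DeficientPartition G κ n Δ D) (hB : BlockSystem G κ Δ C B)
    (hC : ∀ m, m + 1 < C.card → 2 * Δ * m < n * (m + 1)) (hY : IsMaxFullPair G κ D F {j₀}ᶜ S y)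
    (hkc : ∀ b, y j₀ b ∈ B (k b) (c b)) : ¬ Function.Injective k := by
  intro hk
  obtain ⟨W, hW, hdom⟩ := hB.exists_dominating_union H hY hk hkc
  have hS : S.Nonempty := ⟨_, hY.full.mem j₀ false⟩
  have htight := H.tight_cover (hS.mono Finset.subset_union_left) W _ hdom
  have hmult := hY.full.three_mul_card_multiplyDominated_lt H hS
  have hinter := hB.card_inter_le H hC hY hk hkc
  have hunion := Finset.card_union_add_card_inter S C
  rw [Finset.inter_comm] at hunion
  have hScard := hY.full.card_eq
  have hCcard := hB.card_eq
  have hW' : W.card + 2 * D + 2 ≤ 2 * (S ∪ C).card := by omega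
  have := Nat.mul_le_mul_left (3 * Δ) hW'
  nlinarith

/-- Two ends of an edge in one block would have all of the opposite block as common neighbours. -/
theorem opposite_of_mem (H : DeficientPartition G κ n Δ D) (hB : BlockSystem G κ Δ C B)
    (hC : ∀ m, m + 1 < C.card → 2 * Δ * m < n * (m + 1)) (hY : IsMaxFullPair G κ D F {j₀}ᶜ S y)
    (h : y j₀ false ∈ B l d) (h' : y j₀ true ∈ B l' d') : l = l' ∧ d' = !d := by
  obtain rfl : l = l' := by
    by_contra hne
    refine hB.not_injective H hC hY (k := fun b => bif b then l' else l)
      (c := fun b => bif b then d' else d) (Bool.rec h h') ?_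
    rintro (_ | _) (_ | _) h
    exacts [rfl, (hne h).elim, (hne h.symm).elim, rfl]
  refine ⟨rfl, (Bool.eq_or_eq_not d' d).resolve_left ?_⟩
  rintro rfl
  have hinter := hY.full.three_mul_card_inter_lt H (j := j₀) (j' := j₀) (b := false) (b' := true)
    (by simp)
  have hsub := Finset.card_le_card <|
    Finset.subset_inter (hB.subset_neighborFinset h) (hB.subset_neighborFinset h')
  have hlarge := hB.large l !d'
  omega

end BlockSystem

end BlockSystem

section Main

variable {V ι : Type*} {J : Type} {G : SimpleGraph V} {κ : V → ι} {n Δ D q : ℕ} {S C X : Finset ι}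
  {z z₀ : J → Bool → V} {j l : J} {b c : Bool} {v w : V}

/-- Removing any edge of `G` creates a partial transversal missing fewer than `D` classes. -/
def IsEdgeCritical (G : SimpleGraph V) (κ : V → ι) (D : ℕ) : Prop :=
  ∀ u v, G.Adj u v → ∃ T, IsPartialTransversal (G.deleteEdges {s(u, v)}) κ T ∧
    Nat.card ι < T.card + D

theorem exists_isEdgeCritical [Finite V] {G₀ : SimpleGraph V}
    (h : ∀ T, IsPartialTransversal G₀ κ T → T.card + D ≤ Nat.card ι) :
    ∃ G ≤ G₀, (∀ T, IsPartialTransversal G κ T → T.card + D ≤ Nat.card ι) ∧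
      IsEdgeCritical G κ D := by
  obtain ⟨G, ⟨hle, hG⟩, hmin⟩ := (Set.toFinite {G : SimpleGraph V | G ≤ G₀ ∧
    ∀ T, IsPartialTransversal G κ T → T.card + D ≤ Nat.card ι}).exists_minimal ⟨G₀, le_rfl, h⟩
  refine ⟨G, hle, hG, fun u v huv => ?_⟩
  by_contra! hcon
  have hdel := hmin ⟨(SimpleGraph.deleteEdges_le _).trans hle, hcon⟩
    (SimpleGraph.deleteEdges_le _) huv
  exact (SimpleGraph.deleteEdges_adj.1 hdel).2 rfl

/-- Adjacent vertices of blocks lie in opposite blocks. -/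
def OnlyOppositeAdj {L : Type*} (G : SimpleGraph V) (B : L → Bool → Finset V) : Prop :=
  ∀ l l' d d' u v, u ∈ B l d → v ∈ B l' d' → G.Adj u v → l = l' ∧ d' = !d

theorem BlockSystem.onlyOppositeAdj {L : Type} [Fintype V] [Fintype L]
    {B : L → Bool → Finset V} (H : DeficientPartition G κ n Δ D) (hB : BlockSystem G κ Δ C B)
    (hC : ∀ m, m + 1 < C.card → 2 * Δ * m < n * (m + 1)) (hcrit : IsEdgeCritical G κ D) :
    OnlyOppositeAdj G B := by
  intro l l' d d' u v hu hv hadj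
  obtain ⟨T, hT, hcard⟩ := hcrit u v hadj
  obtain ⟨S, J, _, y, j₀, hf, hY⟩ :=
    H.exists_isMaxFullPair_edge (f := fun b => bif b then v else u) hadj hT hcard
  exact hB.opposite_of_mem H hC hY (by simpa [hf] using hu) (by simpa [hf] using hv)

theorem IsFullPair.exists_component [Finite ι] [Fintype J] (hF : IsFullPair G κ D S z₀)
    (hq : Nat.card ι < (q + 1) * D) :
    ∃ C ⊆ S, C.Nonempty ∧ C.card ≤ q ∧
      ∀ c ∈ C, ∀ d ∈ S, Linked (classEnds κ z₀) Set.univ c d → d ∈ C := by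
  have := Fintype.ofFinite ι
  have hcomp := hF.isForest.card_image_component_univ hF.mem
  rw [← hF.card_eq, add_comm, add_left_cancel_iff] at hcomp
  have hlt : S.card < (S.image (component (classEnds κ z₀) Set.univ)).card * (q + 1) := by
    rw [hcomp, mul_comm]
    exact (Nat.card_eq_fintype_card (α := ι) ▸ Finset.card_le_univ S).trans_lt hq
  obtain ⟨x, hx, hcard⟩ := Finset.exists_card_fiber_lt_of_card_lt_mul hlt
  obtain ⟨c, hc, rfl⟩ := Finset.mem_image.1 hx
  refine ⟨S.filter fun d => component (classEnds κ z₀) Set.univ d = component _ _ c,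
    Finset.filter_subset _ S, ⟨c, Finset.mem_filter.2 ⟨hc, rfl⟩⟩,
    Nat.le_of_lt_succ hcard, fun a ha d hd had => Finset.mem_filter.2 ⟨hd, ?_⟩⟩
  exact (component_eq_iff.2 had.symm).trans (Finset.mem_filter.1 ha).2

variable [Fintype V]

/-- The blocks of the edges of `z₀` whose ends have their classes in `C`. -/
noncomputable def blockOn (G : SimpleGraph V) (κ : V → ι) (S C : Finset ι) (z₀ : J → Bool → V)
    (l : {j // κ (z₀ j false) ∈ C}) (b : Bool) : Finset V :=
  block G κ S z₀ l b

namespace IsMaxFullPair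

variable [Fintype J]

theorem class_mem_iff_of_mem_block (H : DeficientPartition G κ n Δ D)
    (hZ : IsMaxFullPair G κ D ∅ Set.univ S z₀)
    (hcl : ∀ c ∈ C, ∀ d ∈ S, Linked (classEnds κ z₀) Set.univ c d → d ∈ C)
    (hv : v ∈ block G κ S z₀ j b) : κ v ∈ C ↔ κ (z₀ j false) ∈ C :=
  have hlinked := hZ.linked_of_mem_block H hv false
  ⟨fun h => hcl _ h _ (hZ.full.mem _ _) hlinked,
    fun h => hcl _ h _ (mem_block.1 hv).1 hlinked.symm⟩

theorem exists_mem_blockOn (H : DeficientPartition G κ n Δ D)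
    (hZ : IsMaxFullPair G κ D ∅ Set.univ S z₀) (hCS : C ⊆ S)
    (hcl : ∀ c ∈ C, ∀ d ∈ S, Linked (classEnds κ z₀) Set.univ c d → d ∈ C) (hv : κ v ∈ C) :
    ∃ l b, v ∈ blockOn G κ S C z₀ l b := by
  obtain ⟨j, b, h⟩ := hZ.exists_mem_block H (hCS hv)
  exact ⟨⟨j, (hZ.class_mem_iff_of_mem_block H hcl h).1 hv⟩, b, h⟩

/-- Each block is dominated by an end of the edge of `z₀` defining it. -/
theorem mul_card_le_mul_card_meeting (H : DeficientPartition G κ n Δ D)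
    (hZ : IsMaxFullPair G κ D ∅ Set.univ S z₀) (hCS : C ⊆ S)
    (hcl : ∀ c ∈ C, ∀ d ∈ S, Linked (classEnds κ z₀) Set.univ c d → d ∈ C) (hX : X ⊆ C) :
    n * X.card ≤ Δ * (meeting (fun l b => (blockOn G κ S C z₀ l b).image κ) X).card := by
  set M := meeting (fun l b => (blockOn G κ S C z₀ l b).image κ) X
  refine (H.mul_card_le_card_classUnion X).trans ?_
  refine (H.card_le_of_cover (M.image fun p => z₀ p.1 !p.2) ∅ fun v hv => Or.inr ?_).trans ?_
  · have hvX := mem_classUnion.1 hv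
    obtain ⟨l, b, h⟩ := hZ.exists_mem_blockOn H hCS hcl (hX hvX)
    refine ⟨z₀ l !b, Finset.mem_image.2 ⟨(l, b), ?_, rfl⟩, ?_⟩
    · exact mem_meeting.2 ⟨κ v, Finset.mem_image_of_mem _ h, hvX⟩
    · exact (hZ.adj_of_mem_block H h (hZ.end_mem_block H Reachable.refl _ _)).symm
  · exact Nat.mul_le_mul_left _ Finset.card_image_le

theorem card_eq_of_component (H : DeficientPartition G κ n Δ D)
    (hZ : IsMaxFullPair G κ D ∅ Set.univ S z₀) (hCS : C ⊆ S)
    (hN : ∀ m, m + 1 < q → 2 * Δ * m < n * (m + 1)) (hne : C.Nonempty) (hCq : C.card ≤ q)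
    (hcl : ∀ c ∈ C, ∀ d ∈ S, Linked (classEnds κ z₀) Set.univ c d → d ∈ C) :
    C.card = q ∧ Fintype.card {j // κ (z₀ j false) ∈ C} + 1 = C.card := by
  have hlt : Fintype.card {j // κ (z₀ j false) ∈ C} < C.card := by
    rw [Fintype.card_subtype]
    refine (hZ.full.isForest.mono (Set.subset_univ _)).card_lt hne fun j hj b => ?_
    exact hcl _ (Finset.mem_filter.1 hj).2 _ (hZ.full.mem j b)
      (Linked.edge (e := classEnds κ z₀) (Set.mem_univ j) false b)
  set m := Fintype.card {j // κ (z₀ j false) ∈ C}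
  have hle : q ≤ m + 1 := by
    by_contra! hmq
    refine (hN m hmq).not_ge ?_
    calc n * (m + 1) ≤ n * C.card := Nat.mul_le_mul_left _ hlt
      _ ≤ Δ * _ := hZ.mul_card_le_mul_card_meeting H hCS hcl subset_rfl
      _ ≤ Δ * (m * 2) := Nat.mul_le_mul_left _ <| (Finset.card_le_univ _).trans_eq <| by
        rw [Fintype.card_prod, Fintype.card_bool]
      _ = 2 * Δ * m := by ring
  omega

theorem blockSystem (H : DeficientPartition G κ n Δ D) (hZ : IsMaxFullPair G κ D ∅ Set.univ S z₀)
    (hCS : C ⊆ S) (hcl : ∀ c ∈ C, ∀ d ∈ S, Linked (classEnds κ z₀) Set.univ c d → d ∈ C)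
    (hcard : Fintype.card {j // κ (z₀ j false) ∈ C} + 1 = C.card) :
    BlockSystem G κ Δ C (blockOn G κ S C z₀) where
  cover _ hv := hZ.exists_mem_blockOn H hCS hcl hv
  mem l _ _ hv := (hZ.class_mem_iff_of_mem_block H hcl hv).2 l.2
  adj _ _ _ hx _ hy := hZ.adj_of_mem_block H hx hy
  large l b := hZ.lt_card_block H l b
  card_eq := hcard

theorem exists_mem_replacements_not_adj (H : DeficientPartition G κ n Δ D)
    (hZ : IsMaxFullPair G κ D ∅ Set.univ S z₀) (hz : Reachable G κ S Set.univ z₀ z)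
    (hw : w ∈ block G κ S z₀ l b) (hj : j ≠ l) (c : Bool) :
    ∃ x ∈ replacements G κ S z j c, ¬ G.Adj x w := by
  by_contra! hcon
  have hreplace := (hZ.of_reachable H hz).lt_card_replacements H (Set.mem_univ j) c
  have hblock := hZ.lt_card_block H l !b
  have hdeg : (G.neighborFinset w).card ≤ Δ := H.degree_le w
  obtain ⟨t, ht⟩ := Finset.inter_nonempty_of_card_lt_card_add_card
    (fun x hx => (G.mem_neighborFinset w x).2 (hcon x hx).symm)
    (fun x hx => (G.mem_neighborFinset w x).2 (hZ.adj_of_mem_block H hw hx))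
    (show _ < _ + (block G κ S z₀ l !b).card by omega)
  obtain ⟨ht, ht'⟩ := Finset.mem_inter.1 ht
  exact hj (hZ.eq_of_mem_block H (hZ.replacements_subset_block H hz j c ht) ht').1

/-- Among the reachable matchings agreeing with `s` on `P`, one with the fewest dominators of `w`
works: a dominator on another edge lies outside the blocks of `C` and could be replaced. -/
theorem exists_reachable_mem_looseVerts (H : DeficientPartition G κ n Δ D)
    (hZ : IsMaxFullPair G κ D ∅ Set.univ S z₀) (hopp : OnlyOppositeAdj G (blockOn G κ S C z₀))
    {s : {j // κ (z₀ j false) ∈ C} → Bool → V} {P : Finset ({j // κ (z₀ j false) ∈ C} × Bool)}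
    (hP : ∃ z, Reachable G κ S Set.univ z₀ z ∧ ∀ p ∈ P, z p.1 p.2 = s p.1 p.2)
    {l : {j // κ (z₀ j false) ∈ C}} (hw : w ∈ blockOn G κ S C z₀ l b) :
    ∃ z, Reachable G κ S Set.univ z₀ z ∧ (∀ p ∈ P, z p.1 p.2 = s p.1 p.2) ∧
      w ∈ looseVerts G κ S z l := by
  obtain ⟨y, ⟨hy, hyP⟩, hmin⟩ := exists_minimalFor_of_wellFoundedLT
    (fun y => Reachable G κ S Set.univ z₀ y ∧ ∀ p ∈ P, y p.1 p.2 = s p.1 p.2)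
    (fun y => (dominators G y w).card) hP
  refine ⟨y, hy, hyP, mem_looseVerts.2 ⟨(mem_block.1 hw).1, fun j hj c hadj => ?_⟩⟩
  have hjC : κ (z₀ j false) ∉ C := fun hjC =>
    hj (congrArg Subtype.val (hopp ⟨j, hjC⟩ l c b _ _ (hZ.end_mem_block H hy j c) hw hadj).1)
  obtain ⟨x, hx, hxw⟩ := hZ.exists_mem_replacements_not_adj H hy hw hj c
  have hlt := card_dominators_replaceEnd_lt hadj hxw
  refine hlt.not_ge (hmin ⟨hy.tail_replaceEnd trivial hx, fun p hp => ?_⟩ hlt.le)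
  rw [replaceEnd_of_ne fun h : p.1.1 = j => hjC (h ▸ p.1.2)]
  exact hyP p hp

theorem exists_reachable_eq (H : DeficientPartition G κ n Δ D)
    (hZ : IsMaxFullPair G κ D ∅ Set.univ S z₀) (hopp : OnlyOppositeAdj G (blockOn G κ S C z₀))
    {s : {j // κ (z₀ j false) ∈ C} → Bool → V} (hs : ∀ l b, s l b ∈ blockOn G κ S C z₀ l b)
    (P : Finset ({j // κ (z₀ j false) ∈ C} × Bool)) :
    ∃ z, Reachable G κ S Set.univ z₀ z ∧ ∀ p ∈ P, z p.1 p.2 = s p.1 p.2 := by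
  induction P using Finset.induction_on with
  | empty => exact ⟨z₀, Reachable.refl, by simp⟩
  | insert p P hp ih =>
    obtain ⟨l, b⟩ := p
    obtain ⟨y, hy, hyP, hloose⟩ := hZ.exists_reachable_mem_looseVerts H hopp ih (hs l b)
    obtain ⟨b', hb'⟩ := (hZ.of_reachable H hy).exists_mem_replacements H (Set.mem_univ _) hloose
    obtain rfl : b' = b :=
      (hZ.eq_of_mem_block H (hZ.replacements_subset_block H hy l b' hb') (hs l b)).2
    refine ⟨_, hy.tail_replaceEnd trivial hb', fun p' hp' => ?_⟩
    obtain rfl | hp' := Finset.mem_insert.1 hp'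
    · exact replaceEnd_self _ _ _
    · have hne : p' ≠ (l, b') := ne_of_mem_of_not_mem hp' hp
      rw [replaceEnd_apply_of_ne fun h => hne (Prod.ext (Subtype.ext h.1) h.2), hyP p' hp']

theorem treeSystem (H : DeficientPartition G κ n Δ D) (hZ : IsMaxFullPair G κ D ∅ Set.univ S z₀)
    (hB : BlockSystem G κ Δ C (blockOn G κ S C z₀))
    (hopp : OnlyOppositeAdj G (blockOn G κ S C z₀)) :
    TreeSystem C fun l b => (blockOn G κ S C z₀ l b).image κ where
  nonempty l b := (hB.nonempty l b).image κ
  subset l b := Finset.image_subset_iff.2 (hB.mem l b)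
  isForest t ht := by
    choose s hs hst using fun l b => Finset.mem_image.1 (ht l b)
    obtain ⟨z, hz, hzs⟩ := hZ.exists_reachable_eq H hopp hs Finset.univ
    have hforest := IsForest.comp_label (A' := Set.univ)
      (Subtype.val_injective (p := fun j => κ (z₀ j false) ∈ C))
      ((hZ.of_reachable H hz).full.isForest.mono (Set.subset_univ _))
    refine hforest.congr fun l _ b => ?_
    exact (congrArg κ (hzs (l, b) (Finset.mem_univ _))).trans (hst l b)
  card_eq := hB.card_eq

end IsMaxFullPair

theorem DeficientPartition.false_of_odd (H : DeficientPartition G κ n Δ D) (hq : 2 ≤ q)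
    (hodd : Odd q) (hr : Nat.card ι < (q + 1) * D)
    (hN : ∀ m, m + 1 < q → 2 * Δ * m < n * (m + 1)) (hcrit : IsEdgeCritical G κ D) : False := by
  have := H.finite
  obtain ⟨S, J, _, z₀, hZ⟩ := H.exists_isMaxFullPair
  obtain ⟨C, hCS, hne, hCq, hcl⟩ := hZ.full.exists_component hr
  obtain ⟨rfl, hL⟩ := hZ.card_eq_of_component H hCS hN hne hCq hcl
  have hB := hZ.blockSystem H hCS hcl hL
  obtain ⟨X, Y, hX, hY, hcard, hmX, hmY⟩ :=
    (hZ.treeSystem H hB (hB.onlyOppositeAdj H hN hcrit)).exists_partition hq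
  have hhalf : ∀ X ⊆ C,
      (meeting (fun l b => (blockOn G κ S C z₀ l b).image κ) X).card + 1 ≤ 2 * X.card →
        C.card ≤ 2 * X.card := by
    intro X hX hm
    obtain ⟨m, hm'⟩ : ∃ m, 2 * X.card = m + 1 := Nat.exists_eq_succ_of_ne_zero (by omega)
    by_contra! hlt
    refine (hN m (hm' ▸ hlt)).not_ge ?_
    calc n * (m + 1) = 2 * (n * X.card) := by rw [← hm']; ring
      _ ≤ 2 * (Δ * _) := Nat.mul_le_mul_left _ (hZ.mul_card_le_mul_card_meeting H hCS hcl hX)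
      _ ≤ 2 * (Δ * m) := Nat.mul_le_mul_left _ (Nat.mul_le_mul_left _ (by omega))
      _ = 2 * Δ * m := by ring
  have hX := hhalf X hX hmX
  have hY := hhalf Y hY hmY
  obtain ⟨t, ht⟩ := hodd
  omega

end Main

section Extremal

variable {r D d q k n m y Δ : ℕ}

theorem two_mul_mul_lt_of_lt (h : 2 * (Δ : ℝ) * (1 - 1 / ((q : ℝ) - 1)) < n) (hm : m + 1 < q) :
    2 * Δ * m < n * (m + 1) := by
  have hmq : (m : ℝ) + 1 ≤ q - 1 := by
    rw [le_sub_iff_add_le]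
    exact_mod_cast hm
  have hm0 : (0 : ℝ) < m + 1 := by positivity
  have hdiv : ((m : ℝ) + 1) / (q - 1) ≤ 1 := div_le_one_of_le₀ hmq (hm0.le.trans hmq)
  have hlt : (2 * Δ * m : ℝ) < n * (m + 1) :=
    calc (2 * Δ * m : ℝ) = 2 * Δ * (m + 1) - 2 * Δ * 1 := by ring
      _ ≤ 2 * Δ * (m + 1) - 2 * Δ * ((m + 1) / (q - 1)) := by gcongr
      _ = 2 * Δ * (1 - 1 / (q - 1)) * (m + 1) := by ring
      _ < n * (m + 1) := mul_lt_mul_of_pos_right h hm0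
  exact_mod_cast hlt

theorem six_mul_mul_lt_of_lt (h : 2 * (Δ : ℝ) * (1 - (6 * (D : ℝ) + 1) / (6 * (r : ℝ))) < n)
    (hy : 1 ≤ y) (hyr : y ≤ r) : 6 * Δ * y < 3 * n * y + 6 * Δ * D + Δ := by
  have hy0 : (0 : ℝ) < y := by exact_mod_cast hy
  have hyr' : (y : ℝ) ≤ r := by exact_mod_cast hyr
  have hdiv : (y : ℝ) / r ≤ 1 := div_le_one_of_le₀ hyr' (hy0.le.trans hyr')
  have hlt : (6 * Δ * y : ℝ) < 3 * n * y + 6 * Δ * D + Δ :=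
    calc (6 * Δ * y : ℝ)
        = 3 * (2 * Δ * (1 - (6 * D + 1) / (6 * r)) * y) + Δ * (6 * D + 1) * (y / r) := by
          field_simp
          ring
      _ < 3 * (n * y) + Δ * (6 * D + 1) * 1 := add_lt_add_of_lt_of_le (by gcongr) (by gcongr)
      _ = 3 * n * y + 6 * Δ * D + Δ := by ring
  exact_mod_cast hlt

theorem IsPartialTransversal.card_add_le {V : Type*} {G : SimpleGraph V} {c : G.Coloring (Fin r)}
    {T : Finset V} (hT : IsPartialTransversal G c T)
    (h : ¬ ∃ T, IsIndepTransversal G c (r + 1 - D) T) : T.card + D ≤ r := by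
  by_contra! hcard
  obtain ⟨T', hT', hcard'⟩ := Finset.exists_subset_card_eq (show r + 1 - D ≤ T.card by omega)
  exact h ⟨T', hT.indep.mono hT', hT.injOn.mono hT', hcard'⟩

theorem bound_of_existsGraphWithoutIT (hr : r = q * (d + 1) + k) (hk : k ≤ d) (hq : 3 ≤ q)
    (hodd : Odd q) (h : ExistsGraphWithoutIT r (d + 1) Δ n) :
    (n : ℝ) ≤ max (2 * (Δ : ℝ) * (1 - (6 * (d : ℝ) + 7) / (6 * (r : ℝ))))
      (2 * (Δ : ℝ) * (1 - 1 / ((q : ℝ) - 1))) := by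
  by_contra! hlt
  obtain ⟨hlt, hlt'⟩ := max_lt_iff.1 hlt
  obtain ⟨V, _, G₀, _, c, hn, rfl, hIT⟩ := h
  obtain ⟨G, hle, hmissing, hcrit⟩ := exists_isEdgeCritical (D := d + 1) (κ := c) (G₀ := G₀)
    fun T hT => by simpa only [Nat.card_fin] using hT.card_add_le hIT
  have hD : 6 * (d : ℝ) + 7 = 6 * ((d + 1 : ℕ) : ℝ) + 1 := by push_cast; ring
  have H : DeficientPartition G c n G₀.maxDegree (d + 1) :=
    { degree_le := fun v => (SimpleGraph.degree_le_of_le hle).trans (G₀.degree_le_maxDegree v)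
      size := fun i => (hn i).trans_eq <| by
        rw [← Set.ncard_coe_finset]
        congr 1
        ext v
        exact (mem_classUnion.trans Finset.mem_singleton).symm
      missing := hmissing
      one_le := Nat.le_add_left 1 d
      tight := fun y hy hyr => six_mul_mul_lt_of_lt (hD ▸ hlt) hy (hyr.trans_eq (Nat.card_fin r)) }
  refine H.false_of_odd (by omega) hodd ?_ (fun m => two_mul_mul_lt_of_lt hlt') hcrit
  rw [Nat.card_fin, hr, add_mul]
  omega

theorem completeBipartiteGraph_isRegularOfDegree (α : Type*) [Fintype α] :
    (completeBipartiteGraph α α).IsRegularOfDegree (Fintype.card α) := by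
  have hl : ∀ v, (completeBipartiteGraph α α).neighborFinset (Sum.inl v) =
      Finset.univ.map Function.Embedding.inr := fun v => by ext (u | u) <;> simp
  have hr : ∀ v, (completeBipartiteGraph α α).neighborFinset (Sum.inr v) =
      Finset.univ.map Function.Embedding.inl := fun v => by ext (u | u) <;> simp
  rintro (v | v)
  · rw [← SimpleGraph.card_neighborFinset_eq_degree, hl, Finset.card_map, Finset.card_univ]
  · rw [← SimpleGraph.card_neighborFinset_eq_degree, hr, Finset.card_map, Finset.card_univ]

theorem existsGraphWithoutIT_zero (h : D + 2 ≤ r) : ExistsGraphWithoutIT r D Δ 0 := by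
  let col : Fin Δ ⊕ Fin Δ → Fin r := Sum.elim (fun _ => ⟨0, by omega⟩) fun _ => ⟨1, by omega⟩
  refine ⟨Fin Δ ⊕ Fin Δ, inferInstance, completeBipartiteGraph (Fin Δ) (Fin Δ), inferInstance,
    SimpleGraph.Coloring.mk col ?_, fun _ => Nat.zero_le _, ?_, ?_⟩
  · rintro (u | u) (v | v) huv <;> simp_all [col]
  · obtain rfl | hΔ := Nat.eq_zero_or_pos Δ
    · exact SimpleGraph.maxDegree_of_subsingleton _
    · have : Nonempty (Fin Δ ⊕ Fin Δ) := ⟨Sum.inl ⟨0, hΔ⟩⟩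
      simpa using (completeBipartiteGraph_isRegularOfDegree (Fin Δ)).maxDegree_eq
  · rintro ⟨T, -, hinj, hcard⟩
    have hle : T.card ≤ ({⟨0, by omega⟩, ⟨1, by omega⟩} : Finset (Fin r)).card := by
      refine Finset.card_le_card_of_injOn col (fun v _ => ?_) hinj
      rcases v with v | v <;> simp [col]
    have htwo := hle.trans Finset.card_le_two
    omega

end Extremal

end IndepTransversal

theorem theorem1p4 (r d q k Δ : ℕ) (hr : r = q * (d + 1) + k) (hk : k ≤ d)
    (hq : 3 ≤ q) (hodd : Odd q) :
    IsGreatest {n : ℕ | ExistsGraphWithoutIT r (d + 1) Δ n} (nExtremal r (d + 1) Δ) ∧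
    (nExtremal r (d + 1) Δ : ℝ) ≤
      max (2 * (Δ : ℝ) * (1 - (6 * (d : ℝ) + 7) / (6 * (r : ℝ))))
        (2 * (Δ : ℝ) * (1 - 1 / ((q : ℝ) - 1))) := by
  have hbound : ∀ n ∈ {n : ℕ | ExistsGraphWithoutIT r (d + 1) Δ n}, (n : ℝ) ≤
      max (2 * (Δ : ℝ) * (1 - (6 * (d : ℝ) + 7) / (6 * (r : ℝ))))
        (2 * (Δ : ℝ) * (1 - 1 / ((q : ℝ) - 1))) := fun n hn =>
    IndepTransversal.bound_of_existsGraphWithoutIT hr hk hq hodd hn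
  have hbdd : BddAbove {n : ℕ | ExistsGraphWithoutIT r (d + 1) Δ n} :=
    ⟨_, fun n hn => Nat.le_floor (hbound n hn)⟩
  have hne : {n : ℕ | ExistsGraphWithoutIT r (d + 1) Δ n}.Nonempty :=
    ⟨0, IndepTransversal.existsGraphWithoutIT_zero (by
      have := Nat.mul_le_mul_right (d + 1) hq
      omega)⟩
  have hmem := Nat.sSup_mem hne hbdd
  exact ⟨⟨hmem, fun n hn => le_csSup hbdd hn⟩, hbound _ hmem⟩
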